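/- **Strategies.** Let $K$ be a finite simplicial complex (only nonempty faces are counted). A discrete Morse strategy deconstructs $K$ step by step until nothing is left. If the current complex has top dimension $d$ and has free $(d-1)$-faces (i.e. $(d-1)$-faces properly contained in exactly one face), one of them is chosen and deleted together with the unique face containing it; otherwise one of the $d$-faces is chosen, declared critical, and deleted. In the strategy `random` ($i=1$) every choice is uniformly random among the available faces. In `random-lex-first` ($i=2$) and `random-lex-last` ($i=3$) the vertices are first relabeled uniformly at random by $1,\dots,n$, and then every choice is the lexicographically smallest, respectively largest, available face. Let $X_i(K)$ be the total number of critical faces, $\mathbb E_i(K)$ its expected value, $f_3(K)$ the number of $3$-faces of $K$, and $\mathrm{sd}^\ell K$ the $\ell$-th barycentric subdivision. **Theorem.** Let $T$ be a tetrahedron. There are a universal $\alpha\in\mathbb N$ and a subcomplex $D$ of $\mathrm{sd}^{\alpha}T$, disjoint from the boundary of $\mathrm{sd}^\alpha T$ and triangulating the dunce hat, such that for each $i\in\{1,2,3\}$ the probability $p_i$ that strategy $i$ collapses $\mathrm{sd}^{\alpha}T$ (without declaring any face critical) to a complex of dimension at most $2$ containing $D$ is positive, and such that the following holds for every finite simplicial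 complex $K$ of dimension $3$ and every $i\in\{1,2,3\}$. 1. For all integers $\ell\ge 0$ and $m\ge 0$, $$\mathbb P\big[X_i(\mathrm{sd}^{\ell+\alpha}K)\le m\big]\le (1-p_i)^{24^{\ell} f_3(K)-m}$$ (where $0^0=1$ and $0^{-k}=\infty$ for $k>0$). 2. $\log \mathbb E_i(\mathrm{sd}^{\ell}K)=\Omega(\ell)$, i.e. there is a constant $c>0$ (which may depend on $K$ and $i$) such that $\log\mathbb E_i(\mathrm{sd}^{\ell}K)\ge c\,\ell$ for all sufficiently large $\ell$. -/

import Mathlib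

open scoped ENNReal

universe u

noncomputable section

/-! ### Finite simplicial complexes -/

/-- A finite abstract simplicial complex: a finite family of nonempty finite sets, closed under
passing to nonempty subsets. The empty set is not counted as a face. -/
structure FinComplex (V : Type u) extends PreAbstractSimplicialComplex V where
  finite : faces.Finite

namespace FinComplex

variable {V : Type u}

/-- The faces of `K`, as a finset. -/
def faceFinset (K : FinComplex V) : Finset (Finset V) := K.finite.toFinset

/-- The number `f_i(K)` of `i`-dimensional faces. -/
def f (K : FinComplex V) (i : ℕ) : ℕ := {σ ∈ K.faceFinset | σ.card = i + 1}.card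

/-- `K` is a `d`-complex: its dimension is exactly `d` (it need not be pure). -/
def HasDim (K : FinComplex V) (d : ℕ) : Prop :=
  (∀ σ ∈ K.faces, σ.card ≤ d + 1) ∧ ∃ σ ∈ K.faces, σ.card = d + 1

open Classical in
/-- The vertices that really occur in `K` (the type `V` may be larger). -/
def verts (K : FinComplex V) : Finset V := K.faceFinset.biUnion id

/-- The barycentric subdivision: its vertices are the faces of `K`, its faces are the nonempty
chains of faces of `K`. -/
def sd (K : FinComplex V) : FinComplex (Finset V) where
  faces := {C | C.Nonempty ∧ (∀ σ ∈ C, σ ∈ K.faces) ∧ ∀ σ ∈ C, ∀ τ ∈ C, σ ⊆ τ ∨ τ ⊆ σ}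
  isRelLowerSet_faces := fun _ hC => ⟨hC.1, fun _ hB hne =>
    ⟨hne, fun σ h => hC.2.1 σ (hB h), fun σ h τ h' => hC.2.2 σ (hB h) τ (hB h')⟩⟩
  finite := (K.finite.toFinset.powerset.finite_toSet).subset fun C hC => by
    simp only [Finset.coe_powerset, Set.mem_preimage, Set.mem_powerset_iff]
    intro σ hσ
    simpa using hC.2.1 σ hσ

end FinComplex

/-- The ambient vertex type of the `n`-th barycentric subdivision of a complex on `V`. -/
def SdVertex (V : Type u) : ℕ → Type u
  | 0 => V
  | n + 1 => Finset (SdVertex V n)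

/-- The `n`-th iterated barycentric subdivision `sd^n K`. -/
def FinComplex.sdIter {V : Type u} (K : FinComplex V) : (n : ℕ) → FinComplex (SdVertex V n)
  | 0 => K
  | n + 1 => (K.sdIter n).sd

/-- The tetrahedron (all nonempty subsets of a four element set). -/
def tetrahedron : FinComplex (Fin 4) where
  faces := {σ | σ.Nonempty}
  isRelLowerSet_faces := fun _ h => ⟨h, fun _ _ h' => h'⟩
  finite := Set.toFinite _

/-- The boundary of the tetrahedron (all nonempty proper subsets). -/
def tetrahedronBoundary : FinComplex (Fin 4) where
  faces := {σ | σ.Nonempty ∧ σ ≠ Finset.univ}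
  isRelLowerSet_faces := fun _ h => ⟨h.1, fun _ hs h' =>
    ⟨h', fun e => h.2 (Finset.univ_subset_iff.mp (e ▸ hs))⟩⟩
  finite := Set.toFinite _

/-! ### The dunce hat -/

/-- The geometric realization of a finite complex, in barycentric coordinates. -/
def FinComplex.realization {V : Type u} (K : FinComplex V) : Set (V → ℝ) :=
  {x | (∀ v, 0 ≤ x v) ∧ ∃ σ ∈ K.faces, (∀ v, v ∉ σ → x v = 0) ∧ ∑ v ∈ σ, x v = 1}

/-- Identification, in a triangle with vertices `v₀, v₁, v₂`, of the three directed edges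
`v₀v₁`, `v₁v₂` and `v₀v₂` (the boundary word is `a a a⁻¹`). -/
def dunceHatRel (x y : stdSimplex ℝ (Fin 3)) : Prop :=
  ∃ t : ℝ, x.1 = ![1 - t, t, 0] ∧ (y.1 = ![0, 1 - t, t] ∨ y.1 = ![1 - t, 0, t])

/-- The dunce hat, with the quotient topology (by the equivalence relation generated by
`dunceHatRel`). -/
abbrev DunceHat : Type := Quot dunceHatRel

/-- `D` triangulates the dunce hat. -/
def FinComplex.IsDunceHat {V : Type u} (D : FinComplex V) : Prop :=
  Nonempty (D.realization ≃ₜ DunceHat)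

/-! ### The random discrete Morse strategies -/

/-- A state of a run: the set of faces still present, and the number of faces declared critical
so far. -/
abbrev MorseState (V : Type u) : Type u := Finset (Finset V) × ℕ

/-- A (random) rule to pick an element of a nonempty set of faces. -/
abbrev Selector (V : Type u) : Type u :=
  (A : Finset (Finset V)) → A.Nonempty → PMF (Finset V)

section Run

variable {V : Type u}

/-- The faces of top dimension of the current complex. -/
def topFaces (S : Finset (Finset V)) : Finset (Finset V) :=
  {σ ∈ S | σ.card = S.sup Finset.card}

open Classical in
/-- The free codimension-one faces of the current complex: faces of dimension one below the top
that are properly contained in exactly one face. -/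
def freeFaces (S : Finset (Finset V)) : Finset (Finset V) :=
  {σ ∈ S | σ.card + 1 = S.sup Finset.card ∧ {τ ∈ S | σ ⊂ τ}.card = 1}

open Classical in
/-- Delete `σ` together with all faces that contain it. If `σ` is a free face this is the elementary
collapse at `σ`; if `σ` is a face of top dimension it deletes only `σ`. -/
def deleteFace (S : Finset (Finset V)) (σ : Finset V) : Finset (Finset V) :=
  {τ ∈ S | ¬ σ ⊆ τ}

open Classical in
/-- One step: if there are free codimension-one faces, pick one of them and collapse;
otherwise pick a face of top dimension, declare it critical and delete it. Nothing happens
to the empty complex. -/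
def morseStep (sel : Selector V) (s : MorseState V) : PMF (MorseState V) :=
  if h : (freeFaces s.1).Nonempty then
    (sel (freeFaces s.1) h).map fun σ => (deleteFace s.1 σ, s.2)
  else if h' : (topFaces s.1).Nonempty then
    (sel (topFaces s.1) h').map fun σ => (deleteFace s.1 σ, s.2 + 1)
  else PMF.pure s

open Classical in
/-- At most `n` steps, halting as soon as the current complex satisfies `halt`. -/
def morseRun (sel : Selector V) (halt : Finset (Finset V) → Prop) :
    ℕ → MorseState V → PMF (MorseState V)
  | 0, s => PMF.pure s
  | n + 1, s => if halt s.1 then PMF.pure s else (morseStep sel s).bind (morseRun sel halt n)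

/-- Pick uniformly at random. -/
def uniformSelector : Selector V := fun A h => PMF.uniformOfFinset A h

open Classical in
/-- The increasing list of the labels of the vertices of a face; lists are compared
lexicographically. -/
def lexKey (lab : V → ℕ) (σ : Finset V) : List ℕ := (σ.image lab).sort (· ≤ ·)

/-- Pick the lexicographically smallest face. -/
def lexFirstSelector (lab : V → ℕ) : Selector V := fun A h =>
  PMF.pure (A.exists_min_image (lexKey lab) h).choose

/-- Pick the lexicographically largest face. -/
def lexLastSelector (lab : V → ℕ) : Selector V := fun A h =>
  PMF.pure (A.exists_max_image (lexKey lab) h).choose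

/-- The relabelings of the `n` vertices of `K` by `n` consecutive numbers. -/
abbrev FinComplex.Relabeling (K : FinComplex V) : Type u := K.verts ≃ Fin K.verts.card

open Classical in
/-- The label of a vertex (only the values on the vertices of `K` matter). -/
def FinComplex.label (K : FinComplex V) (e : K.Relabeling) (v : V) : ℕ :=
  if h : v ∈ K.verts then (e ⟨v, h⟩ : ℕ) + 1 else 0

open Classical in
/-- A uniformly random relabeling of the vertices of `K`. -/
def FinComplex.randomRelabeling (K : FinComplex V) : PMF K.Relabeling :=
  haveI : Nonempty K.Relabeling := ⟨K.verts.equivFin⟩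
  PMF.uniformOfFintype K.Relabeling

end Run

/-- The three strategies. -/
inductive MorseStrategy : Type
  | random
  | randomLexFirst
  | randomLexLast

section Strategies

variable {V : Type u}

/-- The random state in which the strategy, started on `K` with no critical faces, halts.
Every step deletes a face as long as there is one, so `#K` steps suffice. -/
def MorseStrategy.law (i : MorseStrategy) (K : FinComplex V) (halt : Finset (Finset V) → Prop) :
    PMF (MorseState V) :=
  match i with
  | .random => morseRun uniformSelector halt K.faceFinset.card (K.faceFinset, 0)
  | .randomLexFirst => K.randomRelabeling.bind fun e =>
      morseRun (lexFirstSelector (K.label e)) halt K.faceFinset.card (K.faceFinset, 0)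
  | .randomLexLast => K.randomRelabeling.bind fun e =>
      morseRun (lexLastSelector (K.label e)) halt K.faceFinset.card (K.faceFinset, 0)

/-- The distribution of the number `X_i(K)` of critical faces in a complete run on `K`. -/
def MorseStrategy.X (i : MorseStrategy) (K : FinComplex V) : PMF ℕ :=
  (i.law K (fun S => S = ∅)).map Prod.snd

/-- The expected number `𝔼_i(K)` of critical faces. -/
def MorseStrategy.E (i : MorseStrategy) (K : FinComplex V) : ℝ :=
  ∫ n, (n : ℝ) ∂(i.X K).toMeasure

/-- The probability that the strategy collapses `K` to a complex of dimension at most `2` that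
contains `D`: when the dimension first drops to at most `2`, no face has been declared critical
and all faces of `D` are still present. -/
def MorseStrategy.findProb (i : MorseStrategy) (K D : FinComplex V) : ℝ≥0∞ :=
  (i.law K (fun S => ∀ σ ∈ S, σ.card ≤ 3)).toOuterMeasure
    {s | s.2 = 0 ∧ (∀ σ ∈ s.1, σ.card ≤ 3) ∧ D.faceFinset ⊆ s.1}

end Strategies

end

noncomputable section

/-! ### Expectations with respect to a probability mass function -/

namespace PMF

variable {α β : Type*}

/-- The expectation of an extended nonnegative function. -/
def expect (p : PMF α) (f : α → ℝ≥0∞) : ℝ≥0∞ := ∑' a, p a * f a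

lemma expect_pure (a : α) (f : α → ℝ≥0∞) : (PMF.pure a).expect f = f a := by
  classical
  unfold expect
  rw [tsum_eq_single a]
  · simp
  · intro b hb
    simp [PMF.pure_apply, hb]

lemma expect_bind (p : PMF α) (q : α → PMF β) (f : β → ℝ≥0∞) :
    (p.bind q).expect f = p.expect fun a => (q a).expect f := by
  unfold expect
  simp_rw [PMF.bind_apply, ← ENNReal.tsum_mul_right, ← ENNReal.tsum_mul_left]
  rw [ENNReal.tsum_comm]
  simp_rw [mul_assoc]

lemma expect_map (p : PMF α) (g : α → β) (f : β → ℝ≥0∞) :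
    (p.map g).expect f = p.expect fun a => f (g a) := by
  unfold PMF.map
  rw [expect_bind]
  simp [expect_pure]

lemma expect_mono_support (p : PMF α) {f g : α → ℝ≥0∞} (h : ∀ a ∈ p.support, f a ≤ g a) :
    p.expect f ≤ p.expect g := by
  refine ENNReal.tsum_le_tsum fun a => ?_
  by_cases ha : a ∈ p.support
  · gcongr
    exact h a ha
  · rw [PMF.mem_support_iff, not_not] at ha
    simp [ha]

lemma expect_const (p : PMF α) (c : ℝ≥0∞) : p.expect (fun _ => c) = c := by
  unfold expect
  rw [ENNReal.tsum_mul_right, p.tsum_coe, one_mul]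

lemma toOuterMeasure_eq_expect (p : PMF α) (s : Set α) :
    p.toOuterMeasure s = p.expect (s.indicator fun _ => 1) := by
  rw [PMF.toOuterMeasure_apply]
  unfold expect
  congr 1
  ext a
  by_cases h : a ∈ s <;> simp [h]

lemma expect_uniformOfFinset (A : Finset α) (h : A.Nonempty) (f : α → ℝ≥0∞) :
    (PMF.uniformOfFinset A h).expect f = (A.card : ℝ≥0∞)⁻¹ * ∑ a ∈ A, f a := by
  classical
  unfold expect
  rw [tsum_eq_sum (s := A), Finset.mul_sum]
  · refine Finset.sum_congr rfl fun a ha => ?_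
    rw [PMF.uniformOfFinset_apply_of_mem _ ha]
  · intro a ha
    rw [PMF.uniformOfFinset_apply_of_notMem _ ha, zero_mul]

lemma expect_uniformOfFintype [Fintype α] [Nonempty α] (f : α → ℝ≥0∞) :
    (PMF.uniformOfFintype α).expect f = (Fintype.card α : ℝ≥0∞)⁻¹ * ∑ a, f a := by
  unfold PMF.uniformOfFintype
  rw [expect_uniformOfFinset]
  rfl

end PMF

/-! ### Runs of a strategy -/

section Run

variable {V : Type u} {sel : Selector V} {halt : Finset (Finset V) → Prop}

lemma morseRun_invariant {Inv : MorseState V → Prop}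
    (hInv : ∀ s, Inv s → ¬ halt s.1 → ∀ s' ∈ (morseStep sel s).support, Inv s') :
    ∀ n s, Inv s → ∀ s' ∈ (morseRun sel halt n s).support, Inv s' := by
  intro n
  induction n with
  | zero =>
    intro s hs s' hs'
    simp only [morseRun, PMF.support_pure, Set.mem_singleton_iff] at hs'
    exact hs' ▸ hs
  | succ n ih =>
    intro s hs s' hs'
    rw [morseRun] at hs'
    split_ifs at hs' with hh
    · simp only [PMF.support_pure, Set.mem_singleton_iff] at hs'
      exact hs' ▸ hs
    · obtain ⟨r, hr, hr'⟩ := (PMF.mem_support_bind_iff _ _ _).1 hs'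
      exact ih r (hInv s hs hh r hr) s' hr'

lemma expect_morseRun_le {Inv : MorseState V → Prop} {Φ : MorseState V → ℝ≥0∞}
    (hInv : ∀ s, Inv s → ¬ halt s.1 → ∀ s' ∈ (morseStep sel s).support, Inv s')
    (hΦ : ∀ s, Inv s → ¬ halt s.1 → (morseStep sel s).expect Φ ≤ Φ s) :
    ∀ n s, Inv s → (morseRun sel halt n s).expect Φ ≤ Φ s := by
  intro n
  induction n with
  | zero =>
    intro s _
    simp [morseRun, PMF.expect_pure]
  | succ n ih =>
    intro s hs
    rw [morseRun]
    split_ifs with hh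
    · simp [PMF.expect_pure]
    · rw [PMF.expect_bind]
      exact (PMF.expect_mono_support _ fun r hr => ih r (hInv s hs hh r hr)).trans (hΦ s hs hh)

lemma exists_mem_support_morseRun {Good : MorseState V → Prop}
    (hGood : ∀ s, Good s → ¬ halt s.1 → ∃ s' ∈ (morseStep sel s).support, Good s') :
    ∀ n s, Good s → ∃ s' ∈ (morseRun sel halt n s).support, Good s' := by
  intro n
  induction n with
  | zero =>
    intro s hs
    exact ⟨s, by simp [morseRun], hs⟩
  | succ n ih =>
    intro s hs
    rw [morseRun]
    split_ifs with hh
    · exact ⟨s, by simp, hs⟩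
    · obtain ⟨r, hr, hr'⟩ := hGood s hs hh
      obtain ⟨s', hs', hg⟩ := ih r hr'
      exact ⟨s', (PMF.mem_support_bind_iff _ _ _).2 ⟨r, hr, hs'⟩, hg⟩

/-- A selector picks elements of the set that it is given. -/
def Selector.Proper (sel : Selector V) : Prop :=
  ∀ A h, ∀ σ ∈ (sel A h).support, σ ∈ A

lemma mem_support_morseStep (hsel : sel.Proper) {s s' : MorseState V}
    (h : s' ∈ (morseStep sel s).support) (hne : s.1.Nonempty) :
    (∃ σ ∈ freeFaces s.1, s' = (deleteFace s.1 σ, s.2)) ∨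
      (freeFaces s.1 = ∅ ∧ ∃ σ ∈ topFaces s.1, s' = (deleteFace s.1 σ, s.2 + 1)) := by
  unfold morseStep at h
  split_ifs at h with h1 h2
  · obtain ⟨σ, hσ, rfl⟩ := (PMF.mem_support_map_iff _ _ _).1 h
    exact Or.inl ⟨σ, hsel _ _ _ hσ, rfl⟩
  · obtain ⟨σ, hσ, rfl⟩ := (PMF.mem_support_map_iff _ _ _).1 h
    exact Or.inr ⟨Finset.not_nonempty_iff_eq_empty.1 h1, σ, hsel _ _ _ hσ, rfl⟩
  · exfalso
    apply h2
    obtain ⟨σ, hσ, h⟩ := Finset.exists_mem_eq_sup s.1 hne Finset.card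
    exact ⟨σ, by simp [topFaces, hσ, h]⟩

open Classical in
lemma deleteFace_subset (S : Finset (Finset V)) (σ : Finset V) : deleteFace S σ ⊆ S :=
  Finset.filter_subset _ _

lemma card_deleteFace_lt {S : Finset (Finset V)} {σ : Finset V} (h : σ ∈ S) :
    (deleteFace S σ).card < S.card := by
  refine Finset.card_lt_card ⟨deleteFace_subset S σ, fun hs => ?_⟩
  have := hs h
  simp [deleteFace] at this

lemma mem_of_mem_freeFaces {S : Finset (Finset V)} {σ : Finset V} (h : σ ∈ freeFaces S) : σ ∈ S :=
  (Finset.mem_filter.1 h).1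

lemma mem_of_mem_topFaces {S : Finset (Finset V)} {σ : Finset V} (h : σ ∈ topFaces S) : σ ∈ S :=
  (Finset.mem_filter.1 h).1

/-- A run with enough steps halts. -/
lemma halt_of_mem_support_morseRun (hsel : sel.Proper) (h0 : halt ∅) :
    ∀ n s, s.1.card ≤ n → ∀ s' ∈ (morseRun sel halt n s).support, halt s'.1 := by
  intro n
  induction n with
  | zero =>
    intro s hs s' hs'
    simp only [morseRun, PMF.support_pure, Set.mem_singleton_iff] at hs'
    subst hs'
    have : s'.1 = ∅ := by simpa using hs
    rw [this]
    exact h0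
  | succ n ih =>
    intro s hs s' hs'
    rw [morseRun] at hs'
    split_ifs at hs' with hh
    · simp only [PMF.support_pure, Set.mem_singleton_iff] at hs'
      exact hs' ▸ hh
    · obtain ⟨r, hr, hr'⟩ := (PMF.mem_support_bind_iff _ _ _).1 hs'
      refine ih r ?_ s' hr'
      have hne : s.1.Nonempty := by
        rw [Finset.nonempty_iff_ne_empty]
        exact fun h => hh (h ▸ h0)
      rcases mem_support_morseStep hsel hr hne with ⟨σ, hσ, rfl⟩ | ⟨_, σ, hσ, rfl⟩
      · have := card_deleteFace_lt (mem_of_mem_freeFaces hσ)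
        simp only
        omega
      · have := card_deleteFace_lt (mem_of_mem_topFaces hσ)
        simp only
        omega

lemma proper_uniformSelector : (uniformSelector : Selector V).Proper := by
  intro A h σ hσ
  simpa [uniformSelector, PMF.mem_support_uniformOfFinset_iff] using hσ

lemma proper_lexFirstSelector (lab : V → ℕ) : (lexFirstSelector lab).Proper := by
  intro A h σ hσ
  simp only [lexFirstSelector, PMF.support_pure, Set.mem_singleton_iff] at hσ
  subst hσ
  exact (A.exists_min_image (lexKey lab) h).choose_spec.1

lemma proper_lexLastSelector (lab : V → ℕ) : (lexLastSelector lab).Proper := by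
  intro A h σ hσ
  simp only [lexLastSelector, PMF.support_pure, Set.mem_singleton_iff] at hσ
  subst hσ
  exact (A.exists_max_image (lexKey lab) h).choose_spec.1

end Run

/-! ### Cells and their barycentric subdivisions -/

namespace FinComplex

variable {V : Type u} {N : FinComplex V} {U D : Set (Finset V)}

lemma nonempty_of_mem {σ : Finset V} (h : σ ∈ N.faces) : σ.Nonempty :=
  (N.isRelLowerSet_faces h).1

lemma mem_of_subset {σ τ : Finset V} (h : σ ∈ N.faces) (hτ : τ ⊆ σ) (hne : τ.Nonempty) :
    τ ∈ N.faces :=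
  (N.isRelLowerSet_faces h).2 hτ hne

/-- All faces have at most four vertices. -/
def DimLE3 (N : FinComplex V) : Prop := ∀ σ ∈ N.faces, σ.card ≤ 4

lemma sd_chain {C : Finset (Finset V)} (hC : C ∈ N.sd.faces) {σ τ : Finset V} (hσ : σ ∈ C)
    (hτ : τ ∈ C) : σ ⊆ τ ∨ τ ⊆ σ := hC.2.2 σ hσ τ hτ

lemma sd_subset_of_card_le {C : Finset (Finset V)} (hC : C ∈ N.sd.faces) {σ τ : Finset V}
    (hσ : σ ∈ C) (hτ : τ ∈ C) (h : σ.card ≤ τ.card) : σ ⊆ τ := by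
  rcases sd_chain hC hσ hτ with h' | h'
  · exact h'
  · exact (Finset.eq_of_subset_of_card_le h' h).symm ▸ subset_rfl

lemma sd_card_injOn {C : Finset (Finset V)} (hC : C ∈ N.sd.faces) :
    Set.InjOn Finset.card (C : Set (Finset V)) := fun _ hσ _ hτ h =>
  (sd_subset_of_card_le hC hσ hτ h.le).antisymm (sd_subset_of_card_le hC hτ hσ h.ge)

lemma DimLE3.sd (hN : N.DimLE3) : N.sd.DimLE3 := by
  intro C hC
  have h := Finset.card_le_card_of_injOn (t := Finset.Icc 1 4) Finset.card
    (fun σ hσ => by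
      have h1 := hC.2.1 σ hσ
      have h2 := Finset.card_pos.2 (nonempty_of_mem h1)
      have h3 := hN σ h1
      simp only [Finset.coe_Icc, Set.mem_Icc]
      omega) (sd_card_injOn hC)
  simpa using h

/-- The chains that meet `U`. -/
def sdUp (N : FinComplex V) (U : Set (Finset V)) : Set (Finset (Finset V)) :=
  {C | C ∈ N.sd.faces ∧ ∃ σ ∈ C, σ ∈ U}

/-- The interior faces of a triangulated three-dimensional cell: an upper set of faces, pure of
dimension three, in which each triangle lies in exactly two tetrahedra. -/
structure IsCell (N : FinComplex V) (U : Set (Finset V)) : Prop where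
  sub : U ⊆ N.faces
  up : ∀ σ ∈ U, ∀ τ ∈ N.faces, σ ⊆ τ → τ ∈ U
  pure : ∀ σ ∈ U, ∃ τ ∈ U, σ ⊆ τ ∧ τ.card = 4
  two : ∀ σ ∈ U, σ.card = 3 → ∃ s₁ ∈ U, ∃ s₂ ∈ U, s₁ ≠ s₂ ∧ σ ⊂ s₁ ∧ σ ⊂ s₂ ∧
    ∀ s ∈ N.faces, σ ⊂ s → s = s₁ ∨ s = s₂

/-- The tetrahedra of the cell are connected through triangles that are not bad. -/
def ConnAvoid (U : Set (Finset V)) (Bad : Finset V → Prop) : Prop :=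
  ∀ B : Set (Finset V), (∀ σ ∈ U, σ.card = 3 → ¬ Bad σ → ∀ s ∈ U, ∀ s' ∈ U, s.card = 4 →
    s'.card = 4 → σ ⊂ s → σ ⊂ s' → s ∈ B → s' ∈ B) →
    ∀ s ∈ U, ∀ s' ∈ U, s.card = 4 → s'.card = 4 → s ∈ B → s' ∈ B

lemma isCell_singleton (hN : N.DimLE3) {Δ : Finset V} (h : Δ ∈ N.faces) (hc : Δ.card = 4) :
    N.IsCell {Δ} where
  sub := by simpa using h
  up := by
    rintro σ rfl τ hτ hs
    exact (Finset.eq_of_subset_of_card_le hs (by have := hN τ hτ; omega)).symm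
  pure := by
    rintro σ rfl
    exact ⟨σ, rfl, subset_rfl, hc⟩
  two := by
    rintro σ rfl h3
    omega

lemma connAvoid_singleton (Δ : Finset V) (Bad : Finset V → Prop) : ConnAvoid {Δ} Bad := by
  rintro B _ s rfl s' rfl _ _ h
  exact h

lemma exists_triple_of_card_three {C : Finset (Finset V)} (hN : N.DimLE3) (hC : C ∈ N.sd.faces)
    (h3 : C.card = 3) : ∃ x ∈ C, ∃ y ∈ C, ∃ z ∈ C, x ⊂ y ∧ y ⊂ z ∧ 1 ≤ x.card ∧
      x.card < y.card ∧ y.card < z.card ∧ z.card ≤ 4 ∧ ∀ w ∈ C, w = x ∨ w = y ∨ w = z := by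
  classical
  obtain ⟨a, b, c, hab, hac, hbc, rfl⟩ := Finset.card_eq_three.1 h3
  have key : ∀ x y z : Finset V, ({a, b, c} : Finset (Finset V)) = {x, y, z} → x.card < y.card →
      y.card < z.card → ∃ x ∈ ({a, b, c} : Finset (Finset V)), ∃ y ∈ ({a, b, c} : Finset (Finset V)),
      ∃ z ∈ ({a, b, c} : Finset (Finset V)), x ⊂ y ∧ y ⊂ z ∧ 1 ≤ x.card ∧
      x.card < y.card ∧ y.card < z.card ∧ z.card ≤ 4 ∧
      ∀ w ∈ ({a, b, c} : Finset (Finset V)), w = x ∨ w = y ∨ w = z := by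
    intro x y z he h1 h2
    rw [he] at hC ⊢
    have hx : x ∈ ({x, y, z} : Finset (Finset V)) := by simp
    have hy : y ∈ ({x, y, z} : Finset (Finset V)) := by simp
    have hz : z ∈ ({x, y, z} : Finset (Finset V)) := by simp
    refine ⟨x, hx, y, hy, z, hz, ?_, ?_, Finset.card_pos.2 (nonempty_of_mem (hC.2.1 x hx)), h1, h2,
      hN z (hC.2.1 z hz), fun w hw => by simpa using hw⟩
    · exact (sd_subset_of_card_le hC hx hy h1.le).ssubset_of_ne (by rintro rfl; omega)
    · exact (sd_subset_of_card_le hC hy hz h2.le).ssubset_of_ne (by rintro rfl; omega)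
  have hi := sd_card_injOn hC
  have h1 : a.card ≠ b.card := fun h => hab (hi (by simp) (by simp) h)
  have h2 : a.card ≠ c.card := fun h => hac (hi (by simp) (by simp) h)
  have h4 : b.card ≠ c.card := fun h => hbc (hi (by simp) (by simp) h)
  rcases lt_or_gt_of_ne h1 with h1 | h1 <;> rcases lt_or_gt_of_ne h2 with h2 | h2 <;>
    rcases lt_or_gt_of_ne h4 with h4 | h4
  · exact key a b c rfl h1 h4
  · exact key a c b (by ext; simp; tauto) h2 h4
  · omega
  · exact key c a b (by ext; simp; tauto) h2 h1
  · exact key b a c (by ext; simp; tauto) h1 h2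
  · omega
  · exact key b c a (by ext; simp; tauto) h4 h2
  · exact key c b a (by ext; simp; tauto) h4 h1

open Classical in
lemma insert_mem_sd {C : Finset (Finset V)} (hC : C ∈ N.sd.faces) {w : Finset V}
    (hw : w ∈ N.faces) (h : ∀ r ∈ C, r ⊆ w ∨ w ⊆ r) : insert w C ∈ N.sd.faces := by
  refine ⟨Finset.insert_nonempty _ _, ?_, ?_⟩
  · intro σ hσ
    rcases Finset.mem_insert.1 hσ with rfl | hσ
    exacts [hw, hC.2.1 σ hσ]
  · intro σ hσ τ hτ
    rcases Finset.mem_insert.1 hσ with rfl | hσ' <;> rcases Finset.mem_insert.1 hτ with rfl | hτ'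
    · exact Or.inl subset_rfl
    · exact (h τ hτ').symm
    · exact h σ hσ'
    · exact sd_chain hC hσ' hτ'

open Classical in
/-- A coface of a chain with three elements adds one element. -/
lemma sd_coface {C s : Finset (Finset V)} (hN : N.DimLE3) (h3 : C.card = 3) (hs : s ∈ N.sd.faces)
    (hCs : C ⊂ s) : ∃ w, w ∉ C ∧ w ∈ N.faces ∧ s = insert w C ∧ s.card = 4 := by
  have h4 := hN.sd s hs
  have h5 := Finset.card_lt_card hCs
  have h6 : (s \ C).card = 1 := by
    rw [Finset.card_sdiff_of_subset hCs.1]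
    omega
  obtain ⟨w, hw⟩ := Finset.card_eq_one.1 h6
  have hw' : w ∈ s \ C := by simp [hw]
  rw [Finset.mem_sdiff] at hw'
  refine ⟨w, hw'.2, hs.2.1 w hw'.1, ?_, by omega⟩
  rw [← Finset.sdiff_union_of_subset hCs.1, hw]
  rfl

lemma eq_insert_of_between [DecidableEq V] {p q w : Finset V} {a b : V} (hq : q = insert a (insert b p)) (h1 : p ⊂ w)
    (h2 : w ⊂ q) : w = insert a p ∨ w = insert b p := by
  subst hq
  by_cases ha : a ∈ w
  · left
    have hb : b ∉ w := fun hb => h2.2 (Finset.insert_subset ha (Finset.insert_subset hb h1.1))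
    apply (Finset.insert_subset ha h1.1).antisymm'
    intro x hx
    have := h2.1 hx
    simp only [Finset.mem_insert] at this ⊢
    rcases this with h | rfl | h
    · exact Or.inl h
    · exact absurd hx hb
    · exact Or.inr h
  · right
    have hb : b ∈ w := by
      by_contra hb
      apply h1.2
      intro x hx
      have := h2.1 hx
      simp only [Finset.mem_insert] at this
      rcases this with rfl | rfl | h
      · exact absurd hx ha
      · exact absurd hx hb
      · exact h
    apply (Finset.insert_subset hb h1.1).antisymm'
    intro x hx
    have := h2.1 hx
    simp only [Finset.mem_insert] at this ⊢
    rcases this with rfl | h | h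
    · exact absurd hx ha
    · exact Or.inl h
    · exact Or.inr h

/-- A chain with a gap of two dimensions has exactly two ways to fill the gap. -/
lemma sd_two_of_gap (hN : N.DimLE3) {C : Finset (Finset V)} (hC : C ∈ N.sd.faces)
    (h3 : C.card = 3) {p q : Finset V} (hp : p = ∅ ∨ p ∈ C) (hq : q ∈ C) (hpq : p ⊆ q)
    (hc : q.card = p.card + 2) (hsep : ∀ r ∈ C, r ⊆ p ∨ q ⊆ r)
    (hbtw : ∀ w, w ∉ C → w ∈ N.faces → (∀ r ∈ C, r ⊆ w ∨ w ⊆ r) → w.card = p.card + 1) :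
    ∃ s₁ ∈ N.sd.faces, ∃ s₂ ∈ N.sd.faces, s₁ ≠ s₂ ∧ C ⊂ s₁ ∧ C ⊂ s₂ ∧
      ∀ s ∈ N.sd.faces, C ⊂ s → s = s₁ ∨ s = s₂ := by
  classical
  have h2 : (q \ p).card = 2 := by
    rw [Finset.card_sdiff_of_subset hpq]
    omega
  obtain ⟨a, b, hab, hqp⟩ := Finset.card_eq_two.1 h2
  have hq' : q = insert a (insert b p) := by
    rw [← Finset.sdiff_union_of_subset hpq, hqp]
    ext x
    simp
  have ha : a ∈ q \ p := by simp [hqp]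
  have hb : b ∈ q \ p := by simp [hqp]
  rw [Finset.mem_sdiff] at ha hb
  have hqN := hC.2.1 q hq
  have main : ∀ x ∈ q, x ∉ p → insert x p ∉ C ∧ insert (insert x p) C ∈ N.sd.faces := by
    intro x hx hxp
    have hcard : (insert x p).card = p.card + 1 := Finset.card_insert_of_notMem hxp
    have hxq : insert x p ⊆ q := Finset.insert_subset hx hpq
    constructor
    · intro hmem
      rcases hsep _ hmem with h | h
      · have := Finset.card_le_card h
        omega
      · have := Finset.card_le_card h
        omega
    · refine insert_mem_sd hC (mem_of_subset hqN hxq (Finset.insert_nonempty _ _)) ?_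
      intro r hr
      rcases hsep r hr with h | h
      · exact Or.inl (h.trans (Finset.subset_insert _ _))
      · exact Or.inr (hxq.trans h)
  obtain ⟨ha1, ha2⟩ := main a ha.1 ha.2
  obtain ⟨hb1, hb2⟩ := main b hb.1 hb.2
  refine ⟨_, ha2, _, hb2, ?_, Finset.ssubset_insert ha1, Finset.ssubset_insert hb1, ?_⟩
  · intro h
    have h' : insert a p ∈ insert (insert b p) C := h ▸ Finset.mem_insert_self _ _
    rcases Finset.mem_insert.1 h' with h' | h'
    · have : a ∈ insert b p := h' ▸ Finset.mem_insert_self _ _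
      rcases Finset.mem_insert.1 this with h | h
      exacts [hab h, ha.2 h]
    · exact ha1 h'
  · intro s hs hCs
    obtain ⟨w, hwC, hwN, rfl, -⟩ := sd_coface hN h3 hs hCs
    have hcmp : ∀ r ∈ C, r ⊆ w ∨ w ⊆ r := fun r hr =>
      sd_chain hs (Finset.mem_insert_of_mem hr) (Finset.mem_insert_self _ _)
    have hwc := hbtw w hwC hwN hcmp
    have h1 : p ⊂ w := by
      rcases hp with rfl | hp
      · exact Finset.empty_ssubset.2 (nonempty_of_mem hwN)
      · rcases hcmp p hp with h | h
        · exact h.ssubset_of_ne (by rintro rfl; omega)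
        · have := Finset.card_le_card h
          omega
    have h2 : w ⊂ q := by
      rcases hcmp q hq with h | h
      · have := Finset.card_le_card h
        omega
      · exact h.ssubset_of_ne (by rintro rfl; omega)
    rcases eq_insert_of_between hq' h1 h2 with rfl | rfl
    · exact Or.inl rfl
    · exact Or.inr rfl

lemma IsCell.sd_two (hN : N.DimLE3) (hU : N.IsCell U) {C : Finset (Finset V)}
    (hC : C ∈ N.sdUp U) (h3 : C.card = 3) :
    ∃ s₁ ∈ N.sd.faces, ∃ s₂ ∈ N.sd.faces, s₁ ≠ s₂ ∧ C ⊂ s₁ ∧ C ⊂ s₂ ∧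
      ∀ s ∈ N.sd.faces, C ⊂ s → s = s₁ ∨ s = s₂ := by
  classical
  obtain ⟨hC, u, huC, huU⟩ := hC
  obtain ⟨x, hx, y, hy, z, hz, hxy, hyz, h1, h2, h4, h5, hall⟩ :=
    exists_triple_of_card_three hN hC h3
  -- a new element of the chain has a new cardinality
  have hnew : ∀ w, w ∉ C → w ∈ N.faces → (∀ r ∈ C, r ⊆ w ∨ w ⊆ r) →
      1 ≤ w.card ∧ w.card ≤ 4 ∧ w.card ≠ x.card ∧ w.card ≠ y.card ∧ w.card ≠ z.card := by
    intro w hw hwN hcmp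
    have hi := sd_card_injOn (insert_mem_sd hC hwN hcmp)
    have key : ∀ r ∈ C, w.card ≠ r.card := fun r hr h => hw
      ((hi (by simp) (by simp [hr]) h : w = r) ▸ hr)
    exact ⟨Finset.card_pos.2 (nonempty_of_mem hwN), hN w hwN, key x hx, key y hy, key z hz⟩
  by_cases c1 : x.card = 1
  · by_cases c2 : y.card = 2
    · by_cases c3 : z.card = 3
      · -- the tetrahedron is missing
        have hzU : z ∈ U := by
          refine hU.up u huU z (hC.2.1 z hz) (sd_subset_of_card_le hC huC hz ?_)
          rcases hall u huC with rfl | rfl | rfl <;> omega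
        obtain ⟨s₁, hs₁, s₂, hs₂, hne, hz1, hz2, hs⟩ := hU.two z hzU c3
        have main : ∀ s ∈ N.faces, z ⊂ s → s ∉ C ∧ insert s C ∈ N.sd.faces := by
          intro s hsN hzs
          have hlt := Finset.card_lt_card hzs
          refine ⟨fun h => ?_, insert_mem_sd hC hsN fun r hr => Or.inl ?_⟩
          · rcases hall s h with rfl | rfl | rfl <;> omega
          · rcases hall r hr with rfl | rfl | rfl
            exacts [hxy.1.trans (hyz.1.trans hzs.1), hyz.1.trans hzs.1, hzs.1]
        obtain ⟨m1, m2⟩ := main s₁ (hU.sub hs₁) hz1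
        obtain ⟨n1, n2⟩ := main s₂ (hU.sub hs₂) hz2
        refine ⟨_, m2, _, n2, ?_, Finset.ssubset_insert m1, Finset.ssubset_insert n1, ?_⟩
        · intro h
          have h' : s₁ ∈ insert s₂ C := h ▸ Finset.mem_insert_self _ _
          rcases Finset.mem_insert.1 h' with h' | h'
          exacts [hne h', m1 h']
        · intro s hsN hCs
          obtain ⟨w, hwC, hwN, rfl, -⟩ := sd_coface hN h3 hsN hCs
          have hcmp : ∀ r ∈ C, r ⊆ w ∨ w ⊆ r := fun r hr =>
            sd_chain hsN (Finset.mem_insert_of_mem hr) (Finset.mem_insert_self _ _)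
          have hw := hnew w hwC hwN hcmp
          have hzw : z ⊂ w := by
            rcases hcmp z hz with h | h
            · exact h.ssubset_of_ne (by rintro rfl; omega)
            · have := Finset.card_le_card h
              omega
          rcases hs w hwN hzw with rfl | rfl
          · exact Or.inl rfl
          · exact Or.inr rfl
      · refine sd_two_of_gap hN hC h3 (Or.inr hy) hz hyz.1 (by omega) ?_ ?_
        · intro r hr
          rcases hall r hr with rfl | rfl | rfl
          exacts [Or.inl hxy.1, Or.inl subset_rfl, Or.inr subset_rfl]
        · intro w hw hwN hcmp
          have := hnew w hw hwN hcmp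
          omega
    · refine sd_two_of_gap hN hC h3 (Or.inr hx) hy hxy.1 (by omega) ?_ ?_
      · intro r hr
        rcases hall r hr with rfl | rfl | rfl
        exacts [Or.inl subset_rfl, Or.inr subset_rfl, Or.inr hyz.1]
      · intro w hw hwN hcmp
        have := hnew w hw hwN hcmp
        omega
  · refine sd_two_of_gap hN hC h3 (p := ∅) (Or.inl rfl) hx (Finset.empty_subset _) ?_ ?_ ?_
    · simp
      omega
    · intro r hr
      rcases hall r hr with rfl | rfl | rfl
      exacts [Or.inr subset_rfl, Or.inr hxy.1, Or.inr (hxy.1.trans hyz.1)]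
    · intro w hw hwN hcmp
      have := hnew w hw hwN hcmp
      simp
      omega

lemma sdUp_up {C C' : Finset (Finset V)} (hC : C ∈ N.sdUp U) (hC' : C' ∈ N.sd.faces)
    (h : C ⊆ C') : C' ∈ N.sdUp U := by
  obtain ⟨-, u, hu, huU⟩ := hC
  exact ⟨hC', u, h hu, huU⟩

end FinComplex

namespace FinComplex

variable {V : Type u} {N : FinComplex V} {U D : Set (Finset V)}

open Classical in
/-- The chain of the vertex `x`, the edge `xy`, the triangle `xyz` and the tetrahedron `T`. -/
def flag (x y z : V) (T : Finset V) : Finset (Finset V) := {{x}, {x, y}, {x, y, z}, T}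

open Classical in
lemma mem_flag {x y z : V} {T r : Finset V} :
    r ∈ flag x y z T ↔ r = {x} ∨ r = {x, y} ∨ r = {x, y, z} ∨ r = T := by
  simp [flag]

lemma flag_mem_sd {x y z : V} {T : Finset V} (hT : T ∈ N.faces) (hx : x ∈ T) (hy : y ∈ T)
    (hz : z ∈ T) : flag x y z T ∈ N.sd.faces := by
  classical
  have e1 : ({x} : Finset V) ⊆ {x, y} := by simp
  have e2 : ({x, y} : Finset V) ⊆ {x, y, z} := by
    intro r; simp; tauto
  have e3 : ({x, y, z} : Finset V) ⊆ T := by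
    intro r; simp only [Finset.mem_insert, Finset.mem_singleton]
    rintro (rfl | rfl | rfl) <;> assumption
  refine ⟨⟨T, mem_flag.2 (by simp)⟩, ?_, ?_⟩
  · intro σ hσ
    rcases mem_flag.1 hσ with rfl | rfl | rfl | rfl
    · exact mem_of_subset hT (e1.trans (e2.trans e3)) (by simp)
    · exact mem_of_subset hT (e2.trans e3) (by simp)
    · exact mem_of_subset hT e3 (by simp)
    · exact hT
  · intro σ hσ τ hτ
    rcases mem_flag.1 hσ with rfl | rfl | rfl | rfl <;>
      rcases mem_flag.1 hτ with rfl | rfl | rfl | rfl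
    · exact Or.inl subset_rfl
    · exact Or.inl e1
    · exact Or.inl (e1.trans e2)
    · exact Or.inl (e1.trans (e2.trans e3))
    · exact Or.inr e1
    · exact Or.inl subset_rfl
    · exact Or.inl e2
    · exact Or.inl (e2.trans e3)
    · exact Or.inr (e1.trans e2)
    · exact Or.inr e2
    · exact Or.inl subset_rfl
    · exact Or.inl e3
    · exact Or.inr (e1.trans (e2.trans e3))
    · exact Or.inr (e2.trans e3)
    · exact Or.inr e3
    · exact Or.inl subset_rfl

lemma card_flag {x y z : V} {T : Finset V} (hT : T.card = 4) (hxy : x ≠ y) (hxz : x ≠ z)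
    (hyz : y ≠ z) : (flag x y z T).card = 4 := by
  classical
  have h2 : ({x, y} : Finset V).card = 2 := Finset.card_pair hxy
  have h3 : ({x, y, z} : Finset V).card = 3 := Finset.card_eq_three.2 ⟨x, y, z, hxy, hxz, hyz, rfl⟩
  have h1 : ({x} : Finset V).card = 1 := Finset.card_singleton x
  have hi : Set.InjOn Finset.card (flag x y z T : Set (Finset V)) := by
    intro a ha b hb hab
    rcases mem_flag.1 ha with rfl | rfl | rfl | rfl <;>
      rcases mem_flag.1 hb with rfl | rfl | rfl | rfl <;> first | rfl | omega
  rw [← Finset.card_image_of_injOn hi]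
  have : (flag x y z T).image Finset.card = {1, 2, 3, 4} := by
    simp only [flag, Finset.image_insert, Finset.image_singleton, h1, h2, h3, hT]
  rw [this]
  rfl

/-- Every chain of four faces is a flag. -/
lemma exists_eq_flag (hN : N.DimLE3) {C : Finset (Finset V)} (hC : C ∈ N.sd.faces)
    (h4 : C.card = 4) : ∃ T ∈ C, T.card = 4 ∧ ∃ x ∈ T, ∃ y ∈ T, ∃ z ∈ T, x ≠ y ∧ x ≠ z ∧ y ≠ z ∧
      C = flag x y z T := by
  classical
  have himg : C.image Finset.card = Finset.Icc 1 4 := by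
    apply Finset.eq_of_subset_of_card_le
    · intro k hk
      obtain ⟨σ, hσ, rfl⟩ := Finset.mem_image.1 hk
      have h1 := hC.2.1 σ hσ
      have h2 := Finset.card_pos.2 (nonempty_of_mem h1)
      have h3 := hN σ h1
      simp only [Finset.mem_Icc]
      omega
    · rw [Finset.card_image_of_injOn (sd_card_injOn hC), h4]
      simp
  have hex : ∀ k, 1 ≤ k → k ≤ 4 → ∃ σ ∈ C, σ.card = k := by
    intro k h1 h2
    have : k ∈ C.image Finset.card := by rw [himg]; simp; omega
    exact Finset.mem_image.1 this
  obtain ⟨a, ha, ha1⟩ := hex 1 (by omega) (by omega)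
  obtain ⟨e, he, he2⟩ := hex 2 (by omega) (by omega)
  obtain ⟨t, ht, ht3⟩ := hex 3 (by omega) (by omega)
  obtain ⟨T, hT, hT4⟩ := hex 4 (by omega) (by omega)
  have hae := sd_subset_of_card_le hC ha he (by omega)
  have het := sd_subset_of_card_le hC he ht (by omega)
  have htT := sd_subset_of_card_le hC ht hT (by omega)
  obtain ⟨x, rfl⟩ := Finset.card_eq_one.1 ha1
  obtain ⟨y, hy, rfl⟩ := Finset.exists_eq_insert_iff.2 ⟨hae, by simp [he2]⟩
  obtain ⟨z, hz, rfl⟩ := Finset.exists_eq_insert_iff.2 ⟨het, by omega⟩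
  have e2 : insert y {x} = ({x, y} : Finset V) := by ext; simp; tauto
  have e3 : insert z (insert y {x}) = ({x, y, z} : Finset V) := by ext; simp; tauto
  refine ⟨T, hT, hT4, x, htT (by simp), y, htT (by simp), z, htT (by simp), ?_, ?_, ?_, ?_⟩
  · rintro rfl; simp at hy
  · rintro rfl; simp at hz
  · rintro rfl; simp at hz
  · have hne : x ≠ y ∧ x ≠ z ∧ y ≠ z := by
      refine ⟨?_, ?_, ?_⟩ <;> rintro rfl <;> simp_all
    symm
    apply Finset.eq_of_subset_of_card_le
    · intro r hr
      rcases mem_flag.1 hr with rfl | rfl | rfl | rfl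
      exacts [ha, e2 ▸ he, e3 ▸ ht, hT]
    · rw [h4, card_flag hT4 hne.1 hne.2.1 hne.2.2]

lemma IsCell.sd (hN : N.DimLE3) (hU : N.IsCell U) : N.sd.IsCell (N.sdUp U) where
  sub := fun _ h => h.1
  up := fun _ h _ hτ hs => sdUp_up h hτ hs
  pure := by
    classical
    have key : ∀ n, ∀ C ∈ N.sdUp U, C.card + n = 4 → ∃ C' ∈ N.sdUp U, C ⊆ C' ∧ C'.card = 4 := by
      intro n
      induction n with
      | zero => exact fun C hC h => ⟨C, hC, subset_rfl, h⟩
      | succ n ih =>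
        intro C hC hn
        suffices ∃ w ∈ N.faces, w ∉ C ∧ ∀ r ∈ C, r ⊆ w ∨ w ⊆ r by
          obtain ⟨w, hw, hwC, hcmp⟩ := this
          have hmem : insert w C ∈ N.sdUp U :=
            sdUp_up hC (insert_mem_sd hC.1 hw hcmp) (Finset.subset_insert _ _)
          obtain ⟨C', h1, h2, h3⟩ := ih _ hmem (by rw [Finset.card_insert_of_notMem hwC]; omega)
          exact ⟨C', h1, (Finset.subset_insert _ _).trans h2, h3⟩
        by_contra hcon
        push Not at hcon
        -- then all cardinalities occur
        have hall : ∀ k, 1 ≤ k → k ≤ 4 → ∃ σ ∈ C, σ.card = k := by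
          obtain ⟨u, huC, huU⟩ := hC.2
          -- the largest element
          obtain ⟨m, hm, hmax⟩ := C.exists_max_image Finset.card hC.1.1
          have hmU : m ∈ U := hU.up u huU m (hC.1.2.1 m hm)
            (sd_subset_of_card_le hC.1 huC hm (hmax u huC))
          obtain ⟨T, hTU, hmT, hT4⟩ := hU.pure m hmU
          have hTC : T ∈ C := by
            by_contra hTC
            obtain ⟨r, hr, h1, h2⟩ := hcon T (hU.sub hTU) hTC
            exact h1 ((sd_subset_of_card_le hC.1 hr hm (hmax r hr)).trans hmT)
          intro k hk1 hk4
          by_contra hk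
          push Not at hk
          -- smallest element above `k`
          obtain ⟨b, hb, hbmin⟩ := (C.filter fun σ => k < σ.card).exists_min_image Finset.card
            ⟨T, by
              simp only [Finset.mem_filter]
              refine ⟨hTC, lt_of_le_of_ne (by omega) ?_⟩
              exact (hk T hTC).symm⟩
          simp only [Finset.mem_filter] at hb hbmin
          -- union of the elements below `k`
          set p := (C.filter fun σ => σ.card < k).biUnion id with hp
          have hpb : p ⊆ b := by
            rw [hp, Finset.biUnion_subset]
            intro σ hσ
            simp only [Finset.mem_filter] at hσ
            have hlt : σ.card ≤ b.card := by omega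
            exact sd_subset_of_card_le hC.1 hσ.1 hb.1 hlt
          have hpk : p.card ≤ k := by
            rcases (C.filter fun σ => σ.card < k).eq_empty_or_nonempty with h | h
            · simp [hp, h]
            · obtain ⟨c, hc, hcmax⟩ := (C.filter fun σ => σ.card < k).exists_max_image Finset.card h
              simp only [Finset.mem_filter] at hc hcmax
              have : p ⊆ c := by
                rw [hp, Finset.biUnion_subset]
                intro σ hσ
                simp only [Finset.mem_filter] at hσ
                exact sd_subset_of_card_le hC.1 hσ.1 hc.1 (hcmax σ hσ)
              exact (Finset.card_le_card this).trans hc.2.le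
          obtain ⟨w, hpw, hwb, hwk⟩ := Finset.exists_subsuperset_card_eq hpb hpk hb.2.le
          have hw : w ∈ N.faces := mem_of_subset (hC.1.2.1 b hb.1) hwb
            (Finset.card_pos.1 (by omega))
          obtain ⟨r, hr, h1, h2⟩ := hcon w hw (fun h => hk w h hwk)
          rcases lt_trichotomy r.card k with h | h | h
          · exact h1 ((Finset.subset_biUnion_of_mem id (by simp [hr, h])).trans hpw)
          · exact hk r hr h
          · exact h2 (hwb.trans (sd_subset_of_card_le hC.1 hb.1 hr (hbmin r ⟨hr, h⟩)))
        have : (Finset.Icc 1 4).card ≤ C.card := by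
          refine (Finset.card_le_card (t := C.image Finset.card) fun k hk => ?_).trans
            Finset.card_image_le
          simp only [Finset.mem_Icc] at hk
          exact Finset.mem_image.2 (hall k hk.1 hk.2)
        simp at this
        omega
    intro C hC
    have := hN.sd C hC.1
    exact key (4 - C.card) C hC (by omega)
  two := by
    intro C hC h3
    obtain ⟨s₁, h1, s₂, h2, h⟩ := hU.sd_two hN hC h3
    exact ⟨s₁, sdUp_up hC h1 h.2.1.1, s₂, sdUp_up hC h2 h.2.2.1.1, h⟩

set_option maxHeartbeats 1000000 in
/-- Connectivity of the tetrahedra through triangles avoiding `D` passes to the barycentric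
subdivision: the subdivided tetrahedra are connected through triangles without a vertex in `D`. -/
lemma ConnAvoid.sd (hN : N.DimLE3) (hU : N.IsCell U) (hD3 : ∀ t ∈ D, t.card = 3)
    (hD : ∀ s ∈ U, s.card = 4 → ∀ t ∈ D, ∀ t' ∈ D, t ⊆ s → t' ⊆ s → t = t')
    (hconn : ConnAvoid U (· ∈ D)) : ConnAvoid (N.sdUp U) (fun C => ∃ x ∈ C, x ∈ D) := by
  classical
  intro B hB
  have card3 : ∀ x y z : V, x ≠ y → x ≠ z → y ≠ z → ({x, y, z} : Finset V).card = 3 :=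
    fun x y z hxy hxz hyz => Finset.card_eq_three.2 ⟨x, y, z, hxy, hxz, hyz, rfl⟩
  -- crossing a triangle
  have cross : ∀ T ∈ U, T.card = 4 → ∀ T' ∈ U, T'.card = 4 → ∀ x y z x' y' z' : V,
      x ∈ T → y ∈ T → z ∈ T → x ≠ y → x ≠ z → y ≠ z →
      x' ∈ T' → y' ∈ T' → z' ∈ T' → x' ≠ y' → x' ≠ z' → y' ≠ z' →
      ∀ C : Finset (Finset V), C.card = 3 → (∃ u ∈ C, u ∈ U) → C ⊆ flag x y z T →
      C ⊆ flag x' y' z' T' → (∀ r ∈ C, r ∉ D) → flag x y z T ∈ B → flag x' y' z' T' ∈ B := by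
    intro T hT hT4 T' hT' hT4' x y z x' y' z' hx hy hz hxy hxz hyz hx' hy' hz' hxy' hxz' hyz'
      C hC3 hCU h1 h2 hCD hmem
    have f1 := flag_mem_sd (N := N) (hU.sub hT) hx hy hz
    have f2 := flag_mem_sd (N := N) (hU.sub hT') hx' hy' hz'
    have c1 := card_flag hT4 hxy hxz hyz
    have c2 := card_flag hT4' hxy' hxz' hyz'
    have hCsd : C ∈ N.sd.faces := mem_of_subset f1 h1 (Finset.card_pos.1 (by omega))
    have hCup : C ∈ N.sdUp U := ⟨hCsd, hCU⟩
    refine hB C hCup hC3 ?_ _ (sdUp_up hCup f1 h1) _ (sdUp_up hCup f2 h2) c1 c2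
      (h1.ssubset_of_ne (by rintro rfl; omega)) (h2.ssubset_of_ne (by rintro rfl; omega)) hmem
    rintro ⟨r, hr, hrD⟩
    exact hCD r hr hrD
  -- the three kinds of moves inside a tetrahedron
  have m1 : ∀ T ∈ U, T.card = 4 → ∀ x ∈ T, ∀ y ∈ T, ∀ z ∈ T, x ≠ y → x ≠ z → y ≠ z →
      ({x, y, z} : Finset V) ∉ D → flag x y z T ∈ B → flag y x z T ∈ B := by
    intro T hT hT4 x hx y hy z hz hxy hxz hyz hnD
    refine cross T hT hT4 T hT hT4 x y z y x z hx hy hz hxy hxz hyz hy hx hz hxy.symm hyz hxz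
      {{x, y}, {x, y, z}, T} ?_ ⟨T, by simp, hT⟩ ?_ ?_ ?_
    · have h2 : ({x, y} : Finset V).card = 2 := Finset.card_pair hxy
      have h3 := card3 x y z hxy hxz hyz
      refine Finset.card_eq_three.2 ⟨_, _, _, ?_, ?_, ?_, rfl⟩ <;> intro h <;>
        [rw [h] at h2; rw [h] at h2; rw [h] at h3] <;> omega
    · intro r; simp only [mem_flag, Finset.mem_insert, Finset.mem_singleton]; tauto
    · have e2 : ({y, x} : Finset V) = {x, y} := by ext; simp; tauto
      have e3 : ({y, x, z} : Finset V) = {x, y, z} := by ext; simp; tauto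
      intro r; simp only [mem_flag, Finset.mem_insert, Finset.mem_singleton, e2, e3]; tauto
    · intro r hr hrD
      have := hD3 r hrD
      simp only [Finset.mem_insert, Finset.mem_singleton] at hr
      rcases hr with rfl | rfl | rfl
      · have := Finset.card_pair hxy; omega
      · exact hnD hrD
      · omega
  have m2 : ∀ T ∈ U, T.card = 4 → ∀ x ∈ T, ∀ y ∈ T, ∀ z ∈ T, x ≠ y → x ≠ z → y ≠ z →
      ({x, y, z} : Finset V) ∉ D → flag x y z T ∈ B → flag x z y T ∈ B := by
    intro T hT hT4 x hx y hy z hz hxy hxz hyz hnD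
    refine cross T hT hT4 T hT hT4 x y z x z y hx hy hz hxy hxz hyz hx hz hy hxz hxy hyz.symm
      {{x}, {x, y, z}, T} ?_ ⟨T, by simp, hT⟩ ?_ ?_ ?_
    · have h2 : ({x} : Finset V).card = 1 := Finset.card_singleton x
      have h3 := card3 x y z hxy hxz hyz
      refine Finset.card_eq_three.2 ⟨_, _, _, ?_, ?_, ?_, rfl⟩ <;> intro h <;>
        [rw [h] at h2; rw [h] at h2; rw [h] at h3] <;> omega
    · intro r; simp only [mem_flag, Finset.mem_insert, Finset.mem_singleton]; tauto
    · have e3 : ({x, z, y} : Finset V) = {x, y, z} := by ext; simp; tauto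
      intro r; simp only [mem_flag, Finset.mem_insert, Finset.mem_singleton, e3]; tauto
    · intro r hr hrD
      have := hD3 r hrD
      simp only [Finset.mem_insert, Finset.mem_singleton] at hr
      rcases hr with rfl | rfl | rfl
      · have := Finset.card_singleton x; omega
      · exact hnD hrD
      · omega
  have m3 : ∀ T ∈ U, T.card = 4 → ∀ x ∈ T, ∀ y ∈ T, ∀ z ∈ T, ∀ w ∈ T, x ≠ y → x ≠ z → y ≠ z →
      x ≠ w → y ≠ w → flag x y z T ∈ B → flag x y w T ∈ B := by
    intro T hT hT4 x hx y hy z hz w hw hxy hxz hyz hxw hyw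
    refine cross T hT hT4 T hT hT4 x y z x y w hx hy hz hxy hxz hyz hx hy hw hxy hxw hyw
      {{x}, {x, y}, T} ?_ ⟨T, by simp, hT⟩ ?_ ?_ ?_
    · have h2 : ({x} : Finset V).card = 1 := Finset.card_singleton x
      have h3 := Finset.card_pair hxy
      refine Finset.card_eq_three.2 ⟨_, _, _, ?_, ?_, ?_, rfl⟩ <;> intro h <;>
        [rw [h] at h2; rw [h] at h2; rw [h] at h3] <;> omega
    · intro r; simp only [mem_flag, Finset.mem_insert, Finset.mem_singleton]; tauto
    · intro r; simp only [mem_flag, Finset.mem_insert, Finset.mem_singleton]; tauto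
    · intro r hr hrD
      have := hD3 r hrD
      simp only [Finset.mem_insert, Finset.mem_singleton] at hr
      rcases hr with rfl | rfl | rfl
      · have := Finset.card_singleton x; omega
      · have := Finset.card_pair hxy; omega
      · omega
  -- permutations of a triangle that is not in `D`
  have perm3 : ∀ T ∈ U, T.card = 4 → ∀ x ∈ T, ∀ y ∈ T, ∀ z ∈ T, x ≠ y → x ≠ z → y ≠ z →
      ({x, y, z} : Finset V) ∉ D → ∀ x' y' z' : V, x' ≠ y' → x' ≠ z' → y' ≠ z' →
      ({x', y', z'} : Finset V) = {x, y, z} → flag x y z T ∈ B → flag x' y' z' T ∈ B := by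
    intro T hT hT4 x hx y hy z hz hxy hxz hyz hnD x' y' z' hxy' hxz' hyz' he hmem
    have ex : x' = x ∨ x' = y ∨ x' = z := by
      have : x' ∈ ({x, y, z} : Finset V) := he ▸ (by simp)
      simpa using this
    have ey : y' = x ∨ y' = y ∨ y' = z := by
      have : y' ∈ ({x, y, z} : Finset V) := he ▸ (by simp)
      simpa using this
    have ez : z' = x ∨ z' = y ∨ z' = z := by
      have : z' ∈ ({x, y, z} : Finset V) := he ▸ (by simp)
      simpa using this
    have p1 : ({y, x, z} : Finset V) ∉ D := by rwa [Finset.insert_comm]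
    have p2 : ({x, z, y} : Finset V) ∉ D := by rwa [Finset.pair_comm z y]
    have p3 : ({y, z, x} : Finset V) ∉ D := by rwa [Finset.pair_comm z x, Finset.insert_comm y x]
    have p4 : ({z, x, y} : Finset V) ∉ D := by rwa [Finset.insert_comm z x, Finset.pair_comm z y]
    have q1 := m1 T hT hT4 x hx y hy z hz hxy hxz hyz hnD hmem
    have q2 := m2 T hT hT4 x hx y hy z hz hxy hxz hyz hnD hmem
    have q3 := m2 T hT hT4 y hy x hx z hz hxy.symm hyz hxz p1 q1
    have q4 := m1 T hT hT4 x hx z hz y hy hxz hxy hyz.symm p2 q2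
    have q5 := m1 T hT hT4 y hy z hz x hx hyz hxy.symm hxz.symm p3 q3
    rcases ex with rfl | rfl | rfl <;> rcases ey with rfl | rfl | rfl <;>
      rcases ez with rfl | rfl | rfl <;> first | contradiction | assumption
  -- all flags of a tetrahedron whose triangles are not in `D`
  have good : ∀ T ∈ U, T.card = 4 → ∀ x ∈ T, ∀ y ∈ T, ∀ z ∈ T, x ≠ y → x ≠ z → y ≠ z →
      ({x, y, z} : Finset V) ∉ D → ∀ x' ∈ T, ∀ y' ∈ T, ∀ z' ∈ T, x' ≠ y' → x' ≠ z' → y' ≠ z' →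
      ({x', y', z'} : Finset V) ∉ D → flag x y z T ∈ B → flag x' y' z' T ∈ B := by
    intro T hT hT4 x hx y hy z hz hxy hxz hyz hnD x' hx' y' hy' z' hz' hxy' hxz' hyz' hnD' hmem
    have s1 : ({x, y, z} : Finset V) ⊆ T := by
      intro r; simp only [Finset.mem_insert, Finset.mem_singleton]
      rintro (rfl | rfl | rfl) <;> assumption
    have s2 : ({x', y', z'} : Finset V) ⊆ T := by
      intro r; simp only [Finset.mem_insert, Finset.mem_singleton]
      rintro (rfl | rfl | rfl) <;> assumption
    have c1 := card3 x y z hxy hxz hyz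
    have c2 := card3 x' y' z' hxy' hxz' hyz'
    have hI : 1 < (({x, y, z} : Finset V) ∩ {x', y', z'}).card := by
      have h1 := Finset.card_union_add_card_inter ({x, y, z} : Finset V) {x', y', z'}
      have h2 := Finset.card_le_card (Finset.union_subset s1 s2)
      omega
    obtain ⟨u, hu, v, hv, huv⟩ := Finset.one_lt_card.1 hI
    rw [Finset.mem_inter] at hu hv
    have third : ∀ t : Finset V, t.card = 3 → u ∈ t → v ∈ t → ∃ w ∈ t, u ≠ w ∧ v ≠ w ∧
        t = {u, v, w} := by
      intro t ht hut hvt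
      have hsub : ({u, v} : Finset V) ⊆ t := by
        intro r; simp only [Finset.mem_insert, Finset.mem_singleton]
        rintro (rfl | rfl) <;> assumption
      obtain ⟨w, hw, rfl⟩ := Finset.exists_eq_insert_iff.2 ⟨hsub, by rw [Finset.card_pair huv, ht]⟩
      simp only [Finset.mem_insert, Finset.mem_singleton, not_or] at hw
      exact ⟨w, by simp, fun h => hw.1 h.symm, fun h => hw.2 h.symm, by ext; simp; tauto⟩
    obtain ⟨w, hw, huw, hvw, ew⟩ := third _ c1 hu.1 hv.1
    obtain ⟨w', hw', huw', hvw', ew'⟩ := third _ c2 hu.2 hv.2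
    have n1 := perm3 T hT hT4 x hx y hy z hz hxy hxz hyz hnD u v w huv huw hvw ew.symm hmem
    have n2 := m3 T hT hT4 u (s1 hu.1) v (s1 hv.1) w (s1 hw) w' (s2 hw') huv huw hvw huw' hvw' n1
    exact perm3 T hT hT4 u (s1 hu.1) v (s1 hv.1) w' (s2 hw') huv huw' hvw' (ew' ▸ hnD') x' y' z'
      hxy' hxz' hyz' ew' n2
  -- replace the third vertex to leave `D`
  have leave : ∀ T ∈ U, T.card = 4 → ∀ x ∈ T, ∀ y ∈ T, ∀ z ∈ T, x ≠ y → x ≠ z → y ≠ z →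
      ∃ w ∈ T, x ≠ w ∧ y ≠ w ∧ ({x, y, w} : Finset V) ∉ D := by
    intro T hT hT4 x hx y hy z hz hxy hxz hyz
    by_cases hxyz : ({x, y, z} : Finset V) ∈ D
    · have s1 : ({x, y, z} : Finset V) ⊆ T := by
        intro r; simp only [Finset.mem_insert, Finset.mem_singleton]
        rintro (rfl | rfl | rfl) <;> assumption
      obtain ⟨w, hw, he⟩ := Finset.exists_eq_insert_iff.2
        ⟨s1, by rw [card3 x y z hxy hxz hyz, hT4]⟩
      simp only [Finset.mem_insert, Finset.mem_singleton, not_or] at hw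
      have hwT : w ∈ T := he ▸ Finset.mem_insert_self _ _
      refine ⟨w, hwT, fun h => hw.1 h.symm, fun h => hw.2.1 h.symm, fun h => ?_⟩
      have s2 : ({x, y, w} : Finset V) ⊆ T := by
        intro r; simp only [Finset.mem_insert, Finset.mem_singleton]
        rintro (rfl | rfl | rfl) <;> assumption
      have : w ∈ ({x, y, z} : Finset V) := hD T hT hT4 _ h _ hxyz s2 s1 ▸ (by simp)
      simp only [Finset.mem_insert, Finset.mem_singleton] at this
      tauto
    · exact ⟨z, hz, hxz, hyz, hxyz⟩
  have all : ∀ T ∈ U, T.card = 4 → ∀ x ∈ T, ∀ y ∈ T, ∀ z ∈ T, x ≠ y → x ≠ z → y ≠ z →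
      ∀ x' ∈ T, ∀ y' ∈ T, ∀ z' ∈ T, x' ≠ y' → x' ≠ z' → y' ≠ z' →
      flag x y z T ∈ B → flag x' y' z' T ∈ B := by
    intro T hT hT4 x hx y hy z hz hxy hxz hyz x' hx' y' hy' z' hz' hxy' hxz' hyz' hmem
    obtain ⟨w, hw, hxw, hyw, hwD⟩ := leave T hT hT4 x hx y hy z hz hxy hxz hyz
    obtain ⟨w', hw', hxw', hyw', hwD'⟩ := leave T hT hT4 x' hx' y' hy' z' hz' hxy' hxz' hyz'
    have n1 := m3 T hT hT4 x hx y hy z hz w hw hxy hxz hyz hxw hyw hmem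
    have n2 := good T hT hT4 x hx y hy w hw hxy hxw hyw hwD x' hx' y' hy' w' hw' hxy' hxw' hyw'
      hwD' n1
    exact m3 T hT hT4 x' hx' y' hy' w' hw' z' hz' hxy' hxw' hyw' hxz' hyz' n2
  -- pass to the tetrahedra
  have key := hconn {T | ∀ x ∈ T, ∀ y ∈ T, ∀ z ∈ T, x ≠ y → x ≠ z → y ≠ z → flag x y z T ∈ B} ?_
  · intro s hs s' hs' h4 h4' hmem
    obtain ⟨T, hTs, hT4, x, hx, y, hy, z, hz, hxy, hxz, hyz, rfl⟩ := exists_eq_flag hN hs.1 h4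
    obtain ⟨T', hTs', hT4', x', hx', y', hy', z', hz', hxy', hxz', hyz', rfl⟩ :=
      exists_eq_flag hN hs'.1 h4'
    have inU : ∀ C ∈ N.sdUp U, ∀ T ∈ C, T.card = 4 → T ∈ U := by
      intro C hC T hT hT4
      obtain ⟨hC, u, hu, huU⟩ := hC
      have hTN := hC.2.1 T hT
      exact hU.up u huU T hTN (sd_subset_of_card_le hC hu hT (by have := hN u (hC.2.1 u hu); omega))
    have hTU := inU _ hs T hTs hT4
    have hTU' := inU _ hs' T' hTs' hT4'
    exact key T hTU T' hTU' hT4 hT4'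
      (fun a ha b hb c hc hab hac hbc => all T hTU hT4 x hx y hy z hz hxy hxz hyz a ha b hb c hc
        hab hac hbc hmem) x' hx' y' hy' z' hz' hxy' hxz' hyz'
  · intro t ht ht3 htD T hT T' hT' hT4 hT4' htT htT' hTB x' hx' y' hy' z' hz' hxy' hxz' hyz'
    obtain ⟨x, y, z, hxy, hxz, hyz, rfl⟩ := Finset.card_eq_three.1 ht3
    have hx : x ∈ ({x, y, z} : Finset V) := by simp
    have hy : y ∈ ({x, y, z} : Finset V) := by simp
    have hz : z ∈ ({x, y, z} : Finset V) := by simp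
    refine all T' hT' hT4' x (htT'.1 hx) y (htT'.1 hy) z (htT'.1 hz) hxy hxz hyz x' hx' y' hy' z'
      hz' hxy' hxz' hyz' ?_
    refine cross T hT hT4 T' hT' hT4' x y z x y z (htT.1 hx) (htT.1 hy) (htT.1 hz) hxy hxz hyz
      (htT'.1 hx) (htT'.1 hy) (htT'.1 hz) hxy hxz hyz {{x}, {x, y}, {x, y, z}} ?_
      ⟨_, by simp, ht⟩ ?_ ?_ ?_ (hTB x (htT.1 hx) y (htT.1 hy) z (htT.1 hz) hxy hxz hyz)
    · have h2 : ({x} : Finset V).card = 1 := Finset.card_singleton x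
      have h3 := Finset.card_pair hxy
      refine Finset.card_eq_three.2 ⟨_, _, _, ?_, ?_, ?_, rfl⟩ <;> intro h <;>
        [rw [h] at h2; rw [h] at h2; rw [h] at h3] <;> omega
    · intro r; simp only [mem_flag, Finset.mem_insert, Finset.mem_singleton]; tauto
    · intro r; simp only [mem_flag, Finset.mem_insert, Finset.mem_singleton]; tauto
    · intro r hr hrD
      have := hD3 r hrD
      simp only [Finset.mem_insert, Finset.mem_singleton] at hr
      rcases hr with rfl | rfl | rfl
      · have := Finset.card_singleton x; omega
      · have := Finset.card_pair hxy; omega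
      · exact htD hrD

end FinComplex

variable {V : Type u}

open Classical in
/-- A set of triangles that carries no nonzero two-dimensional cycle modulo two. -/
def NoCycles (D : Set (Finset V)) : Prop :=
  ∀ Z : Finset (Finset V), (∀ t ∈ Z, t ∈ D) →
    (∀ e : Finset V, e.card = 2 → (∃ t ∈ D, e ⊆ t) → Even {t ∈ Z | e ⊆ t}.card) → Z = ∅

namespace FinComplex

variable {N : FinComplex V} {U D : Set (Finset V)}

lemma mem_faceFinset {σ : Finset V} : σ ∈ N.faceFinset ↔ σ ∈ N.faces := by
  simp [faceFinset]

/-- A family of triangles without cycles does not separate a cell. -/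
lemma ConnAvoid.of_noCycles (hU : N.IsCell U) (hconn : ConnAvoid U (fun _ => False))
    (hN : N.DimLE3) (hD3 : ∀ t ∈ D, t.card = 3)
    (hDe : ∀ t ∈ D, ∀ e ⊆ t, e.card = 2 → e ∈ U) (hac : NoCycles D) :
    ConnAvoid U (· ∈ D) := by
  classical
  intro B hB
  set Z : Finset (Finset V) := {t ∈ N.faceFinset | t ∈ D ∧ ∃ s ∈ U, ∃ s' ∈ U, s.card = 4 ∧
    s'.card = 4 ∧ t ⊂ s ∧ t ⊂ s' ∧ s ∈ B ∧ s' ∉ B} with hZdef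
  have hZ : Z = ∅ := by
    refine hac Z (fun t ht => (Finset.mem_filter.1 ht).2.1) ?_
    rintro e he ⟨t₀, ht₀, het₀⟩
    have heU : e ∈ U := hDe t₀ ht₀ e het₀ he
    -- triangles and tetrahedra at `e`
    set A : Finset (Finset V) := {t ∈ N.faceFinset | e ⊆ t ∧ t.card = 3} with hA
    set S : Finset (Finset V) := {s ∈ N.faceFinset | e ⊆ s ∧ s.card = 4 ∧ s ∈ B} with hS
    have hdc : ∑ t ∈ A, {s ∈ S | t ⊆ s}.card = ∑ s ∈ S, {t ∈ A | t ⊆ s}.card := by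
      simp only [Finset.card_filter]
      exact Finset.sum_comm
    have h2 : ∀ s ∈ S, {t ∈ A | t ⊆ s}.card = 2 := by
      intro s hs
      simp only [hS, Finset.mem_filter, mem_faceFinset] at hs
      have : {t ∈ A | t ⊆ s} = (s \ e).image (fun x => insert x e) := by
        ext t
        simp only [hA, Finset.mem_filter, mem_faceFinset, Finset.mem_image, Finset.mem_sdiff]
        constructor
        · rintro ⟨⟨-, het, ht3⟩, hts⟩
          obtain ⟨x, hx, rfl⟩ := Finset.exists_eq_insert_iff.2 ⟨het, by omega⟩
          exact ⟨x, ⟨hts (Finset.mem_insert_self _ _), hx⟩, rfl⟩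
        · rintro ⟨x, ⟨hxs, hxe⟩, rfl⟩
          have := Finset.insert_subset hxs hs.2.1
          exact ⟨⟨mem_of_subset hs.1 this (Finset.insert_nonempty _ _), Finset.subset_insert _ _,
            by rw [Finset.card_insert_of_notMem hxe, he]⟩, this⟩
      rw [this, Finset.card_image_of_injOn, Finset.card_sdiff_of_subset hs.2.1]
      · omega
      · intro x hx y hy hxy
        simp only [Finset.coe_sdiff, Set.mem_sdiff, Finset.mem_coe] at hx hy
        have : x ∈ insert y e := by
          rw [← show insert x e = insert y e from hxy]
          exact Finset.mem_insert_self _ _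
        rcases Finset.mem_insert.1 this with h | h
        exacts [h, absurd h hx.2]
    have heven : Even (∑ t ∈ A, {s ∈ S | t ⊆ s}.card) := by
      rw [hdc, Finset.sum_congr rfl h2]
      simp
    -- the parity at each triangle
    have hpar : ∀ t ∈ A, {s ∈ S | t ⊆ s}.card % 2 = if t ∈ Z then 1 else 0 := by
      intro t ht
      simp only [hA, Finset.mem_filter, mem_faceFinset] at ht
      have htU : t ∈ U := hU.up e heU t ht.1 ht.2.1
      obtain ⟨s₁, h1, s₂, hs2, hne, ht1, ht2, hs⟩ := hU.two t htU ht.2.2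
      have c1 : s₁.card = 4 := by
        have := Finset.card_lt_card ht1
        have := hN s₁ (hU.sub h1)
        omega
      have c2 : s₂.card = 4 := by
        have := Finset.card_lt_card ht2
        have := hN s₂ (hU.sub hs2)
        omega
      have hfilter : {s ∈ S | t ⊆ s} = ({s₁, s₂} : Finset (Finset V)).filter (· ∈ B) := by
        ext s
        simp only [hS, Finset.mem_filter, mem_faceFinset, Finset.mem_insert, Finset.mem_singleton]
        constructor
        · rintro ⟨⟨h, -, h', h''⟩, hts⟩
          refine ⟨hs s h (hts.ssubset_of_ne ?_), h''⟩
          rintro rfl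
          omega
        · rintro ⟨rfl | rfl, h⟩
          · exact ⟨⟨hU.sub h1, ht.2.1.trans ht1.1, c1, h⟩, ht1.1⟩
          · exact ⟨⟨hU.sub hs2, ht.2.1.trans ht2.1, c2, h⟩, ht2.1⟩
      have hmemZ : t ∈ Z ↔ ¬ (s₁ ∈ B ↔ s₂ ∈ B) := by
        simp only [hZdef, Finset.mem_filter, mem_faceFinset]
        constructor
        · rintro ⟨-, -, s, hsU, s', hsU', -, -, hts, hts', hsB, hsB'⟩
          rcases hs s (hU.sub hsU) hts with rfl | rfl <;>
            rcases hs s' (hU.sub hsU') hts' with rfl | rfl <;> tauto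
        · intro h
          refine ⟨ht.1, ?_, ?_⟩
          · by_contra hnD
            exact h ⟨hB t htU ht.2.2 hnD s₁ h1 s₂ hs2 c1 c2 ht1 ht2,
              hB t htU ht.2.2 hnD s₂ hs2 s₁ h1 c2 c1 ht2 ht1⟩
          · by_cases hb : s₁ ∈ B
            · exact ⟨s₁, h1, s₂, hs2, c1, c2, ht1, ht2, hb, by tauto⟩
            · exact ⟨s₂, hs2, s₁, h1, c2, c1, ht2, ht1, by tauto, hb⟩
      rw [hfilter]
      by_cases b1 : s₁ ∈ B <;> by_cases b2 : s₂ ∈ B <;>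
        simp [Finset.filter_insert, Finset.filter_singleton, b1, b2, hmemZ, hne]
    have hZA : {t ∈ Z | e ⊆ t} = A.filter (· ∈ Z) := by
      ext t
      simp only [hA, Finset.mem_filter, mem_faceFinset]
      constructor
      · rintro ⟨h, h'⟩
        have := (Finset.mem_filter.1 h).2.1
        exact ⟨⟨mem_faceFinset.1 (Finset.mem_filter.1 h).1, h', hD3 t this⟩, h⟩
      · rintro ⟨⟨-, h, -⟩, h'⟩
        exact ⟨h', h⟩
    rw [hZA, Finset.card_filter]
    rw [Nat.even_iff] at heven ⊢
    rw [Finset.sum_nat_mod, Finset.sum_congr rfl hpar] at heven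
    exact heven
  apply hconn
  intro t htU ht3 _ s hs s' hs' h4 h4' hts hts' hsB
  by_contra hsB'
  by_cases htD : t ∈ D
  · have : t ∈ Z := by
      simp only [hZdef, Finset.mem_filter, mem_faceFinset]
      exact ⟨hU.sub htU, htD, s, hs, s', hs', h4, h4', hts, hts', hsB, hsB'⟩
    simp [hZ] at this
  · exact hsB' (hB t htU ht3 htD s hs s' hs' h4 h4' hts hts' hsB)

end FinComplex

variable {V : Type u}

/-! ### One step of a run -/

/-- The states of a run on `M`: subcomplexes of `M`. -/
def IsState (M : FinComplex V) (S : Finset (Finset V)) : Prop :=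
  (∀ σ ∈ S, σ ∈ M.faces) ∧ ∀ σ ∈ S, ∀ τ ⊆ σ, τ.Nonempty → τ ∈ S

lemma isState_faceFinset (M : FinComplex V) : IsState M M.faceFinset :=
  ⟨fun _ h => FinComplex.mem_faceFinset.1 h, fun _ h _ h' hne =>
    FinComplex.mem_faceFinset.2 (FinComplex.mem_of_subset (FinComplex.mem_faceFinset.1 h) h' hne)⟩

lemma mem_deleteFace {S : Finset (Finset V)} {σ τ : Finset V} :
    τ ∈ deleteFace S σ ↔ τ ∈ S ∧ ¬ σ ⊆ τ := by
  simp [deleteFace]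

lemma IsState.deleteFace {M : FinComplex V} {S : Finset (Finset V)} (hS : IsState M S)
    (σ : Finset V) : IsState M (deleteFace S σ) := by
  refine ⟨fun τ hτ => hS.1 τ (mem_deleteFace.1 hτ).1, fun τ hτ ρ hρ hne => ?_⟩
  rw [mem_deleteFace] at hτ ⊢
  exact ⟨hS.2 τ hτ.1 ρ hρ hne, fun h => hτ.2 (h.trans hρ)⟩

lemma IsState.step {M : FinComplex V} {sel : Selector V} (hsel : sel.Proper) {s s' : MorseState V}
    (hs : IsState M s.1) (h : s' ∈ (morseStep sel s).support) : IsState M s'.1 := by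
  rcases s.1.eq_empty_or_nonempty with he | hne
  · have : s' = s := by
      unfold morseStep at h
      split_ifs at h with h1 h2
      · obtain ⟨σ, hσ⟩ := h1
        have := mem_of_mem_freeFaces hσ
        simp [he] at this
      · obtain ⟨σ, hσ⟩ := h2
        have := mem_of_mem_topFaces hσ
        simp [he] at this
      · simpa using h
    exact this ▸ hs
  · rcases mem_support_morseStep hsel h hne with ⟨σ, -, rfl⟩ | ⟨-, σ, -, rfl⟩
    · exact hs.deleteFace σ
    · exact hs.deleteFace σ

lemma card_le_sup {S : Finset (Finset V)} {σ : Finset V} (h : σ ∈ S) :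
    σ.card ≤ S.sup Finset.card := Finset.le_sup (f := Finset.card) h

lemma mem_freeFaces {S : Finset (Finset V)} {σ : Finset V} :
    σ ∈ freeFaces S ↔ σ ∈ S ∧ σ.card + 1 = S.sup Finset.card ∧
      ∃ s ∈ S, σ ⊂ s ∧ ∀ τ ∈ S, σ ⊂ τ → τ = s := by
  classical
  unfold freeFaces
  rw [Finset.mem_filter, Finset.card_eq_one]
  refine and_congr_right fun _ => and_congr_right fun _ => ?_
  constructor
  · rintro ⟨s, hs⟩
    have h : ∀ τ, τ ∈ S ∧ σ ⊂ τ ↔ τ = s := fun τ => by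
      rw [← Finset.mem_singleton, ← hs, Finset.mem_filter]
    exact ⟨s, ((h s).2 rfl).1, ((h s).2 rfl).2, fun τ h1 h2 => (h τ).1 ⟨h1, h2⟩⟩
  · rintro ⟨s, hs, hσs, h⟩
    refine ⟨s, ?_⟩
    ext τ
    rw [Finset.mem_filter, Finset.mem_singleton]
    exact ⟨fun hτ => h τ hτ.1 hτ.2, by rintro rfl; exact ⟨hs, hσs⟩⟩

/-- The unique proper coface of a free face. -/
lemma exists_coface_of_free {S : Finset (Finset V)} {σ : Finset V} (h : σ ∈ freeFaces S) :
    ∃ s ∈ S, σ ⊂ s ∧ s.card = σ.card + 1 ∧ (∀ τ ∈ S, σ ⊂ τ → τ = s) ∧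
      ∀ τ, τ ∈ deleteFace S σ ↔ τ ∈ S ∧ τ ≠ σ ∧ τ ≠ s := by
  obtain ⟨hσ, hc, s, hs, hσs, hu⟩ := mem_freeFaces.1 h
  refine ⟨s, hs, hσs, ?_, hu, fun τ => ?_⟩
  · have := Finset.card_lt_card hσs
    have := card_le_sup hs
    omega
  · rw [mem_deleteFace]
    refine and_congr_right fun hτ => ⟨fun h => ⟨?_, ?_⟩, fun h h' => ?_⟩
    · rintro rfl
      exact h subset_rfl
    · rintro rfl
      exact h hσs.1
    · exact h.2 (hu τ hτ (h'.ssubset_of_ne h.1.symm))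

lemma mem_deleteFace_of_top {S : Finset (Finset V)} {σ : Finset V} (h : σ ∈ topFaces S)
    (τ : Finset V) : τ ∈ deleteFace S σ ↔ τ ∈ S ∧ τ ≠ σ := by
  have hc : σ.card = S.sup Finset.card := (Finset.mem_filter.1 h).2
  rw [mem_deleteFace]
  refine and_congr_right fun hτ => ⟨?_, fun h h' => h ?_⟩
  · rintro h rfl
    exact h subset_rfl
  · exact (Finset.eq_of_subset_of_card_le h' (hc ▸ card_le_sup hτ)).symm

/-! ### Gadgets -/

/-- A family `T` of tetrahedra of `M` with a family `D` of triangles inside that has no free edges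
and does not separate `T`, together with two sets of vertices that witness this for the
lexicographic strategies. -/
structure IsGadget (M : FinComplex V) (T D : Finset (Finset V)) (A W : Set V) : Prop where
  tet : ∀ s ∈ T, s ∈ M.faces ∧ s.card = 4
  tri : ∀ t ∈ D, t ∈ M.faces ∧ t.card = 3
  nonempty : D.Nonempty
  coface : ∀ t ∈ D, ∃ s₁ ∈ T, ∃ s₂ ∈ T, s₁ ≠ s₂ ∧ t ⊂ s₁ ∧ t ⊂ s₂ ∧
    ∀ s ∈ M.faces, t ⊂ s → s = s₁ ∨ s = s₂
  edge : ∀ t ∈ D, ∀ e ⊆ t, e.card = 2 → ∃ t' ∈ D, t' ≠ t ∧ e ⊆ t'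
  meets : ∀ t ∈ D, ∃ x ∈ t, x ∈ A
  within : ∀ t ∈ D, ∀ x ∈ t, x ∈ W
  cut : ∀ B : Set (Finset V), ∀ s ∈ T, s ∈ B → ∀ s' ∈ T, s' ∉ B →
    ∃ σ ∈ M.faces, σ.card = 3 ∧ (∀ x ∈ σ, x ∉ A) ∧ (∃ x ∈ σ, x ∉ W) ∧
      ∃ s₁ ∈ T, ∃ s₂ ∈ T, s₁ ∈ B ∧ s₂ ∉ B ∧ σ ⊂ s₁ ∧ σ ⊂ s₂ ∧
        ∀ s ∈ M.faces, σ ⊂ s → s = s₁ ∨ s = s₂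

section Gadget

variable {M : FinComplex V} {T D : Finset (Finset V)} {A W : Set V} {S : Finset (Finset V)}
  {σ : Finset V}

/-- When a triangle of `D` is free, another triangle of the gadget is free. -/
lemma IsGadget.exists_free (hG : IsGadget M T D A W) (hS : IsState M S)
    (hσ : σ ∈ freeFaces S) (hσD : σ ∈ D) :
    ∃ τ ∈ freeFaces S, τ ∉ D ∧ (∀ x ∈ τ, x ∉ A) ∧ (∃ x ∈ τ, x ∉ W) ∧ ∃ s ∈ S, s ∈ T ∧ τ ⊂ s := by
  obtain ⟨hσS, hc, s, hs, hσs, hu⟩ := mem_freeFaces.1 hσ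
  have h3 := (hG.tri σ hσD).2
  obtain ⟨s₁, h1, s₂, h2, hne, hσ1, hσ2, hall⟩ := hG.coface σ hσD
  have hex : ∃ r ∈ T, r ∈ S ∧ ∃ r' ∈ T, r' ∉ S := by
    rcases hall s (hS.1 s hs) hσs with rfl | rfl
    · exact ⟨s, h1, hs, s₂, h2, fun h => hne (hu s₂ h hσ2).symm⟩
    · exact ⟨s, h2, hs, s₁, h1, fun h => hne (hu s₁ h hσ1)⟩
  obtain ⟨r, hrT, hrS, r', hrT', hrS'⟩ := hex
  obtain ⟨τ, hτM, hτ3, hτA, hτW, t₁, ht1, t₂, ht2, hB1, hB2, hτ1, hτ2, hτ⟩ :=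
    hG.cut (S : Set (Finset V)) r hrT hrS r' hrT' hrS'
  refine ⟨τ, mem_freeFaces.2 ⟨?_, by omega, t₁, hB1, hτ1, ?_⟩, ?_, hτA, hτW, t₁, hB1, ht1, hτ1⟩
  · exact hS.2 t₁ hB1 τ hτ1.1 (Finset.card_pos.1 (by omega))
  · intro ρ hρ hτρ
    rcases hτ ρ (hS.1 ρ hρ) hτρ with rfl | rfl
    exacts [rfl, absurd hρ hB2]
  · intro hτD
    obtain ⟨x, hx, hxA⟩ := hG.meets τ hτD
    exact hτA x hx hxA

lemma IsGadget.subset_deleteFace_of_free (hG : IsGadget M T D A W) (hDS : D ⊆ S)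
    (hσ : σ ∈ freeFaces S) (hσD : σ ∉ D) : D ⊆ deleteFace S σ := by
  obtain ⟨s, hs, hσs, hsc, hu, hdel⟩ := exists_coface_of_free hσ
  intro t ht
  rw [hdel]
  refine ⟨hDS ht, fun h => hσD (h ▸ ht), ?_⟩
  rintro rfl
  have h3 := (hG.tri t ht).2
  obtain ⟨t', ht', hne, hsub⟩ := hG.edge t ht σ hσs.1 (by omega)
  have h3' := (hG.tri t' ht').2
  refine hne (hu t' (hDS ht') (hsub.ssubset_of_ne ?_))
  rintro rfl
  omega

open Classical in
/-- The factor of a gadget in the potential. -/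
def gadgetFactor (h : ℕ → ℝ) (T D S : Finset (Finset V)) : ℝ :=
  if D ⊆ S then h (T ∩ S).card else 1

lemma gadgetFactor_congr (h : ℕ → ℝ) {S S' : Finset (Finset V)} (hD : D ⊆ S ↔ D ⊆ S')
    (hT : ∀ s ∈ T, s ∈ S ↔ s ∈ S') : gadgetFactor h T D S = gadgetFactor h T D S' := by
  classical
  have : T ∩ S = T ∩ S' := by
    ext s
    simp only [Finset.mem_inter]
    exact and_congr_right (hT s)
  unfold gadgetFactor
  rw [this]
  simp only [hD]

lemma gadgetFactor_le_one {h : ℕ → ℝ} (h1 : ∀ j, h j ≤ 1) : gadgetFactor h T D S ≤ 1 := by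
  unfold gadgetFactor
  split_ifs
  exacts [h1 _, le_rfl]

lemma le_gadgetFactor {h : ℕ → ℝ} {t : ℝ} (ht : t ≤ 1) (h1 : ∀ j, t ≤ h j) :
    t ≤ gadgetFactor h T D S := by
  unfold gadgetFactor
  split_ifs
  exacts [h1 _, ht]

end Gadget

/-! ### A family of disjoint gadgets -/

section Family

variable {ι : Type*} {M : FinComplex V} {J : Finset ι} {T D : ι → Finset (Finset V)}
  {A W : ι → Set V} {h : ℕ → ℝ} {t : ℝ}

/-- The potential of a state. -/
def potential (t : ℝ) (h : ℕ → ℝ) (J : Finset ι) (T D : ι → Finset (Finset V))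
    (s : MorseState V) : ℝ :=
  t ^ s.2 * ∏ i ∈ J, gadgetFactor h (T i) (D i) s.1

lemma mul_prod_le_prod {f f' : ι → ℝ} (ht0 : 0 ≤ t) (ht1 : t ≤ 1) (h1 : ∀ i ∈ J, f' i ≤ 1) (htf : ∀ i ∈ J, t ≤ f i)
    (hone : ∀ i ∈ J, ∀ k ∈ J, f' i ≠ f i → f' k ≠ f k → i = k) :
    t * ∏ i ∈ J, f' i ≤ ∏ i ∈ J, f i := by
  classical
  by_cases hex : ∃ i ∈ J, f' i ≠ f i
  · obtain ⟨i, hi, hne⟩ := hex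
    rw [← Finset.mul_prod_erase J f' hi, ← Finset.mul_prod_erase J f hi, ← mul_assoc]
    have he : ∏ k ∈ J.erase i, f' k = ∏ k ∈ J.erase i, f k := by
      refine Finset.prod_congr rfl fun k hk => ?_
      by_contra hk'
      exact (Finset.mem_erase.1 hk).1 (hone k (Finset.mem_erase.1 hk).2 i hi hk' hne)
    rw [he]
    refine mul_le_mul_of_nonneg_right ?_ (Finset.prod_nonneg fun k hk =>
      ht0.trans (htf k (Finset.mem_erase.1 hk).2))
    exact (mul_le_of_le_one_right ht0 (h1 i hi)).trans (htf i hi)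
  · push Not at hex
    rw [Finset.prod_congr rfl hex]
    exact mul_le_of_le_one_left (Finset.prod_nonneg fun k hk => ht0.trans (htf k hk)) ht1

lemma IsGadget.disjoint_tri (hG : ∀ i ∈ J, IsGadget M (T i) (D i) (A i) (W i))
    (hdisj : ∀ i ∈ J, ∀ k ∈ J, ∀ s, s ∈ T i → s ∈ T k → i = k) {i k : ι} (hi : i ∈ J) (hk : k ∈ J)
    {τ : Finset V} (h1 : τ ∈ D i) {s : Finset V} (hs : s ∈ T k) (hτs : τ ⊂ s) : i = k := by
  obtain ⟨s₁, hs1, s₂, hs2, -, -, -, hall⟩ := (hG i hi).coface τ h1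
  rcases hall s ((hG k hk).tet s hs).1 hτs with rfl | rfl
  · exact hdisj i hi k hk _ hs1 hs
  · exact hdisj i hi k hk _ hs2 hs

/-- Critical steps do not increase the potential. -/
lemma potential_critical_le (hG : ∀ i ∈ J, IsGadget M (T i) (D i) (A i) (W i))
    (hdisj : ∀ i ∈ J, ∀ k ∈ J, ∀ s, s ∈ T i → s ∈ T k → i = k)
    (ht0 : 0 ≤ t) (ht1 : t ≤ 1) (hth : ∀ j, t ≤ h j) (hh1 : ∀ j, h j ≤ 1)
    {s : MorseState V} {σ : Finset V} (hσ : σ ∈ topFaces s.1) :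
    potential t h J T D (deleteFace s.1 σ, s.2 + 1) ≤ potential t h J T D s := by
  classical
  unfold potential
  rw [pow_succ, mul_assoc]
  refine mul_le_mul_of_nonneg_left ?_ (pow_nonneg ht0 _)
  refine mul_prod_le_prod ht0 ht1 (fun i _ => gadgetFactor_le_one hh1) (fun i _ => le_gadgetFactor ht1 hth) ?_
  have key : ∀ i ∈ J, gadgetFactor h (T i) (D i) (deleteFace s.1 σ) ≠
      gadgetFactor h (T i) (D i) s.1 → σ ∈ D i ∨ σ ∈ T i := by
    intro i _ hne
    by_contra hcon
    push Not at hcon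
    refine hne (gadgetFactor_congr h ⟨fun h' => h'.trans (deleteFace_subset _ _), ?_⟩ ?_)
    · intro h' τ hτ
      exact (mem_deleteFace_of_top hσ τ).2 ⟨h' hτ, fun he => hcon.1 (he ▸ hτ)⟩
    · intro τ hτ
      rw [mem_deleteFace_of_top hσ τ]
      exact ⟨fun h => h.1, fun h => ⟨h, fun he => hcon.2 (he ▸ hτ)⟩⟩
  have hcard : ∀ i ∈ J, ∀ k ∈ J, σ ∈ D i → σ ∈ T k → False := by
    intro i hi k hk h1 h2
    have := ((hG i hi).tri σ h1).2
    have := ((hG k hk).tet σ h2).2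
    omega
  intro i hi k hk hne hne'
  rcases key i hi hne with h1 | h1 <;> rcases key k hk hne' with h2 | h2
  · obtain ⟨s₁, hs1, -, -, -, hσ1, -, -⟩ := (hG k hk).coface σ h2
    exact IsGadget.disjoint_tri hG hdisj hi hk h1 hs1 hσ1
  · exact (hcard i hi k hk h1 h2).elim
  · exact (hcard k hk i hi h2 h1).elim
  · exact hdisj i hi k hk σ h1 h2

/-- Collapses that delete neither a triangle nor a tetrahedron of a gadget preserve its factor. -/
lemma gadgetFactor_free_eq (hN : M.DimLE3) {T D : Finset (Finset V)} {A W : Set V}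
    (hG : IsGadget M T D A W)
    {S : Finset (Finset V)} (hS : IsState M S) {σ : Finset V} (hσ : σ ∈ freeFaces S) (hσD : σ ∉ D)
    (hT : ∀ s ∈ T, s ∈ S → ¬ σ ⊂ s) :
    gadgetFactor h T D (deleteFace S σ) = gadgetFactor h T D S := by
  refine gadgetFactor_congr h ⟨fun h' => h'.trans (deleteFace_subset _ _), fun h' =>
    hG.subset_deleteFace_of_free h' hσ hσD⟩ ?_
  obtain ⟨s, hs, hσs, hsc, hu, hdel⟩ := exists_coface_of_free hσ
  intro τ hτ
  rw [hdel]
  refine ⟨fun h => h.1, fun h => ⟨h, ?_, ?_⟩⟩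
  · rintro rfl
    have := (hG.tet τ hτ).2
    have := hN s (hS.1 s hs)
    omega
  · rintro rfl
    exact hT τ hτ hs hσs

/-- The faces of a gadget that are free through one of its tetrahedra. -/
def gadgetFree (T S : Finset (Finset V)) : Set (Finset V) :=
  {σ | σ ∈ freeFaces S ∧ ∃ s ∈ T, s ∈ S ∧ σ ⊂ s}

open Classical in
lemma card_gadgetFree_le {T D : Finset (Finset V)} {A W : Set V} (hG : IsGadget M T D A W)
    (S : Finset (Finset V)) : {σ ∈ freeFaces S | σ ∈ gadgetFree T S}.card ≤ 4 * T.card := by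
  have hsub : {σ ∈ freeFaces S | σ ∈ gadgetFree T S} ⊆ T.biUnion fun s => s.powersetCard 3 := by
    intro σ hσ
    obtain ⟨hσ, -, s, hsT, hsS, hσs⟩ := Finset.mem_filter.1 hσ
    obtain ⟨s', hs', -, hc, hu, -⟩ := exists_coface_of_free hσ
    have := hu s hsS hσs
    subst this
    have := (hG.tet s hsT).2
    exact Finset.mem_biUnion.2 ⟨s, hsT, Finset.mem_powersetCard.2 ⟨hσs.1, by omega⟩⟩
  refine (Finset.card_le_card hsub).trans (Finset.card_biUnion_le.trans ?_)
  rw [Finset.sum_congr rfl (g := fun _ => 4)]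
  · simp [mul_comm]
  · intro s hs
    rw [Finset.card_powersetCard, (hG.tet s hs).2]
    rfl

open Classical in
lemma sum_gadgetFactor_le {T D : Finset (Finset V)} {A W : Set V}
    (hG : IsGadget M T D A W) {F : ℕ} (hF : 4 * T.card ≤ F) (hh1 : ∀ j, h j ≤ 1)
    (hh : ∀ m j : ℕ, 1 ≤ m → m ≤ F → (m - 1 : ℝ) + h j ≤ m * h (j + 1))
    {S : Finset (Finset V)} (hS : IsState M S) :
    ∑ σ ∈ freeFaces S with σ ∈ gadgetFree T S, gadgetFactor h T D (deleteFace S σ) ≤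
      {σ ∈ freeFaces S | σ ∈ gadgetFree T S}.card * gadgetFactor h T D S := by
  set R := {σ ∈ freeFaces S | σ ∈ gadgetFree T S} with hR
  by_cases hDS : D ⊆ S
  swap
  · have e1 : gadgetFactor h T D S = 1 := if_neg hDS
    have e2 : ∀ σ ∈ R, gadgetFactor h T D (deleteFace S σ) = 1 := fun σ _ =>
      if_neg fun h' => hDS (h'.trans (deleteFace_subset _ _))
    rw [Finset.sum_congr rfl e2, e1]
    simp
  rcases R.eq_empty_or_nonempty with hRe | hRne
  · simp [hRe]
  -- a free triangle of the gadget outside `D`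
  have hgood : ∃ σ ∈ R, σ ∉ D := by
    obtain ⟨σ, hσ⟩ := hRne
    by_cases hσD : σ ∈ D
    · obtain ⟨τ, hτ, hτD, -, -, s, hsS, hsT, hτs⟩ :=
        hG.exists_free hS (Finset.mem_filter.1 hσ).1 hσD
      exact ⟨τ, Finset.mem_filter.2 ⟨hτ, hτ, s, hsT, hsS, hτs⟩, hτD⟩
    · exact ⟨σ, hσ, hσD⟩
  obtain ⟨σ₀, hσ₀, hσ₀D⟩ := hgood
  have hm : 1 ≤ R.card := Finset.card_pos.2 hRne
  have hmF : R.card ≤ F := (card_gadgetFree_le hG S).trans hF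
  have hfac : gadgetFactor h T D S = h (T ∩ S).card := if_pos hDS
  have hσ₀' : gadgetFactor h T D (deleteFace S σ₀) = h ((T ∩ S).card - 1) ∧
      1 ≤ (T ∩ S).card := by
    obtain ⟨hσ, -, s, hsT, hsS, hσs⟩ := Finset.mem_filter.1 hσ₀
    obtain ⟨s', hs', -, hc, hu, hdel⟩ := exists_coface_of_free hσ
    have := hu s hsS hσs
    subst this
    have hmem : s ∈ T ∩ S := Finset.mem_inter.2 ⟨hsT, hsS⟩
    have he : T ∩ deleteFace S σ₀ = (T ∩ S).erase s := by
      ext τ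
      simp only [Finset.mem_inter, Finset.mem_erase, hdel]
      constructor
      · rintro ⟨h1, h2, h3, h4⟩
        exact ⟨h4, h1, h2⟩
      · rintro ⟨h4, h1, h2⟩
        refine ⟨h1, h2, ?_, h4⟩
        rintro rfl
        have := (hG.tet τ h1).2
        have := (hG.tet s hsT).2
        omega
    refine ⟨?_, Finset.card_pos.2 ⟨s, hmem⟩⟩
    unfold gadgetFactor
    rw [if_pos (hG.subset_deleteFace_of_free hDS hσ hσ₀D), he, Finset.card_erase_of_mem hmem]
  have hsum : ∑ σ ∈ R, gadgetFactor h T D (deleteFace S σ) ≤ (R.card - 1 : ℝ) +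
      h ((T ∩ S).card - 1) := by
    rw [← Finset.sum_erase_add R _ hσ₀, hσ₀'.1]
    gcongr
    calc _ ≤ ∑ σ ∈ R.erase σ₀, (1 : ℝ) := Finset.sum_le_sum fun σ _ => gadgetFactor_le_one hh1
      _ = R.card - 1 := by
        rw [Finset.sum_const, Finset.card_erase_of_mem hσ₀, nsmul_eq_mul, mul_one,
          Nat.cast_sub hm, Nat.cast_one]
  refine hsum.trans ?_
  have := hh R.card ((T ∩ S).card - 1) hm hmF
  rwa [Nat.sub_add_cancel hσ₀'.2, ← hfac] at this

/-- Averaged over all free faces, a collapse does not increase the product of the factors. -/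
lemma sum_prod_gadgetFactor_le (hN : M.DimLE3)
    (hG : ∀ i ∈ J, IsGadget M (T i) (D i) (A i) (W i))
    (hdisj : ∀ i ∈ J, ∀ k ∈ J, ∀ s, s ∈ T i → s ∈ T k → i = k) {F : ℕ}
    (hF : ∀ i ∈ J, 4 * (T i).card ≤ F) (hh0 : ∀ j, 0 ≤ h j) (hh1 : ∀ j, h j ≤ 1)
    (hh : ∀ m j : ℕ, 1 ≤ m → m ≤ F → (m - 1 : ℝ) + h j ≤ m * h (j + 1))
    {S : Finset (Finset V)} (hS : IsState M S) :
    ∑ σ ∈ freeFaces S, ∏ i ∈ J, gadgetFactor h (T i) (D i) (deleteFace S σ) ≤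
      (freeFaces S).card * ∏ i ∈ J, gadgetFactor h (T i) (D i) S := by
  classical
  have hnn : ∀ (i : ι) (S : Finset (Finset V)), 0 ≤ gadgetFactor h (T i) (D i) S := fun i S =>
    le_gadgetFactor zero_le_one hh0
  -- faces that are not free in a gadget preserve its factor
  have hkeep : ∀ i ∈ J, ∀ σ ∈ freeFaces S, σ ∉ gadgetFree (T i) S →
      gadgetFactor h (T i) (D i) (deleteFace S σ) = gadgetFactor h (T i) (D i) S := by
    intro i hi σ hσ hσT
    refine gadgetFactor_free_eq hN (hG i hi) hS hσ (fun hσD => hσT ?_) fun s hsT hsS hσs =>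
      hσT ⟨hσ, s, hsT, hsS, hσs⟩
    obtain ⟨s, hs, hσs, -⟩ := exists_coface_of_free hσ
    obtain ⟨s₁, h1, s₂, h2, -, -, -, hall⟩ := (hG i hi).coface σ hσD
    refine ⟨hσ, s, ?_, hs, hσs⟩
    rcases hall s (hS.1 s hs) hσs with rfl | rfl <;> assumption
  have huniq : ∀ i ∈ J, ∀ k ∈ J, ∀ σ, σ ∈ gadgetFree (T i) S → σ ∈ gadgetFree (T k) S → i = k := by
    rintro i hi k hk σ ⟨hσ, s, hsT, hsS, hσs⟩ ⟨-, s', hsT', hsS', hσs'⟩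
    obtain ⟨r, -, -, -, hu, -⟩ := exists_coface_of_free hσ
    have := (hu s hsS hσs).trans (hu s' hsS' hσs').symm
    subst this
    exact hdisj i hi k hk s hsT hsT'
  set c : Finset V → Option ι := fun σ =>
    if hex : ∃ i ∈ J, σ ∈ gadgetFree (T i) S then some hex.choose else none with hc
  have hcs : ∀ σ i, i ∈ J → (c σ = some i ↔ σ ∈ gadgetFree (T i) S) := by
    intro σ i hi
    simp only [hc]
    split_ifs with hex
    · rw [Option.some_inj]
      refine ⟨fun he => he ▸ hex.choose_spec.2, fun h' => ?_⟩
      exact huniq _ hex.choose_spec.1 i hi σ hex.choose_spec.2 h'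
    · simp only [false_iff]
      exact fun h' => hex ⟨i, hi, h'⟩
  have hmaps : ∀ σ ∈ freeFaces S, c σ ∈ insert none (J.image some) := by
    intro σ _
    simp only [hc]
    split_ifs with hex
    · exact Finset.mem_insert_of_mem (Finset.mem_image_of_mem _ hex.choose_spec.1)
    · exact Finset.mem_insert_self _ _
  rw [← Finset.sum_fiberwise_of_maps_to hmaps, Finset.card_eq_sum_card_fiberwise hmaps,
    Nat.cast_sum, Finset.sum_mul]
  refine Finset.sum_le_sum fun y hy => ?_
  rcases Finset.mem_insert.1 hy with rfl | hy
  · rw [← nsmul_eq_mul]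
    refine Finset.sum_le_card_nsmul _ _ _ fun σ hσ => ?_
    rw [Finset.mem_filter] at hσ
    refine (Finset.prod_congr rfl fun i hi => hkeep i hi σ hσ.1 fun h' => ?_).le
    rw [← hcs σ i hi, hσ.2] at h'
    simp at h'
  · obtain ⟨i, hi, rfl⟩ := Finset.mem_image.1 hy
    have hfil : {σ ∈ freeFaces S | c σ = some i} = {σ ∈ freeFaces S | σ ∈ gadgetFree (T i) S} :=
      Finset.filter_congr fun σ _ => hcs σ i hi
    rw [hfil]
    have hprod : ∀ σ ∈ {σ ∈ freeFaces S | σ ∈ gadgetFree (T i) S},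
        ∏ k ∈ J, gadgetFactor h (T k) (D k) (deleteFace S σ) =
          gadgetFactor h (T i) (D i) (deleteFace S σ) *
            ∏ k ∈ J.erase i, gadgetFactor h (T k) (D k) S := by
      intro σ hσ
      rw [Finset.mem_filter] at hσ
      rw [← Finset.mul_prod_erase J _ hi]
      congr 1
      refine Finset.prod_congr rfl fun k hk => ?_
      rw [Finset.mem_erase] at hk
      exact hkeep k hk.2 σ hσ.1 fun h' => hk.1 (huniq k hk.2 i hi σ h' hσ.2)
    rw [Finset.sum_congr rfl hprod, ← Finset.sum_mul, ← Finset.mul_prod_erase J _ hi, ← mul_assoc]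
    exact mul_le_mul_of_nonneg_right
      (sum_gadgetFactor_le (hG i hi) (hF i hi) hh1 hh hS)
      (Finset.prod_nonneg fun k _ => hnn k S)

end Family

variable {V : Type u}

/-! ### Lexicographic comparison of faces -/

lemma lexKey_lt {lab : V → ℕ} {σ τ : Finset V} (hσ : σ.Nonempty)
    (h : ∃ x ∈ τ, ∀ y ∈ σ, lab x < lab y) : lexKey lab τ < lexKey lab σ := by
  classical
  obtain ⟨x, hx, hlt⟩ := h
  unfold lexKey
  have hxm : lab x ∈ (τ.image lab).sort (· ≤ ·) := by
    rw [Finset.mem_sort]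
    exact Finset.mem_image_of_mem _ hx
  have hsort := Finset.pairwise_sort (τ.image lab) (· ≤ ·)
  have hmem : ∀ b ∈ (σ.image lab).sort (· ≤ ·), lab x < b := by
    intro b hb
    rw [Finset.mem_sort] at hb
    obtain ⟨y, hy, rfl⟩ := Finset.mem_image.1 hb
    exact hlt y hy
  have hne : (σ.image lab).sort (· ≤ ·) ≠ [] := by
    intro h0
    have := Finset.length_sort (s := σ.image lab) (· ≤ ·)
    rw [h0] at this
    have h2 := Finset.card_pos.2 (hσ.image lab)
    simp at this
    omega
  cases hl : (τ.image lab).sort (· ≤ ·) with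
  | nil => rw [hl] at hxm; simp at hxm
  | cons a l =>
    cases hl' : (σ.image lab).sort (· ≤ ·) with
    | nil => exact absurd hl' hne
    | cons b l' =>
      rw [hl] at hxm hsort
      rw [hl'] at hmem
      refine List.cons_lt_cons_iff.2 (Or.inl ?_)
      have hb := hmem b (by simp)
      rcases List.mem_cons.1 hxm with h | h
      · omega
      · have := (List.pairwise_cons.1 hsort).1 _ h
        omega

lemma lexFirstSelector_support {lab : V → ℕ} {A : Finset (Finset V)} {h : A.Nonempty}
    {σ : Finset V} (hσ : σ ∈ (lexFirstSelector lab A h).support) :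
    ∀ τ ∈ A, lexKey lab σ ≤ lexKey lab τ := by
  simp only [lexFirstSelector, PMF.support_pure, Set.mem_singleton_iff] at hσ
  subst hσ
  exact (A.exists_min_image (lexKey lab) h).choose_spec.2

lemma lexLastSelector_support {lab : V → ℕ} {A : Finset (Finset V)} {h : A.Nonempty}
    {σ : Finset V} (hσ : σ ∈ (lexLastSelector lab A h).support) :
    ∀ τ ∈ A, lexKey lab τ ≤ lexKey lab σ := by
  simp only [lexLastSelector, PMF.support_pure, Set.mem_singleton_iff] at hσ
  subst hσ
  exact (A.exists_max_image (lexKey lab) h).choose_spec.2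

/-- The labels of the vertices of `T` in `Q` exceed the other labels of vertices of `T`. -/
def LabelsAbove (lab : V → ℕ) (T : Finset (Finset V)) (Q : Set V) : Prop :=
  ∀ s ∈ T, ∀ x ∈ s, ∀ s' ∈ T, ∀ y ∈ s', x ∉ Q → y ∈ Q → lab x < lab y

/-- The selector does not pick a triangle of `D` among the free faces. -/
def AvoidsGadget (sel : Selector V) (M : FinComplex V) (D : Finset (Finset V)) : Prop :=
  ∀ S, IsState M S → ∀ h : (freeFaces S).Nonempty, ∀ σ ∈ (sel (freeFaces S) h).support, σ ∉ D

lemma IsGadget.exists_subset_tet {M : FinComplex V} {T D : Finset (Finset V)} {A W : Set V}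
    (hG : IsGadget M T D A W) {σ : Finset V} (hσ : σ ∈ D) : ∃ s ∈ T, σ ⊆ s := by
  obtain ⟨s, hs, -, -, -, h, -⟩ := hG.coface σ hσ
  exact ⟨s, hs, h.1⟩

lemma avoidsGadget_lexFirst {M : FinComplex V} {T D : Finset (Finset V)} {A W : Set V}
    (hG : IsGadget M T D A W) {lab : V → ℕ} (hlab : LabelsAbove lab T W) :
    AvoidsGadget (lexFirstSelector lab) M D := by
  intro S hS h σ hσ hσD
  obtain ⟨τ, hτ, hτD, -, ⟨x, hx, hxW⟩, s, hsS, hsT, hτs⟩ :=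
    hG.exists_free hS (proper_lexFirstSelector lab _ _ _ hσ) hσD
  obtain ⟨s', hs', hσs'⟩ := hG.exists_subset_tet hσD
  refine absurd (lexFirstSelector_support hσ τ hτ) (not_le.2 (lexKey_lt ?_ ⟨x, hx, ?_⟩))
  · exact Finset.card_pos.1 (by rw [(hG.tri σ hσD).2]; norm_num)
  · exact fun y hy => hlab s hsT x (hτs.1 hx) s' hs' y (hσs' hy) hxW (hG.within σ hσD y hy)

lemma avoidsGadget_lexLast {M : FinComplex V} {T D : Finset (Finset V)} {A W : Set V}
    (hG : IsGadget M T D A W) {lab : V → ℕ} (hlab : LabelsAbove lab T Aᶜ) :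
    AvoidsGadget (lexLastSelector lab) M D := by
  intro S hS h σ hσ hσD
  obtain ⟨τ, hτ, hτD, hτA, -, s, hsS, hsT, hτs⟩ :=
    hG.exists_free hS (proper_lexLastSelector lab _ _ _ hσ) hσD
  obtain ⟨s', hs', hσs'⟩ := hG.exists_subset_tet hσD
  obtain ⟨x, hx, hxA⟩ := hG.meets σ hσD
  refine absurd (lexLastSelector_support hσ τ hτ) (not_le.2 (lexKey_lt ?_ ⟨x, hx, ?_⟩))
  · exact FinComplex.nonempty_of_mem (hS.1 τ (mem_of_mem_freeFaces hτ))
  · exact fun y hy => hlab s' hs' x (hσs' hx) s hsT y (hτs.1 hy) (fun h => h hxA) (hτA y hy)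

/-! ### Complete runs -/

section Complete

variable {ι : Type*} {M : FinComplex V} {J : Finset ι} {T D : ι → Finset (Finset V)}
  {A W : ι → Set V} {h : ℕ → ℝ} {t : ℝ}

lemma expect_pow_le_potential {sel : Selector V} (hsel : sel.Proper)
    (hne : ∀ i ∈ J, (D i).Nonempty)
    (hstep : ∀ s : MorseState V, IsState M s.1 → s.1 ≠ ∅ →
      (morseStep sel s).expect (fun s => ENNReal.ofReal (potential t h J T D s)) ≤
        ENNReal.ofReal (potential t h J T D s)) :
    (morseRun sel (· = ∅) M.faceFinset.card (M.faceFinset, 0)).expect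
      (fun s => ENNReal.ofReal (t ^ s.2)) ≤
        ENNReal.ofReal (potential t h J T D (M.faceFinset, 0)) := by
  refine le_trans (PMF.expect_mono_support _ fun s hs => ?_)
    (expect_morseRun_le (Inv := fun s => IsState M s.1)
      (Φ := fun s => ENNReal.ofReal (potential t h J T D s))
      (fun s hs _ s' hs' => hs.step hsel hs') hstep M.faceFinset.card (M.faceFinset, 0)
      (isState_faceFinset M))
  have he : s.1 = ∅ := halt_of_mem_support_morseRun (halt := (· = ∅)) hsel rfl M.faceFinset.card
    (M.faceFinset, 0) le_rfl s hs
  have : potential t h J T D s = t ^ s.2 := by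
    unfold potential
    rw [Finset.prod_eq_one, mul_one]
    intro i hi
    rw [he]
    refine if_neg fun h' => ?_
    obtain ⟨x, hx⟩ := hne i hi
    simpa using h' hx
  rw [this]

lemma expect_morseStep_uniform_le (hN : M.DimLE3)
    (hG : ∀ i ∈ J, IsGadget M (T i) (D i) (A i) (W i))
    (hdisj : ∀ i ∈ J, ∀ k ∈ J, ∀ s, s ∈ T i → s ∈ T k → i = k) {F : ℕ}
    (hF : ∀ i ∈ J, 4 * (T i).card ≤ F) (ht0 : 0 ≤ t) (ht1 : t ≤ 1) (hth : ∀ j, t ≤ h j)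
    (hh1 : ∀ j, h j ≤ 1)
    (hh : ∀ m j : ℕ, 1 ≤ m → m ≤ F → (m - 1 : ℝ) + h j ≤ m * h (j + 1))
    {s : MorseState V} (hs : IsState M s.1) :
    (morseStep uniformSelector s).expect (fun s => ENNReal.ofReal (potential t h J T D s)) ≤
        ENNReal.ofReal (potential t h J T D s) := by
  have hpn : ∀ s, 0 ≤ potential t h J T D s := fun s => mul_nonneg (pow_nonneg ht0 _)
    (Finset.prod_nonneg fun i _ => ht0.trans (le_gadgetFactor ht1 hth))
  unfold morseStep
  split_ifs with h1 h2
  · rw [PMF.expect_map, uniformSelector, PMF.expect_uniformOfFinset,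
      ← ENNReal.ofReal_sum_of_nonneg fun _ _ => hpn _]
    have hc : (0 : ℝ) < (freeFaces s.1).card := Nat.cast_pos.2 (Finset.card_pos.2 h1)
    rw [← ENNReal.ofReal_natCast, ← ENNReal.ofReal_inv_of_pos hc, ← ENNReal.ofReal_mul
      (inv_nonneg.2 hc.le)]
    refine ENNReal.ofReal_le_ofReal ?_
    rw [inv_mul_le_iff₀ hc]
    have := sum_prod_gadgetFactor_le hN hG hdisj hF (fun j => ht0.trans (hth j)) hh1 hh hs
    unfold potential
    simp only
    rw [← Finset.mul_sum, mul_left_comm]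
    exact mul_le_mul_of_nonneg_left this (pow_nonneg ht0 _)
  · rw [PMF.expect_map]
    refine (PMF.expect_mono_support _ (g := fun _ => ENNReal.ofReal (potential t h J T D s))
      fun σ hσ => ?_).trans (PMF.expect_const _ _).le
    exact ENNReal.ofReal_le_ofReal (potential_critical_le hG hdisj ht0 ht1 hth hh1
      (proper_uniformSelector _ _ _ hσ))
  · rw [PMF.expect_pure]

lemma expect_morseStep_avoids_le {sel : Selector V} (hsel : sel.Proper)
    (hG : ∀ i ∈ J, IsGadget M (T i) (D i) (A i) (W i))
    (hdisj : ∀ i ∈ J, ∀ k ∈ J, ∀ s, s ∈ T i → s ∈ T k → i = k)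
    (havoid : ∀ i ∈ J, AvoidsGadget sel M (D i)) (ht0 : 0 ≤ t) (ht1 : t ≤ 1)
    {s : MorseState V} (hs : IsState M s.1) :
    (morseStep sel s).expect
      (fun s => ENNReal.ofReal (potential t (fun _ => t) J T D s)) ≤
        ENNReal.ofReal (potential t (fun _ => t) J T D s) := by
  unfold morseStep
  split_ifs with h1 h2
  · rw [PMF.expect_map]
    refine (PMF.expect_mono_support _
      (g := fun _ => ENNReal.ofReal (potential t (fun _ => t) J T D s))
      fun σ hσ => ?_).trans (PMF.expect_const _ _).le
    refine ENNReal.ofReal_le_ofReal ?_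
    unfold potential
    refine mul_le_mul_of_nonneg_left (Finset.prod_le_prod (fun i _ => ?_) fun i hi => ?_)
      (pow_nonneg ht0 _)
    · exact ht0.trans (le_gadgetFactor ht1 fun _ => le_rfl)
    · by_cases hD : D i ⊆ s.1
      · have := (hG i hi).subset_deleteFace_of_free hD (hsel _ _ _ hσ) (havoid i hi _ hs h1 σ hσ)
        unfold gadgetFactor
        rw [if_pos hD, if_pos this]
      · refine (gadgetFactor_le_one fun _ => ht1).trans ?_
        unfold gadgetFactor
        rw [if_neg hD]
  · rw [PMF.expect_map]
    refine (PMF.expect_mono_support _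
      (g := fun _ => ENNReal.ofReal (potential t (fun _ => t) J T D s))
      fun σ hσ => ?_).trans (PMF.expect_const _ _).le
    exact ENNReal.ofReal_le_ofReal (potential_critical_le hG hdisj ht0 ht1 (fun _ => le_rfl)
      (fun _ => ht1) (hsel _ _ _ hσ))
  · rw [PMF.expect_pure]

lemma IsGadget.subset_faceFinset {T D : Finset (Finset V)} {A W : Set V}
    (hG : IsGadget M T D A W) : D ⊆ M.faceFinset := fun τ hτ =>
  FinComplex.mem_faceFinset.2 (hG.tri τ hτ).1

/-- The exponential moment of the number of critical faces of a uniformly random run. -/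
lemma expect_pow_uniform_le (hN : M.DimLE3)
    (hG : ∀ i ∈ J, IsGadget M (T i) (D i) (A i) (W i))
    (hdisj : ∀ i ∈ J, ∀ k ∈ J, ∀ s, s ∈ T i → s ∈ T k → i = k) {F : ℕ} (hF0 : 1 ≤ F)
    (hF : ∀ i ∈ J, 4 * (T i).card ≤ F) (ht0 : 0 ≤ t) (ht1 : t ≤ 1) :
    (morseRun uniformSelector (· = ∅) M.faceFinset.card (M.faceFinset, 0)).expect
      (fun s => ENNReal.ofReal (t ^ s.2)) ≤
        ENNReal.ofReal ((1 - (1 - t) * ((F : ℝ) ^ F)⁻¹) ^ J.card) := by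
  classical
  set h : ℕ → ℝ := fun j => 1 - (1 - t) * ((F : ℝ) ^ j)⁻¹ with hh
  have hF1 : (1 : ℝ) ≤ F := by exact_mod_cast hF0
  have hp : ∀ j : ℕ, (0 : ℝ) < (F : ℝ) ^ j := fun j => by positivity
  have hpi : ∀ j : ℕ, ((F : ℝ) ^ j)⁻¹ ≤ 1 := fun j => inv_le_one_of_one_le₀ (one_le_pow₀ hF1)
  have hth : ∀ j, t ≤ h j := by
    intro j
    have := mul_le_of_le_one_right (sub_nonneg.2 ht1) (hpi j)
    simp only [hh]
    linarith
  have hh1 : ∀ j, h j ≤ 1 := by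
    intro j
    have := mul_nonneg (sub_nonneg.2 ht1) (inv_nonneg.2 (hp j).le)
    simp only [hh]
    linarith
  have hrec : ∀ m j : ℕ, 1 ≤ m → m ≤ F → (m - 1 : ℝ) + h j ≤ m * h (j + 1) := by
    intro m j _ hm
    have hmF : (m : ℝ) ≤ F := by exact_mod_cast hm
    have : (m : ℝ) * ((F : ℝ) ^ (j + 1))⁻¹ ≤ ((F : ℝ) ^ j)⁻¹ := by
      rw [pow_succ, mul_inv, mul_left_comm]
      refine mul_le_of_le_one_right (inv_nonneg.2 (hp j).le) ?_
      rw [← div_eq_mul_inv]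
      exact div_le_one_of_le₀ hmF (by positivity)
    have := mul_le_mul_of_nonneg_left this (sub_nonneg.2 ht1)
    simp only [hh]
    nlinarith
  refine (expect_pow_le_potential proper_uniformSelector (fun i hi => (hG i hi).nonempty)
    fun s hs _ => expect_morseStep_uniform_le hN hG hdisj hF ht0 ht1 hth hh1 hrec hs).trans ?_
  refine ENNReal.ofReal_le_ofReal ?_
  unfold potential
  rw [pow_zero, one_mul]
  rw [← Finset.prod_const]
  refine Finset.prod_le_prod (fun i _ => ht0.trans (le_gadgetFactor ht1 hth)) fun i hi => ?_
  unfold gadgetFactor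
  rw [if_pos (hG i hi).subset_faceFinset]
  simp only [hh]
  have hcard : (T i ∩ M.faceFinset).card ≤ F :=
    (Finset.card_le_card Finset.inter_subset_left).trans (by have := hF i hi; omega)
  have : ((F : ℝ) ^ F)⁻¹ ≤ ((F : ℝ) ^ (T i ∩ M.faceFinset).card)⁻¹ :=
    inv_anti₀ (hp _) (pow_le_pow_right₀ hF1 hcard)
  have := mul_le_mul_of_nonneg_left this (sub_nonneg.2 ht1)
  linarith

/-- The exponential moment of the number of critical faces of a run that avoids gadgets. -/
lemma expect_pow_avoids_le {sel : Selector V} (hsel : sel.Proper)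
    (hG : ∀ i ∈ J, IsGadget M (T i) (D i) (A i) (W i))
    (hdisj : ∀ i ∈ J, ∀ k ∈ J, ∀ s, s ∈ T i → s ∈ T k → i = k)
    (havoid : ∀ i ∈ J, AvoidsGadget sel M (D i)) (ht0 : 0 ≤ t) (ht1 : t ≤ 1) :
    (morseRun sel (· = ∅) M.faceFinset.card (M.faceFinset, 0)).expect
      (fun s => ENNReal.ofReal (t ^ s.2)) ≤ ENNReal.ofReal (t ^ J.card) := by
  refine (expect_pow_le_potential hsel (fun i hi => (hG i hi).nonempty)
    fun s hs _ => expect_morseStep_avoids_le hsel hG hdisj havoid ht0 ht1 hs).trans ?_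
  refine ENNReal.ofReal_le_ofReal ?_
  unfold potential
  rw [pow_zero, one_mul]
  rw [← Finset.prod_const]
  refine Finset.prod_le_prod (fun i _ => ht0.trans (le_gadgetFactor ht1 fun _ => le_rfl)) fun i hi => ?_
  unfold gadgetFactor
  rw [if_pos (hG i hi).subset_faceFinset]

end Complete

variable {V : Type u}

/-! ### Finding a gadget in a ball -/

/-- The current complex has dimension at most two. -/
abbrev HaltDim (S : Finset (Finset V)) : Prop := ∀ σ ∈ S, σ.card ≤ 3

/-- As long as there are tetrahedra, there are free triangles. -/
def HasFreeFaces (M : FinComplex V) : Prop :=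
  ∀ S, IsState M S → ¬ HaltDim S → (freeFaces S).Nonempty

section Find

variable {M : FinComplex V} {T D : Finset (Finset V)} {A W : Set V} {sel : Selector V}

lemma sup_eq_four (hN : M.DimLE3) {S : Finset (Finset V)} (hS : IsState M S) (h : ¬ HaltDim S) :
    S.sup Finset.card = 4 := by
  unfold HaltDim at h
  push Not at h
  obtain ⟨σ, hσ, hc⟩ := h
  have h1 := card_le_sup hσ
  have h2 : S.sup Finset.card ≤ 4 := Finset.sup_le fun τ hτ => hN τ (hS.1 τ hτ)
  omega

/-- The probability that a run on `M` collapses to dimension two and keeps `D`. -/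
lemma exists_support_find (hG : IsGadget M T D A W) (hfree : HasFreeFaces M)
    (hchoice : ∀ S, IsState M S → ∀ h : (freeFaces S).Nonempty,
      ∃ σ ∈ (sel (freeFaces S) h).support, σ ∈ freeFaces S ∧ σ ∉ D) (n : ℕ) :
    ∃ s ∈ (morseRun sel HaltDim n (M.faceFinset, 0)).support,
      IsState M s.1 ∧ s.2 = 0 ∧ D ⊆ s.1 := by
  refine exists_mem_support_morseRun (Good := fun s => IsState M s.1 ∧ s.2 = 0 ∧ D ⊆ s.1) ?_ n _
    ⟨isState_faceFinset M, rfl, hG.subset_faceFinset⟩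
  rintro ⟨S, k⟩ ⟨hS, rfl, hD⟩ hh
  have hne := hfree S hS hh
  obtain ⟨σ, hσ, hσf, hσD⟩ := hchoice S hS hne
  refine ⟨(deleteFace S σ, 0), ?_, hS.deleteFace σ, rfl, hG.subset_deleteFace_of_free hD hσf hσD⟩
  unfold morseStep
  rw [dif_pos hne, PMF.mem_support_map_iff]
  exact ⟨σ, hσ, rfl⟩

lemma IsGadget.exists_choice_uniform (hG : IsGadget M T D A W) {S : Finset (Finset V)}
    (hS : IsState M S) (h : (freeFaces S).Nonempty) :
    ∃ σ ∈ (uniformSelector (freeFaces S) h).support, σ ∈ freeFaces S ∧ σ ∉ D := by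
  have hsupp : ∀ σ ∈ freeFaces S, σ ∈ (uniformSelector (freeFaces S) h).support := by
    intro σ hσ
    unfold uniformSelector
    exact (PMF.mem_support_uniformOfFinset_iff h σ).2 hσ
  obtain ⟨σ, hσ⟩ := h
  by_cases hσD : σ ∈ D
  · obtain ⟨τ, hτ, hτD, -⟩ := hG.exists_free hS hσ hσD
    exact ⟨τ, hsupp τ hτ, hτ, hτD⟩
  · exact ⟨σ, hsupp σ hσ, hσ, hσD⟩

lemma AvoidsGadget.exists_choice (hsel : sel.Proper) (hav : AvoidsGadget sel M D)
    {S : Finset (Finset V)} (hS : IsState M S) (h : (freeFaces S).Nonempty) :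
    ∃ σ ∈ (sel (freeFaces S) h).support, σ ∈ freeFaces S ∧ σ ∉ D := by
  obtain ⟨σ, hσ⟩ := (sel (freeFaces S) h).support_nonempty
  exact ⟨σ, hσ, hsel _ _ _ hσ, hav S hS h σ hσ⟩

/-- A triangle with exactly two cofaces. -/
structure IsWall (M : FinComplex V) (τ s₁ s₂ : Finset V) : Prop where
  card : τ.card = 3
  mem₁ : s₁ ∈ M.faces
  mem₂ : s₂ ∈ M.faces
  card₁ : s₁.card = 4
  card₂ : s₂.card = 4
  ne : s₁ ≠ s₂
  sub₁ : τ ⊂ s₁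
  sub₂ : τ ⊂ s₂
  all : ∀ s ∈ M.faces, τ ⊂ s → s = s₁ ∨ s = s₂

variable {τ s₁ s₂ : Finset V}

lemma IsWall.symm (h : IsWall M τ s₁ s₂) : IsWall M τ s₂ s₁ :=
  ⟨h.card, h.mem₂, h.mem₁, h.card₂, h.card₁, h.ne.symm, h.sub₂, h.sub₁,
    fun s hs hτs => (h.all s hs hτs).symm⟩

lemma IsWall.free (hw : IsWall M τ s₁ s₂) {S : Finset (Finset V)} (hS : IsState M S)
    (hsup : S.sup Finset.card = 4) (h1 : s₁ ∈ S) (h2 : s₂ ∉ S) : τ ∈ freeFaces S := by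
  refine mem_freeFaces.2 ⟨hS.2 s₁ h1 τ hw.sub₁.1 (Finset.card_pos.1 (by rw [hw.card]; norm_num)),
    by rw [hw.card, hsup], s₁, h1, hw.sub₁, fun ρ hρ hτρ => ?_⟩
  rcases hw.all ρ (hS.1 ρ hρ) hτρ with rfl | rfl
  exacts [rfl, absurd hρ h2]

open Classical in
/-- A bound for the probability that the wall `τ` survives. -/
def wallBound (τ s₁ s₂ : Finset V) (S : Finset (Finset V)) : ℝ :=
  if τ ∈ S then if s₁ ∈ S ∨ s₂ ∈ S then 3 / 4 else 1 else 0

lemma wallBound_nonneg (S : Finset (Finset V)) : 0 ≤ wallBound τ s₁ s₂ S := by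
  unfold wallBound
  split_ifs <;> norm_num

lemma wallBound_le_one (S : Finset (Finset V)) : wallBound τ s₁ s₂ S ≤ 1 := by
  unfold wallBound
  split_ifs <;> norm_num

lemma wallBound_le {S : Finset (Finset V)} (h : s₁ ∈ S ∨ s₂ ∈ S) :
    wallBound τ s₁ s₂ S ≤ 3 / 4 := by
  unfold wallBound
  split_ifs <;> norm_num

lemma wallBound_comm (S : Finset (Finset V)) : wallBound τ s₁ s₂ S = wallBound τ s₂ s₁ S := by
  unfold wallBound
  by_cases h : τ ∈ S <;> by_cases h1 : s₁ ∈ S <;> by_cases h2 : s₂ ∈ S <;> simp [h, h1, h2]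

open Classical in
lemma IsWall.sum_wallBound_le_of_one (hw : IsWall M τ s₁ s₂) {S : Finset (Finset V)}
    (hS : IsState M S) (hsup : S.sup Finset.card = 4) (hτ : τ ∈ S) (h1 : s₁ ∈ S) (h2 : s₂ ∉ S) :
    ∑ σ ∈ freeFaces S, wallBound τ s₁ s₂ (deleteFace S σ) ≤
      (freeFaces S).card * wallBound τ s₁ s₂ S := by
  have e : wallBound τ s₁ s₂ S = 3 / 4 := by
    unfold wallBound
    rw [if_pos hτ, if_pos (Or.inl h1)]
  have hfree := hw.free hS hsup h1 h2
  rw [e, ← Finset.sum_filter_add_sum_filter_not (freeFaces S) (· ⊂ s₁)]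
  have hR : {σ ∈ freeFaces S | σ ⊂ s₁}.card ≤ 4 := by
    have : {σ ∈ freeFaces S | σ ⊂ s₁} ⊆ s₁.powersetCard 3 := by
      intro σ hσ
      rw [Finset.mem_filter] at hσ
      have := (mem_freeFaces.1 hσ.1).2.1
      exact Finset.mem_powersetCard.2 ⟨hσ.2.1, by omega⟩
    refine (Finset.card_le_card this).trans ?_
    rw [Finset.card_powersetCard, hw.card₁]
    rfl
  have hτR : τ ∈ {σ ∈ freeFaces S | σ ⊂ s₁} := Finset.mem_filter.2 ⟨hfree, hw.sub₁⟩
  have b1 : ∑ σ ∈ freeFaces S with σ ⊂ s₁, wallBound τ s₁ s₂ (deleteFace S σ) ≤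
      {σ ∈ freeFaces S | σ ⊂ s₁}.card - 1 := by
    rw [← Finset.add_sum_erase _ _ hτR]
    have : wallBound τ s₁ s₂ (deleteFace S τ) = 0 := by
      unfold wallBound
      rw [if_neg]
      rw [mem_deleteFace]
      exact fun h => h.2 subset_rfl
    rw [this, zero_add]
    calc _ ≤ ∑ σ ∈ {σ ∈ freeFaces S | σ ⊂ s₁}.erase τ, (1 : ℝ) :=
          Finset.sum_le_sum fun σ _ => wallBound_le_one _
      _ = _ := by
        rw [Finset.sum_const, Finset.card_erase_of_mem hτR, nsmul_eq_mul, mul_one,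
          Nat.cast_sub (Finset.card_pos.2 ⟨τ, hτR⟩), Nat.cast_one]
  have b2 : ∑ σ ∈ freeFaces S with ¬ σ ⊂ s₁, wallBound τ s₁ s₂ (deleteFace S σ) ≤
      {σ ∈ freeFaces S | ¬ σ ⊂ s₁}.card * (3 / 4) := by
    rw [← nsmul_eq_mul]
    refine Finset.sum_le_card_nsmul _ _ _ fun σ hσ => wallBound_le (Or.inl ?_)
    rw [Finset.mem_filter] at hσ
    obtain ⟨s, hs, hσs, hsc, hu, hdel⟩ := exists_coface_of_free hσ.1
    rw [hdel]
    refine ⟨h1, ?_, ?_⟩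
    · rintro rfl
      have := (mem_freeFaces.1 hσ.1).2.1
      have := hw.card₁
      omega
    · rintro rfl
      exact hσ.2 hσs
  have hsplit := Finset.card_filter_add_card_filter_not (s := freeFaces S) (· ⊂ s₁)
  have hsplit' : (({σ ∈ freeFaces S | σ ⊂ s₁}.card : ℝ) + {σ ∈ freeFaces S | ¬ σ ⊂ s₁}.card) =
      (freeFaces S).card := by exact_mod_cast hsplit
  have hR' : ({σ ∈ freeFaces S | σ ⊂ s₁}.card : ℝ) ≤ 4 := by exact_mod_cast hR
  linarith

/-- A collapse removes only one tetrahedron. -/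
lemma IsWall.mem_or_mem_of_free (hw : IsWall M τ s₁ s₂) {S : Finset (Finset V)}
    (hsup : S.sup Finset.card = 4) {σ : Finset V}
    (hσ : σ ∈ freeFaces S) (h1 : s₁ ∈ S) (h2 : s₂ ∈ S) :
    s₁ ∈ deleteFace S σ ∨ s₂ ∈ deleteFace S σ := by
  obtain ⟨s, hs, hσs, hsc, hu, hdel⟩ := exists_coface_of_free hσ
  have hc := (mem_freeFaces.1 hσ).2.1
  by_cases h : s₁ = s
  · refine Or.inr ((hdel _).2 ⟨h2, ?_, fun h' => hw.ne (h.trans h'.symm)⟩)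
    rintro rfl
    have := hw.card₂
    omega
  · refine Or.inl ((hdel _).2 ⟨h1, ?_, h⟩)
    rintro rfl
    have := hw.card₁
    omega

lemma IsWall.mem_or_mem_of_top (hw : IsWall M τ s₁ s₂) {S : Finset (Finset V)} {σ : Finset V}
    (hσ : σ ∈ topFaces S) (h1 : s₁ ∈ S) (h2 : s₂ ∈ S) :
    s₁ ∈ deleteFace S σ ∨ s₂ ∈ deleteFace S σ := by
  by_cases h : s₁ = σ
  · exact Or.inr ((mem_deleteFace_of_top hσ _).2 ⟨h2, fun h' => hw.ne (h.trans h'.symm)⟩)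
  · exact Or.inl ((mem_deleteFace_of_top hσ _).2 ⟨h1, h⟩)

lemma IsWall.sum_wallBound_le (hw : IsWall M τ s₁ s₂) {S : Finset (Finset V)}
    (hS : IsState M S) (hsup : S.sup Finset.card = 4) :
    ∑ σ ∈ freeFaces S, wallBound τ s₁ s₂ (deleteFace S σ) ≤
      (freeFaces S).card * wallBound τ s₁ s₂ S := by
  by_cases hτ : τ ∈ S
  · by_cases h1 : s₁ ∈ S <;> by_cases h2 : s₂ ∈ S
    · have e : wallBound τ s₁ s₂ S = 3 / 4 := by
        unfold wallBound
        rw [if_pos hτ, if_pos (Or.inl h1)]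
      rw [e, ← nsmul_eq_mul]
      exact Finset.sum_le_card_nsmul _ _ _ fun σ hσ =>
        wallBound_le (hw.mem_or_mem_of_free hsup hσ h1 h2)
    · exact hw.sum_wallBound_le_of_one hS hsup hτ h1 h2
    · simp only [wallBound_comm (s₁ := s₁)]
      exact hw.symm.sum_wallBound_le_of_one hS hsup hτ h2 h1
    · have e : wallBound τ s₁ s₂ S = 1 := by
        unfold wallBound
        rw [if_pos hτ, if_neg (by tauto)]
      rw [e, ← nsmul_eq_mul]
      exact Finset.sum_le_card_nsmul _ _ _ fun σ hσ => wallBound_le_one _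
  · refine le_of_eq_of_le (Finset.sum_eq_zero fun σ _ => ?_)
      (mul_nonneg (Nat.cast_nonneg _) (wallBound_nonneg _))
    unfold wallBound
    rw [if_neg fun h => hτ (deleteFace_subset _ _ h)]

/-- A uniformly random run destroys the wall with probability at least one quarter. -/
lemma IsWall.uniform_le (hN : M.DimLE3) (hw : IsWall M τ s₁ s₂) (hτ : τ ∈ M.faces) :
    (morseRun uniformSelector HaltDim M.faceFinset.card (M.faceFinset, 0)).toOuterMeasure
      {s | τ ∈ s.1} ≤ ENNReal.ofReal (3 / 4) := by
  rw [PMF.toOuterMeasure_eq_expect]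
  have h0 : wallBound τ s₁ s₂ M.faceFinset = 3 / 4 := by
    unfold wallBound
    rw [if_pos (FinComplex.mem_faceFinset.2 hτ), if_pos (Or.inl (FinComplex.mem_faceFinset.2 hw.mem₁))]
  rw [← h0]
  refine le_trans (PMF.expect_mono_support _ fun s hs => ?_)
    (expect_morseRun_le (Inv := fun s => IsState M s.1)
      (Φ := fun s => ENNReal.ofReal (wallBound τ s₁ s₂ s.1))
      (fun s hs _ s' hs' => hs.step proper_uniformSelector hs') ?_ M.faceFinset.card
      (M.faceFinset, 0) (isState_faceFinset M))
  · by_cases hm : τ ∈ s.1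
    · have hh : HaltDim s.1 := halt_of_mem_support_morseRun (halt := HaltDim)
        proper_uniformSelector (by simp [HaltDim]) M.faceFinset.card (M.faceFinset, 0) le_rfl s hs
      have : wallBound τ s₁ s₂ s.1 = 1 := by
        unfold wallBound
        rw [if_pos hm, if_neg]
        rintro (h | h)
        · have := hh _ h
          have := hw.card₁
          omega
        · have := hh _ h
          have := hw.card₂
          omega
      rw [this]
      simp [hm]
    · simp [hm]
  · intro s hs hh
    have hsup := sup_eq_four hN hs hh
    unfold morseStep
    split_ifs with h1 h2
    · rw [PMF.expect_map, uniformSelector, PMF.expect_uniformOfFinset,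
        ← ENNReal.ofReal_sum_of_nonneg fun _ _ => wallBound_nonneg _]
      have hc : (0 : ℝ) < (freeFaces s.1).card := Nat.cast_pos.2 (Finset.card_pos.2 h1)
      rw [← ENNReal.ofReal_natCast, ← ENNReal.ofReal_inv_of_pos hc, ← ENNReal.ofReal_mul
        (inv_nonneg.2 hc.le)]
      refine ENNReal.ofReal_le_ofReal ?_
      rw [inv_mul_le_iff₀ hc]
      exact hw.sum_wallBound_le hs hsup
    · rw [PMF.expect_map]
      refine (PMF.expect_mono_support _
        (g := fun _ => ENNReal.ofReal (wallBound τ s₁ s₂ s.1))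
        fun σ hσ => ?_).trans (PMF.expect_const _ _).le
      refine ENNReal.ofReal_le_ofReal ?_
      have hσ' := proper_uniformSelector _ _ _ hσ
      by_cases hτS : τ ∈ s.1
      · by_cases m1 : s₁ ∈ s.1 <;> by_cases m2 : s₂ ∈ s.1
        · have e : wallBound τ s₁ s₂ s.1 = 3 / 4 := by
            unfold wallBound
            rw [if_pos hτS, if_pos (Or.inl m1)]
          rw [e]
          exact wallBound_le (hw.mem_or_mem_of_top hσ' m1 m2)
        · exact absurd ⟨τ, hw.free hs hsup m1 m2⟩ h1
        · exact absurd ⟨τ, hw.symm.free hs hsup m2 m1⟩ h1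
        · have e : wallBound τ s₁ s₂ s.1 = 1 := by
            unfold wallBound
            rw [if_pos hτS, if_neg (by tauto)]
          rw [e]
          exact wallBound_le_one _
      · unfold wallBound
        rw [if_neg hτS, if_neg fun h => hτS (deleteFace_subset _ _ h)]
    · rw [PMF.expect_pure]

/-- The selector prefers the wall to the other faces of its cofaces. -/
def PrefersWall (sel : Selector V) (M : FinComplex V) (τ s₁ s₂ : Finset V) : Prop :=
  ∀ S, IsState M S → ∀ h : (freeFaces S).Nonempty, τ ∈ freeFaces S →
    ∀ σ ∈ (sel (freeFaces S) h).support, σ.card = 3 → (σ ⊂ s₁ ∨ σ ⊂ s₂) → σ = τ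

lemma PrefersWall.symm (h : PrefersWall sel M τ s₁ s₂) : PrefersWall sel M τ s₂ s₁ :=
  fun S hS hne hτ σ hσ hc hs => h S hS hne hτ σ hσ hc hs.symm

lemma IsWall.mem_of_prefers (hsel : sel.Proper) (hw : IsWall M τ s₁ s₂)
    (hp : PrefersWall sel M τ s₁ s₂) {S : Finset (Finset V)} (hS : IsState M S)
    (hsup : S.sup Finset.card = 4) (hne : (freeFaces S).Nonempty) {σ : Finset V}
    (hσ : σ ∈ (sel (freeFaces S) hne).support) (hτ : τ ∈ deleteFace S σ) (h1 : s₁ ∈ S)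
    (h2 : s₂ ∉ S) : s₁ ∈ deleteFace S σ := by
  have hσf := hsel _ _ _ hσ
  have hc := (mem_freeFaces.1 hσf).2.1
  obtain ⟨s, hs, hσs, hsc, hu, hdel⟩ := exists_coface_of_free hσf
  refine (hdel _).2 ⟨h1, ?_, ?_⟩
  · rintro rfl
    have := hw.card₁
    omega
  · rintro rfl
    have := hp S hS hne (hw.free hS hsup h1 h2) σ hσ (by omega) (Or.inl hσs)
    subst this
    exact ((hdel _).1 hτ).2.1 rfl

/-- A run that prefers the wall destroys it. -/
lemma IsWall.notMem_of_prefers (hN : M.DimLE3) (hsel : sel.Proper) (hw : IsWall M τ s₁ s₂)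
    (hp : PrefersWall sel M τ s₁ s₂) {s : MorseState V}
    (hs : s ∈ (morseRun sel HaltDim M.faceFinset.card (M.faceFinset, 0)).support) : τ ∉ s.1 := by
  intro hτ
  have hh : HaltDim s.1 := halt_of_mem_support_morseRun (halt := HaltDim) hsel
    (by simp [HaltDim]) M.faceFinset.card (M.faceFinset, 0) le_rfl s hs
  have hinv := morseRun_invariant (halt := HaltDim) (sel := sel)
    (Inv := fun s => IsState M s.1 ∧ (τ ∈ s.1 → s₁ ∈ s.1 ∨ s₂ ∈ s.1)) ?_ M.faceFinset.card
    (M.faceFinset, 0) ⟨isState_faceFinset M, fun _ => Or.inl (FinComplex.mem_faceFinset.2 hw.mem₁)⟩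
    s hs
  · rcases hinv.2 hτ with h | h
    · have := hh _ h
      have := hw.card₁
      omega
    · have := hh _ h
      have := hw.card₂
      omega
  · rintro r ⟨hr, hr'⟩ hrh r' hstep
    refine ⟨hr.step hsel hstep, fun hτ' => ?_⟩
    have hsup := sup_eq_four hN hr hrh
    unfold morseStep at hstep
    split_ifs at hstep with h1 h2
    · obtain ⟨σ, hσ, rfl⟩ := (PMF.mem_support_map_iff _ _ _).1 hstep
      have hσf := hsel _ _ _ hσ
      have hτr := deleteFace_subset _ _ hτ'
      by_cases m1 : s₁ ∈ r.1 <;> by_cases m2 : s₂ ∈ r.1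
      · exact hw.mem_or_mem_of_free hsup hσf m1 m2
      · exact Or.inl (hw.mem_of_prefers hsel hp hr hsup h1 hσ hτ' m1 m2)
      · exact Or.inr (hw.symm.mem_of_prefers hsel hp.symm hr hsup h1 hσ hτ' m2 m1)
      · exact absurd (hr' hτr) (by tauto)
    · obtain ⟨σ, hσ, rfl⟩ := (PMF.mem_support_map_iff _ _ _).1 hstep
      have hσf := hsel _ _ _ hσ
      have hτr := deleteFace_subset _ _ hτ'
      by_cases m1 : s₁ ∈ r.1 <;> by_cases m2 : s₂ ∈ r.1
      · exact hw.mem_or_mem_of_top hσf m1 m2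
      · exact absurd ⟨τ, hw.free hr hsup m1 m2⟩ h1
      · exact absurd ⟨τ, hw.symm.free hr hsup m2 m1⟩ h1
      · exact absurd (hr' hτr) (by tauto)
    · simp only [PMF.support_pure, Set.mem_singleton_iff] at hstep
      subst hstep
      exact hr' hτ'

end Find

/-! ### Random relabelings -/

section Perm

/-- Values of a function can be realized as ranks. -/
lemma exists_equiv_fin_of_lt {α : Type*} [Fintype α] (g : α → ℕ) :
    ∃ κ : α ≃ Fin (Fintype.card α), ∀ x y, g x < g y → κ x < κ y := by
  set e := Fintype.equivFin α
  have hmono := Tuple.monotone_sort (g ∘ e.symm)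
  refine ⟨e.trans (Tuple.sort (g ∘ e.symm)).symm, fun x y hxy => ?_⟩
  by_contra hle
  have := hmono (not_lt.1 hle)
  simp at this
  omega

lemma exists_perm_labelsAbove {α : Type*} [Fintype α] {lab : α → ℕ} (hlab : Function.Injective lab)
    (Q : Set α) : ∃ π : Equiv.Perm α, ∀ x y, x ∉ Q → y ∈ Q → lab (π x) < lab (π y) := by
  classical
  obtain ⟨κ, hκ⟩ := exists_equiv_fin_of_lt (fun x : α => if x ∈ Q then 1 else 0)
  obtain ⟨ρ, hρ⟩ := exists_equiv_fin_of_lt lab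
  refine ⟨κ.trans ρ.symm, fun x y hx hy => ?_⟩
  have h1 : κ x < κ y := hκ x y (by simp [hx, hy])
  by_contra hle
  rcases (not_lt.1 hle).lt_or_eq with h | h
  · have := hρ _ _ h
    simp at this
    exact absurd h1 (not_lt.2 this.le)
  · have := hlab h
    simp at this
    subst this
    exact hx hy

variable {ι α β : Type*} [Fintype α] [Fintype β] [DecidableEq α] [DecidableEq β]

open Classical in
/-- Events that depend on disjoint sets of labels, each of which can be achieved by permuting the
labels, behave as independent events of probability bounded below. -/
lemma sum_prod_perm_le {E : ι → (α ≃ β) → Prop} {P : ι → Set α} {J : Finset ι} {k : ℕ} {t : ℝ}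
    (ht0 : 0 ≤ t) (ht1 : t ≤ 1)
    (hdisj : ∀ i ∈ J, ∀ l ∈ J, ∀ x, x ∈ P i → x ∈ P l → i = l)
    (hdep : ∀ i ∈ J, ∀ e e' : α ≃ β, (∀ x ∈ P i, e x = e' x) → E i e → E i e')
    (hex : ∀ i ∈ J, ∀ e : α ≃ β, ∃ π : Equiv.Perm {x // x ∈ P i},
      E i ((Equiv.Perm.ofSubtype π).trans e))
    (hcard : ∀ i ∈ J, Fintype.card {x // x ∈ P i} ≤ k) :
    ∑ e : α ≃ β, ∏ i ∈ J, (if E i e then t else 1) ≤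
      (1 - (1 - t) * ((k.factorial : ℝ))⁻¹) ^ J.card * Fintype.card (α ≃ β) := by
  induction J using Finset.induction_on with
  | empty => simp
  | insert i J hi ih =>
    have hJ := ih (fun i hi l hl => hdisj i (Finset.mem_insert_of_mem hi) l
      (Finset.mem_insert_of_mem hl)) (fun i hi => hdep i (Finset.mem_insert_of_mem hi))
      (fun i hi => hex i (Finset.mem_insert_of_mem hi))
      (fun i hi => hcard i (Finset.mem_insert_of_mem hi))
    set H : (α ≃ β) → ℝ := fun e => ∏ l ∈ J, (if E l e then t else 1) with hH
    set f : (α ≃ β) → ℝ := fun e => if E i e then t else 1 with hf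
    set c : ℝ := 1 - (1 - t) * ((k.factorial : ℝ))⁻¹ with hc
    have hii := Finset.mem_insert_self i J
    have hk0 : (0 : ℝ) < k.factorial := Nat.cast_pos.2 k.factorial_pos
    have hH0 : ∀ e, 0 ≤ H e := fun e => Finset.prod_nonneg fun l _ => by
      split_ifs
      exacts [ht0, zero_le_one]
    have hf1 : ∀ e, f e ≤ 1 := fun e => by
      simp only [hf]
      split_ifs
      exacts [ht1, le_rfl]
    have hinv : ∀ (π : Equiv.Perm {x // x ∈ P i}) (e : α ≃ β),
        H ((Equiv.Perm.ofSubtype π).trans e) = H e := by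
      intro π e
      refine Finset.prod_congr rfl fun l hl => ?_
      have hl' := Finset.mem_insert_of_mem (b := i) hl
      have hfix : ∀ x ∈ P l, ((Equiv.Perm.ofSubtype π).trans e) x = e x := by
        intro x hx
        have hxi : x ∉ P i := by
          intro hxi
          exact hi (hdisj i hii l hl' x hxi hx ▸ hl)
        rw [Equiv.trans_apply, Equiv.Perm.ofSubtype_apply_of_not_mem π hxi]
      have : E l ((Equiv.Perm.ofSubtype π).trans e) ↔ E l e :=
        ⟨hdep l hl' _ _ hfix, hdep l hl' _ _ fun x hx => (hfix x hx).symm⟩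
      simp only [this]
    set G := Equiv.Perm {x // x ∈ P i}
    have hG : (Fintype.card G : ℝ) ≤ k.factorial := by
      have : Fintype.card G = (Fintype.card {x // x ∈ P i}).factorial := Fintype.card_perm
      rw [this]
      exact_mod_cast Nat.factorial_le (hcard i hii)
    have hG0 : (0 : ℝ) < Fintype.card G := Nat.cast_pos.2 Fintype.card_pos
    have hsum : ∀ e, ∑ π : G, f ((Equiv.Perm.ofSubtype π).trans e) ≤ Fintype.card G * c := by
      intro e
      obtain ⟨π₀, hπ₀⟩ := hex i hii e
      rw [← Finset.add_sum_erase _ _ (Finset.mem_univ π₀)]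
      have e1 : f ((Equiv.Perm.ofSubtype π₀).trans e) = t := if_pos hπ₀
      have e2 : ∑ π ∈ Finset.univ.erase π₀, f ((Equiv.Perm.ofSubtype π).trans e) ≤
          Fintype.card G - 1 := by
        calc _ ≤ ∑ π ∈ Finset.univ.erase π₀, (1 : ℝ) := Finset.sum_le_sum fun π _ => hf1 _
          _ = _ := by
            rw [Finset.sum_const, Finset.card_erase_of_mem (Finset.mem_univ _), nsmul_eq_mul,
              mul_one, Finset.card_univ, Nat.cast_sub Fintype.card_pos, Nat.cast_one]
      have e3 : Fintype.card G * ((1 - t) * ((k.factorial : ℝ))⁻¹) ≤ 1 - t := by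
        rw [mul_left_comm]
        refine mul_le_of_le_one_right (sub_nonneg.2 ht1) ?_
        rw [← div_eq_mul_inv]
        exact div_le_one_of_le₀ hG hk0.le
      rw [e1, hc, mul_sub, mul_one]
      linarith
    have key : (Fintype.card G : ℝ) * ∑ e, f e * H e ≤ Fintype.card G * (c * ∑ e, H e) := by
      calc (Fintype.card G : ℝ) * ∑ e, f e * H e
          = ∑ π : G, ∑ e, f ((Equiv.Perm.ofSubtype π).trans e) * H e := by
            rw [← nsmul_eq_mul, ← Finset.card_univ, ← Finset.sum_const]
            refine Finset.sum_congr rfl fun π _ => ?_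
            rw [← Equiv.sum_comp (Equiv.equivCongr (Equiv.Perm.ofSubtype π).symm (Equiv.refl β))]
            refine Finset.sum_congr rfl fun e _ => ?_
            have : Equiv.equivCongr (Equiv.Perm.ofSubtype π).symm (Equiv.refl β) e =
                (Equiv.Perm.ofSubtype π).trans e := by
              ext x
              simp [Equiv.equivCongr]
            rw [this, hinv]
        _ = ∑ e, H e * ∑ π : G, f ((Equiv.Perm.ofSubtype π).trans e) := by
            rw [Finset.sum_comm]
            refine Finset.sum_congr rfl fun e _ => ?_
            rw [Finset.mul_sum]
            exact Finset.sum_congr rfl fun π _ => mul_comm _ _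
        _ ≤ ∑ e, H e * (Fintype.card G * c) :=
            Finset.sum_le_sum fun e _ => mul_le_mul_of_nonneg_left (hsum e) (hH0 e)
        _ = _ := by rw [← Finset.sum_mul]; ring
    have key' := le_of_mul_le_mul_left key hG0
    have hc0 : 0 ≤ c := by
      have h1 : ((k.factorial : ℝ))⁻¹ ≤ 1 :=
        inv_le_one_of_one_le₀ (by exact_mod_cast k.factorial_pos)
      have := mul_le_of_le_one_right (sub_nonneg.2 ht1) h1
      simp only [hc]
      linarith
    calc ∑ e : α ≃ β, ∏ l ∈ insert i J, (if E l e then t else 1) = ∑ e, f e * H e :=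
          Finset.sum_congr rfl fun e _ => Finset.prod_insert hi
      _ ≤ c * ∑ e, H e := key'
      _ ≤ c * (c ^ J.card * Fintype.card (α ≃ β)) := mul_le_mul_of_nonneg_left hJ hc0
      _ = _ := by
        rw [Finset.card_insert_of_notMem hi, pow_succ]
        ring

end Perm

namespace FinComplex

variable {V : Type u} {N Dc : FinComplex V} {U : Set (Finset V)}

/-- A pure two-dimensional complex `Dc` in the interior of a cell, without free edges, that does not
separate the cell. -/
structure IsSpine (N : FinComplex V) (U : Set (Finset V)) (Dc : FinComplex V) : Prop where
  sub : Dc.faces ⊆ U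
  card_le : ∀ σ ∈ Dc.faces, σ.card ≤ 3
  pure : ∀ σ ∈ Dc.faces, ∃ t ∈ Dc.faces, σ ⊆ t ∧ t.card = 3
  edge : ∀ t ∈ Dc.faces, t.card = 3 → ∀ e ⊆ t, e.card = 2 →
    ∃ t' ∈ Dc.faces, t'.card = 3 ∧ t' ≠ t ∧ e ⊆ t'
  conn : ConnAvoid U (· ∈ Dc.faces)
  nonempty : ∃ t, t ∈ Dc.faces

lemma sd_faces_subset_sdUp (hN : U ⊆ N.faces) (h : Dc.faces ⊆ U) : Dc.sd.faces ⊆ N.sdUp U := by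
  intro C hC
  refine ⟨⟨hC.1, fun σ hσ => hN (h (hC.2.1 σ hσ)), hC.2.2⟩, ?_⟩
  obtain ⟨σ, hσ⟩ := hC.1
  exact ⟨σ, hσ, h (hC.2.1 σ hσ)⟩

lemma sd_card_le {n : ℕ} (h : ∀ σ ∈ Dc.faces, σ.card ≤ n) : ∀ C ∈ Dc.sd.faces, C.card ≤ n := by
  intro C hC
  have h := Finset.card_le_card_of_injOn (t := Finset.Icc 1 n) Finset.card
    (fun σ hσ => by
      have h1 := hC.2.1 σ hσ
      have h2 := Finset.card_pos.2 (nonempty_of_mem h1)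
      have h3 := h σ h1
      simp only [Finset.coe_Icc, Set.mem_Icc]
      omega) (sd_card_injOn hC)
  simpa using h

/-- A coarse form of maximality: a chain of `Dc` extends to a chain of three faces. -/
lemma IsSpine.sd_pure (hD : IsSpine N U Dc) : ∀ C ∈ Dc.sd.faces, ∃ C' ∈ Dc.sd.faces,
    C ⊆ C' ∧ C'.card = 3 := by
  classical
  -- a maximal chain above `C`
  intro C hC
  obtain ⟨C', hC', hmax⟩ := (Dc.sd.finite.subset (fun C' (h : C' ∈ {C' | C' ∈ Dc.sd.faces ∧ C ⊆ C'})
    => h.1)).exists_maximalFor Finset.card _ ⟨C, hC, subset_rfl⟩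
  refine ⟨C', hC'.1, hC'.2, ?_⟩
  have hmax' : ∀ w ∈ Dc.faces, (∀ r ∈ C', r ⊆ w ∨ w ⊆ r) → w ∈ C' := by
    intro w hw h
    by_contra hn
    have h1 := hmax (j := insert w C') ⟨insert_mem_sd hC'.1 hw h, hC'.2.trans (Finset.subset_insert _ _)⟩
      (Finset.card_le_card (Finset.subset_insert _ _))
    rw [Finset.card_insert_of_notMem hn] at h1
    omega
  have hle := sd_card_le hD.card_le C' hC'.1
  -- the largest element
  obtain ⟨m, hm, hmm⟩ := C'.exists_max_image Finset.card hC'.1.1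
  have hmtop : ∀ r ∈ C', r ⊆ m := fun r hr => sd_subset_of_card_le hC'.1 hr hm (hmm r hr)
  obtain ⟨t, ht, hmt, ht3⟩ := hD.pure m (hC'.1.2.1 m hm)
  have htC : t ∈ C' := hmax' t ht fun r hr => Or.inl ((hmtop r hr).trans hmt)
  have hrt : ∀ r ∈ C', r ⊆ t := fun r hr => (hmtop r hr).trans hmt
  -- an element of every cardinality
  have hex : ∀ k, 1 ≤ k → k ≤ 3 → ∃ r ∈ C', r.card = k := by
    intro k hk1 hk3
    by_contra hno
    push Not at hno
    -- neighbours
    obtain ⟨q, hq, hqmin⟩ := ({r ∈ C' | k < r.card}).exists_min_image Finset.card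
      ⟨t, Finset.mem_filter.2 ⟨htC, by have := hno t htC; omega⟩⟩
    rw [Finset.mem_filter] at hq
    obtain ⟨p, hpq, hpk, hp⟩ : ∃ p : Finset V, p ⊆ q ∧ p.card ≤ k ∧
        ∀ r ∈ C', r ⊆ p ∨ q ⊆ r := by
      by_cases hlow : ({r ∈ C' | r.card < k}).Nonempty
      · obtain ⟨p, hp, hpmax⟩ := ({r ∈ C' | r.card < k}).exists_max_image Finset.card hlow
        rw [Finset.mem_filter] at hp
        refine ⟨p, sd_subset_of_card_le hC'.1 hp.1 hq.1 (by omega), hp.2.le, fun r hr => ?_⟩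
        rcases lt_or_gt_of_ne (hno r hr) with h | h
        · exact Or.inl (sd_subset_of_card_le hC'.1 hr hp.1 (hpmax r (Finset.mem_filter.2 ⟨hr, h⟩)))
        · exact Or.inr (sd_subset_of_card_le hC'.1 hq.1 hr (hqmin r (Finset.mem_filter.2 ⟨hr, h⟩)))
      · refine ⟨∅, Finset.empty_subset _, by simp, fun r hr => Or.inr ?_⟩
        rw [Finset.not_nonempty_iff_eq_empty] at hlow
        have h : k < r.card := by
          rcases lt_or_gt_of_ne (hno r hr) with h | h
          · have : r ∈ ({r ∈ C' | r.card < k}) := Finset.mem_filter.2 ⟨hr, h⟩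
            simp [hlow] at this
          · exact h
        exact sd_subset_of_card_le hC'.1 hq.1 hr (hqmin r (Finset.mem_filter.2 ⟨hr, h⟩))
    obtain ⟨w, hpw, hwq, hwk⟩ := Finset.exists_subsuperset_card_eq hpq hpk hq.2.le
    have hw : w ∈ C' := hmax' w (mem_of_subset (hC'.1.2.1 q hq.1) hwq
      (Finset.card_pos.1 (by omega))) fun r hr => by
        rcases hp r hr with h | h
        exacts [Or.inl (h.trans hpw), Or.inr (hwq.trans h)]
    exact hno w hw hwk
  have h3 : (Finset.Icc 1 3).card ≤ C'.card := by
    have : Finset.Icc 1 3 ⊆ C'.image Finset.card := by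
      intro k hk
      rw [Finset.mem_Icc] at hk
      obtain ⟨r, hr, hrk⟩ := hex k hk.1 hk.2
      exact Finset.mem_image.2 ⟨r, hr, hrk⟩
    exact (Finset.card_le_card this).trans Finset.card_image_le
  simp at h3
  omega

lemma IsSpine.dimLE3 (hD : IsSpine N U Dc) : Dc.DimLE3 := fun σ hσ =>
  (hD.card_le σ hσ).trans (by norm_num)

lemma IsSpine.sd_edge (hD : IsSpine N U Dc) : ∀ C ∈ Dc.sd.faces, C.card = 3 → ∀ e ⊆ C,
    e.card = 2 → ∃ C' ∈ Dc.sd.faces, C'.card = 3 ∧ C' ≠ C ∧ e ⊆ C' := by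
  classical
  intro C hC h3 e he h2
  obtain ⟨x, hx, y, hy, z, hz, hxy, hyz, c1, c2, c3, -, hall⟩ :=
    exists_triple_of_card_three hD.dimLE3 hC h3
  have hz3 := hD.card_le z (hC.2.1 z hz)
  -- the missing element
  obtain ⟨m, hm, hme⟩ : ∃ m ∈ C, e = C.erase m := by
    have : (C \ e).card = 1 := by rw [Finset.card_sdiff_of_subset he]; omega
    obtain ⟨m, hm⟩ := Finset.card_eq_one.1 this
    have hm' : m ∈ C \ e := by simp [hm]
    rw [Finset.mem_sdiff] at hm'
    refine ⟨m, hm'.1, ?_⟩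
    rw [Finset.erase_eq, ← hm, Finset.sdiff_sdiff_eq_self he]
  -- it suffices to find a replacement
  suffices h : ∃ w ∈ Dc.faces, w ≠ m ∧ w.card = m.card ∧ ∀ r ∈ C, r ≠ m → r ⊆ w ∨ w ⊆ r by
    obtain ⟨w, hw, hwm, hwc, hcmp⟩ := h
    have hwC : w ∉ C := fun h => hwm (sd_card_injOn hC h hm hwc)
    have hene : e.Nonempty := Finset.card_pos.1 (by omega)
    have heC : e ∈ Dc.sd.faces := mem_of_subset hC he hene
    refine ⟨insert w e, insert_mem_sd heC hw ?_, ?_, ?_, Finset.subset_insert _ _⟩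
    · intro r hr
      rw [hme, Finset.mem_erase] at hr
      exact hcmp r hr.2 hr.1
    · rw [Finset.card_insert_of_notMem (fun h => hwC (he h)), h2]
    · intro h
      exact hwC (h ▸ Finset.mem_insert_self _ _)
  have hx1 : x.card = 1 := by omega
  have hy2 : y.card = 2 := by omega
  have hz3' : z.card = 3 := by omega
  rcases hall m hm with rfl | rfl | rfl
  · obtain ⟨w, hw⟩ := Finset.card_eq_one.1 (show (y \ m).card = 1 by
      rw [Finset.card_sdiff_of_subset hxy.1]; omega)
    have hw' : w ∈ y \ m := by simp [hw]
    rw [Finset.mem_sdiff] at hw'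
    have hwy : ({w} : Finset V) ⊆ y := by simpa using hw'.1
    refine ⟨{w}, mem_of_subset (hC.2.1 y hy) hwy (by simp), ?_, by simp [hx1], ?_⟩
    · rintro rfl
      simp at hw'
    · intro r hr hrm
      rcases hall r hr with rfl | rfl | rfl
      · exact absurd rfl hrm
      · exact Or.inr hwy
      · exact Or.inr (hwy.trans hyz.1)
  · obtain ⟨w, hw⟩ := Finset.card_eq_one.1 (show (z \ m).card = 1 by
      rw [Finset.card_sdiff_of_subset hyz.1]; omega)
    have hw' : w ∈ z \ m := by simp [hw]
    rw [Finset.mem_sdiff] at hw'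
    have hwx : w ∉ x := fun h => hw'.2 (hxy.1 h)
    have hsub : insert w x ⊆ z := Finset.insert_subset hw'.1 (hxy.1.trans hyz.1)
    refine ⟨insert w x, mem_of_subset (hC.2.1 z hz) hsub (Finset.insert_nonempty _ _), ?_, ?_, ?_⟩
    · rintro rfl
      simp at hw'
    · rw [Finset.card_insert_of_notMem hwx]; omega
    · intro r hr hrm
      rcases hall r hr with rfl | rfl | rfl
      · exact Or.inl (Finset.subset_insert _ _)
      · exact absurd rfl hrm
      · exact Or.inr hsub
  · obtain ⟨t', ht', ht3, hne, hyt⟩ := hD.edge m (hC.2.1 m hm) hz3' y hyz.1 hy2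
    refine ⟨t', ht', hne, by omega, ?_⟩
    intro r hr hrm
    rcases hall r hr with rfl | rfl | rfl
    · exact Or.inl (hxy.1.trans hyt)
    · exact Or.inl hyt
    · exact absurd rfl hrm

lemma exists_eq_flag_of_mem_sdUp (hN : N.DimLE3) (hU : N.IsCell U) {C : Finset (Finset V)}
    (hC : C ∈ N.sdUp U) (h4 : C.card = 4) : ∃ x y z T, T ∈ U ∧ T.card = 4 ∧ x ∈ T ∧ y ∈ T ∧ z ∈ T ∧
      x ≠ y ∧ x ≠ z ∧ y ≠ z ∧ C = flag x y z T := by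
  obtain ⟨T, hT, hT4, x, hx, y, hy, z, hz, hxy, hxz, hyz, h⟩ := exists_eq_flag hN hC.1 h4
  obtain ⟨u, hu, huU⟩ := hC.2
  refine ⟨x, y, z, T, hU.up u huU T (hC.1.2.1 T hT) (sd_subset_of_card_le hC.1 hu hT ?_), hT4, hx, hy,
    hz, hxy, hxz, hyz, h⟩
  have := hN u (hC.1.2.1 u hu)
  omega

lemma IsSpine.sd_conn (hN : N.DimLE3) (hU : N.IsCell U) (hD : IsSpine N U Dc) :
    ConnAvoid (N.sdUp U) (· ∈ Dc.sd.faces) := by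
  classical
  intro B hB
  -- chains through the same tetrahedron
  have same : ∀ s ∈ U, s.card = 4 → ∀ C ∈ N.sd.faces, ∀ C' ∈ N.sd.faces, C.card = 4 → C'.card = 4 →
      s ∈ C → s ∈ C' → C ∈ B → C' ∈ B := by
    intro s hs hs4 C hC C' hC' h4 h4' hsC hsC' hCB
    have h := ConnAvoid.sd (D := ∅) hN (isCell_singleton hN (hU.sub hs) hs4) (by simp) (by simp)
      (connAvoid_singleton s _) B
    refine h ?_ C ⟨hC, s, hsC, rfl⟩ C' ⟨hC', s, hsC', rfl⟩ h4 h4' hCB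
    rintro σ ⟨hσ, _, hsσ, rfl⟩ h3 - E hE E' hE' hE4 hE4' hσE hσE' hEB
    refine hB σ ⟨hσ, _, hsσ, hs⟩ h3 ?_ E ⟨hE.1, _, hσE.1 hsσ, hs⟩ E' ⟨hE'.1, _, hσE'.1 hsσ, hs⟩
      hE4 hE4' hσE hσE' hEB
    intro h
    have := hD.card_le _ (h.2.1 _ hsσ)
    omega
  have top : ∀ C ∈ N.sdUp U, C.card = 4 → ∃ s ∈ C, s ∈ U ∧ s.card = 4 := by
    intro C hC h4
    obtain ⟨x, y, z, T, hT, hT4, hx, hy, hz, hxy, hxz, hyz, rfl⟩ := exists_eq_flag_of_mem_sdUp hN hU hC h4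
    exact ⟨T, mem_flag.2 (by simp), hT, hT4⟩
  intro C hC C' hC' h4 h4' hCB
  obtain ⟨s, hsC, hsU, hs4⟩ := top C hC h4
  obtain ⟨s', hsC', hsU', hs4'⟩ := top C' hC' h4'
  have key := hD.conn {s | ∃ E ∈ N.sd.faces, E.card = 4 ∧ s ∈ E ∧ E ∈ B} ?_ s hsU s' hsU' hs4 hs4'
    ⟨C, hC.1, h4, hsC, hCB⟩
  · obtain ⟨E, hE, hE4, hsE, hEB⟩ := key
    exact same s' hsU' hs4' E hE C' hC'.1 hE4 h4' hsE hsC' hEB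
  · rintro σ hσU h3 hσD r hr r' hr' hr4 hr4' hσr hσr' ⟨E, hE, hE4, hrE, hEB⟩
    obtain ⟨x, y, z, hxy, hxz, hyz, rfl⟩ := Finset.card_eq_three.1 h3
    have mem : ∀ T : Finset V, {x, y, z} ⊂ T → x ∈ T ∧ y ∈ T ∧ z ∈ T := fun T h =>
      ⟨h.1 (by simp), h.1 (by simp), h.1 (by simp)⟩
    obtain ⟨a1, a2, a3⟩ := mem r hσr
    obtain ⟨b1, b2, b3⟩ := mem r' hσr'
    have f1 := flag_mem_sd (N := N) (hU.sub hr) a1 a2 a3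
    have f2 := flag_mem_sd (N := N) (hU.sub hr') b1 b2 b3
    have c1 := card_flag hr4 hxy hxz hyz
    have c2 := card_flag hr4' hxy hxz hyz
    refine ⟨_, f2, c2, mem_flag.2 (by simp), ?_⟩
    have hB1 := same r hr hr4 E hE _ f1 hE4 c1 hrE (mem_flag.2 (by simp)) hEB
    set F : Finset (Finset V) := {{x}, {x, y}, {x, y, z}} with hF
    have hF3 : F.card = 3 := by
      have e1 := Finset.card_singleton x
      have e2 := Finset.card_pair hxy
      refine Finset.card_eq_three.2 ⟨_, _, _, ?_, ?_, ?_, rfl⟩ <;> intro h <;>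
        [rw [h] at e1; rw [h] at e1; rw [h] at e2] <;> omega
    have s1 : F ⊆ flag x y z r := by
      intro w; simp only [hF, mem_flag, Finset.mem_insert, Finset.mem_singleton]; tauto
    have s2 : F ⊆ flag x y z r' := by
      intro w; simp only [hF, mem_flag, Finset.mem_insert, Finset.mem_singleton]; tauto
    have hFU : F ∈ N.sdUp U := ⟨mem_of_subset f1 s1 (Finset.card_pos.1 (by omega)),
      {x, y, z}, by simp [hF], hσU⟩
    refine hB F hFU hF3 (fun h => hσD (h.2.1 _ (by simp [hF]))) _ (sdUp_up hFU f1 s1) _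
      (sdUp_up hFU f2 s2) c1 c2 (s1.ssubset_of_ne ?_) (s2.ssubset_of_ne ?_) hB1 <;>
      · intro h
        rw [h] at hF3
        omega

lemma IsSpine.sd (hN : N.DimLE3) (hU : N.IsCell U) (hD : IsSpine N U Dc) :
    IsSpine N.sd (N.sdUp U) Dc.sd where
  sub := sd_faces_subset_sdUp hU.sub hD.sub
  card_le := sd_card_le hD.card_le
  pure := hD.sd_pure
  edge := hD.sd_edge
  conn := hD.sd_conn hN hU
  nonempty := by
    obtain ⟨t, ht⟩ := hD.nonempty
    exact ⟨{t}, by simp, by simpa using ht, by simp⟩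

/-- A tetrahedron of the subdivision contains at most one triangle of the subdivided spine. -/
lemma IsSpine.sd_unique (hN : N.DimLE3) (hU : N.IsCell U) (hD : IsSpine N U Dc) :
    ∀ s ∈ N.sdUp U, s.card = 4 → ∀ t ∈ Dc.sd.faces, t.card = 3 → ∀ t' ∈ Dc.sd.faces, t'.card = 3 →
      t ⊆ s → t' ⊆ s → t = t' := by
  classical
  intro s hs h4 t ht h3 t' ht' h3' hts hts'
  obtain ⟨x, y, z, T, hT, hT4, hx, hy, hz, hxy, hxz, hyz, rfl⟩ := exists_eq_flag_of_mem_sdUp hN hU hs h4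
  have hTt : ∀ t ∈ Dc.sd.faces, T ∉ t := fun t ht h => by
    have := hD.card_le T (ht.2.1 T h)
    omega
  have key : ∀ t ∈ Dc.sd.faces, t.card = 3 → t ⊆ flag x y z T → t = (flag x y z T).erase T := by
    intro t ht h3 h
    refine Finset.eq_of_subset_of_card_le (fun r hr => Finset.mem_erase.2
      ⟨by rintro rfl; exact hTt t ht hr, h hr⟩) ?_
    rw [Finset.card_erase_of_mem (mem_flag.2 (by simp))]
    omega
  rw [key t ht h3 hts, key t' ht' h3' hts']

open Classical in
/-- The tetrahedra of a cell. -/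
def cellTets (N : FinComplex V) (U : Set (Finset V)) : Finset (Finset V) :=
  {s ∈ N.faceFinset | s ∈ U ∧ s.card = 4}

open Classical in
/-- The triangles of a complex. -/
def triangles (N : FinComplex V) : Finset (Finset V) := {s ∈ N.faceFinset | s.card = 3}

lemma mem_cellTets (hU : U ⊆ N.faces) {s : Finset V} : s ∈ N.cellTets U ↔ s ∈ U ∧ s.card = 4 := by
  simp only [cellTets, Finset.mem_filter, mem_faceFinset]
  exact ⟨fun h => h.2, fun h => ⟨hU h.1, h⟩⟩

lemma mem_triangles {s : Finset V} : s ∈ N.triangles ↔ s ∈ N.faces ∧ s.card = 3 := by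
  simp [triangles, mem_faceFinset]

lemma card_cellTets_sdUp_le (hN : N.DimLE3) (hU : N.IsCell U) :
    (N.sd.cellTets (N.sdUp U)).card ≤ 2 ^ 16 * (N.cellTets U).card := by
  classical
  have hsub : N.sd.cellTets (N.sdUp U) ⊆ (N.cellTets U).biUnion fun s => s.powerset.powerset := by
    intro C hC
    rw [mem_cellTets (hU.sd hN).sub] at hC
    obtain ⟨x, y, z, T, hT, hT4, hx, hy, hz, hxy, hxz, hyz, rfl⟩ := exists_eq_flag_of_mem_sdUp hN hU hC.1 hC.2
    simp only [Finset.mem_biUnion, Finset.mem_powerset]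
    refine ⟨T, (mem_cellTets hU.sub).2 ⟨hT, hT4⟩, fun r hr => ?_⟩
    rw [Finset.mem_powerset]
    intro w hw
    rcases mem_flag.1 hr with rfl | rfl | rfl | rfl <;>
      try simp only [Finset.mem_insert, Finset.mem_singleton] at hw
    · exact hw ▸ hx
    · rcases hw with rfl | rfl <;> assumption
    · rcases hw with rfl | rfl | rfl <;> assumption
    · exact hw
  refine (Finset.card_le_card hsub).trans (Finset.card_biUnion_le.trans
    ((Finset.sum_le_card_nsmul _ _ (2 ^ 16) fun s hs => ?_).trans (by rw [smul_eq_mul, mul_comm])))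
  rw [mem_cellTets hU.sub] at hs
  rw [Finset.card_powerset, Finset.card_powerset, hs.2]
  norm_num

/-- The gadget made from a spine that has at most one triangle in each tetrahedron. -/
lemma IsSpine.isGadget (hN : N.DimLE3) (hU : N.IsCell U) (hD : IsSpine N U Dc)
    (huniq : ∀ s ∈ U, s.card = 4 → ∀ t ∈ Dc.faces, t.card = 3 → ∀ t' ∈ Dc.faces, t'.card = 3 →
      t ⊆ s → t' ⊆ s → t = t') :
    IsGadget N.sd (N.sd.cellTets (N.sdUp U)) Dc.sd.triangles
      {t | t ∈ Dc.faces ∧ t.card = 3} Dc.faces where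
  tet := fun s hs => by
    rw [mem_cellTets (hU.sd hN).sub] at hs
    exact ⟨(hU.sd hN).sub hs.1, hs.2⟩
  tri := fun t ht => by
    rw [mem_triangles] at ht
    exact ⟨(hU.sd hN).sub ((hD.sd hN hU).sub ht.1), ht.2⟩
  nonempty := by
    obtain ⟨t, ht⟩ := (hD.sd hN hU).nonempty
    obtain ⟨t', ht', -, h3⟩ := (hD.sd hN hU).pure t ht
    exact ⟨t', mem_triangles.2 ⟨ht', h3⟩⟩
  coface := fun t ht => by
    rw [mem_triangles] at ht
    obtain ⟨s₁, h1, s₂, h2, hne, hs1, hs2, hall⟩ :=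
      (hU.sd hN).two t ((hD.sd hN hU).sub ht.1) ht.2
    have h4 : ∀ s ∈ N.sdUp U, t ⊂ s → s.card = 4 := fun s hs hts => by
      have := hN.sd s hs.1
      have := Finset.card_lt_card hts
      omega
    exact ⟨s₁, (mem_cellTets (hU.sd hN).sub).2 ⟨h1, h4 _ h1 hs1⟩, s₂,
      (mem_cellTets (hU.sd hN).sub).2 ⟨h2, h4 _ h2 hs2⟩, hne, hs1, hs2, hall⟩
  edge := fun t ht e het he => by
    rw [mem_triangles] at ht
    obtain ⟨t', ht', h3, hne, hs⟩ := (hD.sd hN hU).edge t ht.1 ht.2 e het he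
    exact ⟨t', mem_triangles.2 ⟨ht', h3⟩, hne, hs⟩
  meets := fun t ht => by
    rw [mem_triangles] at ht
    obtain ⟨x, hx, y, hy, z, hz, -, -, h1, h2, h3, -, -⟩ :=
      exists_triple_of_card_three hD.dimLE3 ht.1 ht.2
    have := hD.card_le z (ht.1.2.1 z hz)
    exact ⟨z, hz, ht.1.2.1 z hz, by omega⟩
  within := fun t ht x hx => (mem_triangles.1 ht).1.2.1 x hx
  cut := by
    intro B s hs hsB s' hs' hsB'
    rw [mem_cellTets (hU.sd hN).sub] at hs hs'
    have hconn := ConnAvoid.sd (D := {t | t ∈ Dc.faces ∧ t.card = 3}) hN hU (fun t ht => ht.2)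
      (fun s hs h4 t ht t' ht' => huniq s hs h4 t ht.1 ht.2 t' ht'.1 ht'.2) (by
        intro B hB
        refine hD.conn B fun σ hσ h3 hσD => hB σ hσ h3 fun h => hσD h.1)
    by_contra hno
    refine hsB' (hconn B ?_ s hs.1 s' hs'.1 hs.2 hs'.2 hsB)
    intro σ hσ h3 hbad r hr r' hr' hr4 hr4' hσr hσr' hrB
    by_contra hrB'
    refine hno ⟨σ, hσ.1, h3, fun x hx hxA => hbad ⟨x, hx, hxA⟩, ?_, r,
      (mem_cellTets (hU.sd hN).sub).2 ⟨hr, hr4⟩, r', (mem_cellTets (hU.sd hN).sub).2 ⟨hr', hr4'⟩,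
      hrB, hrB', hσr, hσr', ?_⟩
    · by_contra hall
      push Not at hall
      have hσD : σ ∈ Dc.sd.faces := ⟨hσ.1.1, hall, hσ.1.2.2⟩
      obtain ⟨x, hx, y, hy, z, hz, -, -, h1, h2, h3, -, -⟩ :=
        exists_triple_of_card_three hD.dimLE3 hσD h3
      have := hD.card_le z (hall z hz)
      exact hbad ⟨z, hz, hall z hz, by omega⟩
    · obtain ⟨s₁, h1, s₂, h2, hne, hs1, hs2, hall⟩ := (hU.sd hN).two σ hσ h3
      intro q hq hσq
      have e1 := hall r hr.1 hσr
      have e2 := hall r' hr'.1 hσr'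
      have e3 := hall q hq hσq
      have hne' : r ≠ r' := by rintro rfl; exact hrB' hrB
      rcases e1 with rfl | rfl <;> rcases e2 with rfl | rfl <;> rcases e3 with rfl | rfl <;> tauto

/-- Cells without common faces, boundaries included. -/
def CellsDisjoint (U U' : Set (Finset V)) : Prop :=
  ∀ σ : Finset V, σ.Nonempty → (∃ τ ∈ U, σ ⊆ τ) → ¬ ∃ τ ∈ U', σ ⊆ τ

lemma exists_superset_of_mem_sdUp (hU : N.IsCell U) {C C' : Finset (Finset V)}
    (hC' : C' ∈ N.sdUp U) (hC : C ⊆ C') {r : Finset V} (hr : r ∈ C) : ∃ τ ∈ U, r ⊆ τ := by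
  obtain ⟨hC's, u, hu, huU⟩ := hC'
  rcases sd_chain hC's (hC hr) hu with h | h
  · exact ⟨u, huU, h⟩
  · exact ⟨r, hU.up u huU r (hC's.2.1 r (hC hr)) h, subset_rfl⟩

lemma CellsDisjoint.sd {U' : Set (Finset V)} (hU : N.IsCell U) (hU' : N.IsCell U')
    (h : CellsDisjoint U U') : CellsDisjoint (N.sdUp U) (N.sdUp U') := by
  rintro C ⟨r, hr⟩ ⟨τ, hτ, hC⟩ ⟨τ', hτ', hC'⟩
  exact h r (nonempty_of_mem (hτ.1.2.1 r (hC hr))) (exists_superset_of_mem_sdUp hU hτ hC hr)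
    (exists_superset_of_mem_sdUp hU' hτ' hC' hr)

lemma CellsDisjoint.notMem {U' : Set (Finset V)} (h : CellsDisjoint U U') {s s' : Finset V}
    (hs : s ∈ U) (hs' : s' ∈ U') {x : V} (hx : x ∈ s) (hx' : x ∈ s') : False :=
  h {x} (by simp) ⟨s, hs, by simpa using hx⟩ ⟨s', hs', by simpa using hx'⟩

end FinComplex

/-! ### A triangulated dunce hat -/

/-- The triangles of a triangulated disc. -/
def discTriangle : Fin 35 → Fin 3 → Fin 23 := ![
  ![0, 2, 1], ![0, 1, 20], ![0, 3, 2], ![4, 1, 2], ![0, 20, 3], ![4, 20, 1], ![8, 2, 3],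
  ![4, 2, 5], ![8, 3, 20], ![4, 13, 20], ![8, 22, 2], ![7, 5, 2], ![4, 5, 6], ![4, 11, 13],
  ![7, 2, 22], ![7, 6, 5], ![4, 6, 12], ![4, 12, 11], ![14, 13, 11], ![9, 6, 7], ![9, 12, 6],
  ![10, 11, 12], ![14, 11, 16], ![9, 10, 12], ![10, 16, 11], ![14, 16, 18], ![9, 15, 10],
  ![10, 15, 16], ![14, 18, 19], ![17, 18, 16], ![9, 17, 15], ![17, 16, 15], ![19, 18, 21],
  ![17, 21, 18], ![9, 21, 17]]

/-- Identification of the boundary vertices of the disc according to the word `a a a⁻¹`. -/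
def foldVertex : Fin 23 → Fin 17 := ![
  1, 6, 8, 7, 0, 13, 12, 4, 2, 2, 5, 10, 14, 4, 2, 11, 15, 3, 9, 4, 16, 16, 16]

/-- The triangles of the dunce hat. -/
def hatTriangle (k : Fin 35) : Finset (Fin 17) :=
  {foldVertex (discTriangle k 0), foldVertex (discTriangle k 1), foldVertex (discTriangle k 2)}

/-- Some faces of a tetrahedron. -/
def hatFace : Fin 5 → Finset (Fin 4) := ![Finset.univ, {1, 2, 3}, {2, 3}, {3}, {2}]

/-- Some chains of the faces `hatFace`. -/
def hatChain : Fin 6 → Finset (Fin 5) := ![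
  {0}, {0, 1}, {0, 2}, {0, 1, 2}, {0, 1, 2, 4}, {0, 1, 2, 3}]

/-- The vertices of the dunce hat, as chains of the chains `hatChain`. -/
def hatCode : Fin 17 → Finset (Fin 6) := ![
  {0}, {1}, {3}, {3, 5}, {0, 3}, {2, 3}, {0, 1}, {1, 3}, {0, 1, 3}, {0, 3, 5}, {0, 2, 3},
  {2, 3, 5}, {0, 3, 4}, {0, 1, 3, 4}, {0, 2, 3, 4}, {0, 2, 3, 5}, {0, 1, 3, 5}]

/-- A neighbouring triangle in the disc that is closer to the first triangle. -/
def discParent : Fin 35 → Fin 35 := ![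
  0, 0, 0, 0, 1, 1, 2, 3, 4, 5, 6, 7, 7, 9, 10, 11, 12, 13, 13, 15, 16, 17, 18, 20, 21, 22, 23,
  24, 25, 25, 26, 27, 28, 29, 30]

lemma card_hatTriangle : ∀ k, (hatTriangle k).card = 3 := by decide +kernel

lemma hatTriangle_injective : Function.Injective hatTriangle := by
  have h : ∀ i j, hatTriangle i = hatTriangle j → i = j := by decide +kernel
  exact fun i j => h i j

lemma discParent_spec : ∀ k, k ≠ 0 → discParent k < k ∧
    (hatTriangle k ∩ hatTriangle (discParent k)).card = 2 ∧
    ∀ l, hatTriangle k ∩ hatTriangle (discParent k) ⊆ hatTriangle l ↔ l = k ∨ l = discParent k := by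
  decide +kernel

lemma hat_singular_edge : ∀ l, ({2, 4} : Finset (Fin 17)) ⊆ hatTriangle l ↔ l = 18 ∨ l = 19 ∨ l = 28 := by
  decide +kernel

lemma hat_edge : ∀ k, ∀ a ∈ hatTriangle k, ∀ b ∈ hatTriangle k, a ≠ b →
    ∃ l, l ≠ k ∧ a ∈ hatTriangle l ∧ b ∈ hatTriangle l := by
  decide +kernel

lemma hatFace_injective : Function.Injective hatFace := by
  have h : ∀ i j, hatFace i = hatFace j → i = j := by decide +kernel
  exact fun i j => h i j

lemma hatFace_nonempty : ∀ i, (hatFace i).Nonempty := by decide +kernel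

lemma hatChain_injective : Function.Injective hatChain := by
  have h : ∀ i j, hatChain i = hatChain j → i = j := by decide +kernel
  exact fun i j => h i j

lemma hatChain_chain : ∀ i, 0 ∈ hatChain i ∧ ∀ x ∈ hatChain i, ∀ y ∈ hatChain i,
    hatFace x ⊆ hatFace y ∨ hatFace y ⊆ hatFace x := by
  decide +kernel

lemma hatCode_injective : Function.Injective hatCode := by
  have h : ∀ i j, hatCode i = hatCode j → i = j := by decide +kernel
  exact fun i j => h i j

lemma hatCode_chain : ∀ i, (hatCode i).Nonempty ∧ ∀ c ∈ hatCode i, ∀ d ∈ hatCode i,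
    hatChain c ⊆ hatChain d ∨ hatChain d ⊆ hatChain c := by
  decide +kernel

lemma hatTriangle_comparable : ∀ k, ∀ a ∈ hatTriangle k, ∀ b ∈ hatTriangle k,
    hatCode a ⊆ hatCode b ∨ hatCode b ⊆ hatCode a := by
  decide +kernel

/-- The map of simplices induced by an injective map of vertices. -/
def simplexEmb {V W : Type*} (g : V ↪ W) : Finset V ↪ Finset W := (Finset.mapEmbedding g).toEmbedding

lemma simplexEmb_apply {V W : Type*} (g : V ↪ W) (σ : Finset V) : simplexEmb g σ = σ.map g := rfl

/-- The positions of the vertices of the dunce hat in the third barycentric subdivision of a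
tetrahedron. -/
def hatVertex : Fin 17 ↪ Finset (Finset (Finset (Fin 4))) :=
  (⟨hatCode, hatCode_injective⟩ : Fin 17 ↪ _).trans (simplexEmb
    ((⟨hatChain, hatChain_injective⟩ : Fin 6 ↪ _).trans (simplexEmb ⟨hatFace, hatFace_injective⟩)))

/-- The abstract triangulated dunce hat. -/
def hatComplex : FinComplex (Fin 17) where
  faces := {σ | σ.Nonempty ∧ ∃ k, σ ⊆ hatTriangle k}
  isRelLowerSet_faces := fun _ h => ⟨h.1, fun _ hs h' =>
    ⟨h', h.2.imp fun _ hk => hs.trans hk⟩⟩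
  finite := Set.toFinite _

namespace FinComplex

variable {V W : Type u}

/-- The image of a complex under a relabeling of the vertices. -/
def map {V : Type*} {W : Type u} (g : V ↪ W) (K : FinComplex V) : FinComplex W where
  faces := {τ | ∃ σ ∈ K.faces, τ = σ.map g}
  isRelLowerSet_faces := by
    classical
    rintro _ ⟨σ, hσ, rfl⟩
    refine ⟨(nonempty_of_mem hσ).map, fun τ hτ hne => ?_⟩
    obtain ⟨ρ, hρ, rfl⟩ := Finset.subset_map_iff.1 hτ
    exact ⟨ρ, mem_of_subset hσ hρ (by simpa using hne), rfl⟩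
  finite := (K.finite.image (Finset.map g)).subset fun τ ⟨σ, hσ, h⟩ => ⟨σ, hσ, h.symm⟩

lemma map_sd_mem {V : Type*} {W : Type u} {K : FinComplex V} {N : FinComplex W} {g : V ↪ W}
    (h : ∀ σ ∈ K.faces, σ.map g ∈ N.faces) : ∀ C ∈ K.sd.faces, C.map (simplexEmb g) ∈ N.sd.faces := by
  rintro C ⟨h1, h2, h3⟩
  refine ⟨h1.map, ?_, ?_⟩
  · intro σ hσ
    obtain ⟨τ, hτ, rfl⟩ := Finset.mem_map.1 hσ
    exact h τ (h2 τ hτ)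
  · intro σ hσ τ hτ
    obtain ⟨σ', hσ', rfl⟩ := Finset.mem_map.1 hσ
    obtain ⟨τ', hτ', rfl⟩ := Finset.mem_map.1 hτ
    simp only [simplexEmb_apply, Finset.map_subset_map]
    exact h3 σ' hσ' τ' hτ'

lemma mem_hat_of_card_three {σ : Finset (Fin 17)} (h : σ ∈ hatComplex.faces) (h3 : σ.card = 3) :
    ∃ k, σ = hatTriangle k := by
  obtain ⟨k, hk⟩ := h.2
  exact ⟨k, Finset.eq_of_subset_of_card_le hk (by rw [card_hatTriangle, h3])⟩

lemma hatTriangle_mem (k : Fin 35) : hatTriangle k ∈ hatComplex.faces :=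
  ⟨Finset.card_pos.1 (by rw [card_hatTriangle]; norm_num), k, subset_rfl⟩

/-- The dunce hat carries no cycle. -/
lemma noCycles_hat {W : Type u} (g : Fin 17 ↪ W) :
    NoCycles {t | ∃ k, t = (hatTriangle k).map g} := by
  classical
  intro Z hZ heven
  set m : Fin 35 → Finset W := fun k => (hatTriangle k).map g with hm
  have hinj : Function.Injective m := fun i j h => hatTriangle_injective (Finset.map_injective g h)
  have hfil : ∀ e : Finset (Fin 17), {t ∈ Z | e.map g ⊆ t} =
      ({k | e ⊆ hatTriangle k ∧ m k ∈ Z} : Finset (Fin 35)).image m := by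
    intro e
    ext t
    simp only [Finset.mem_filter, Finset.mem_image, Finset.mem_univ, true_and]
    constructor
    · rintro ⟨ht, he⟩
      obtain ⟨k, rfl⟩ := hZ t ht
      exact ⟨k, ⟨by simpa using he, ht⟩, rfl⟩
    · rintro ⟨k, ⟨he, hk⟩, rfl⟩
      exact ⟨hk, by simpa [hm] using he⟩
  have hev : ∀ e : Finset (Fin 17), e.card = 2 → (∃ k, e ⊆ hatTriangle k) →
      Even ({k | e ⊆ hatTriangle k ∧ m k ∈ Z} : Finset (Fin 35)).card := by
    intro e he ⟨k, hk⟩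
    have h := heven (e.map g) (by simpa using he) ⟨m k, ⟨k, rfl⟩, by simpa [hm] using hk⟩
    rwa [hfil, Finset.card_image_of_injective _ hinj] at h
  have hpar : ∀ k, k ≠ 0 → (m k ∈ Z ↔ m (discParent k) ∈ Z) := by
    intro k hk
    obtain ⟨h1, h2, h3⟩ := discParent_spec k hk
    have h := hev _ h2 ⟨k, Finset.inter_subset_left⟩
    simp only [h3] at h
    have hne : k ≠ discParent k := h1.ne'
    by_contra hcon
    have hone : ({l | (l = k ∨ l = discParent k) ∧ m l ∈ Z} : Finset (Fin 35)).card = 1 := by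
      rw [Finset.card_eq_one]
      by_cases hk : m k ∈ Z
      · refine ⟨k, ?_⟩
        ext l
        simp only [Finset.mem_filter, Finset.mem_univ, true_and, Finset.mem_singleton]
        constructor
        · rintro ⟨rfl | rfl, hl⟩
          · rfl
          · tauto
        · rintro rfl
          exact ⟨Or.inl rfl, hk⟩
      · refine ⟨discParent k, ?_⟩
        ext l
        simp only [Finset.mem_filter, Finset.mem_univ, true_and, Finset.mem_singleton]
        constructor
        · rintro ⟨rfl | rfl, hl⟩
          · tauto
          · rfl
        · rintro rfl
          exact ⟨Or.inr rfl, by tauto⟩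
    rw [hone] at h
    exact absurd h (by decide)
  have hall : ∀ n : ℕ, ∀ k : Fin 35, (k : ℕ) = n → (m k ∈ Z ↔ m 0 ∈ Z) := by
    intro n
    induction n using Nat.strong_induction_on with
    | _ n ih =>
      intro k hk
      by_cases hk0 : k = 0
      · rw [hk0]
      · rw [hpar k hk0]
        exact ih _ (hk ▸ (discParent_spec k hk0).1) _ rfl
  have hall' : ∀ k, m k ∈ Z ↔ m 0 ∈ Z := fun k => hall _ k rfl
  have h0 : m 0 ∉ Z := by
    intro h0
    have h := hev {2, 4} (by decide) ⟨18, (hat_singular_edge 18).2 (Or.inl rfl)⟩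
    have : ({k | ({2, 4} : Finset (Fin 17)) ⊆ hatTriangle k ∧ m k ∈ Z} : Finset (Fin 35)) =
        {18, 19, 28} := by
      ext k
      simp [hat_singular_edge, hall', h0]
    rw [this] at h
    exact absurd h (by decide)
  rw [Finset.eq_empty_iff_forall_notMem]
  intro t ht
  obtain ⟨k, rfl⟩ := hZ t ht
  exact h0 ((hall' k).1 ht)

/-- The interior of the third barycentric subdivision of a tetrahedron. -/
def cell3 (N : FinComplex V) (s : Finset V) : Set (Finset (Finset (Finset (Finset V)))) :=
  N.sd.sd.sdUp (N.sd.sdUp (N.sdUp {s}))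

/-- The vertices of the dunce hat in the third barycentric subdivision of a tetrahedron. -/
def hatEmb {V : Type u} (g : Fin 4 ↪ V) : Fin 17 ↪ Finset (Finset (Finset V)) :=
  hatVertex.trans (simplexEmb (simplexEmb (simplexEmb g)))

/-- The dunce hat in the third barycentric subdivision of a tetrahedron. -/
def hat {V : Type u} (g : Fin 4 ↪ V) : FinComplex (Finset (Finset (Finset V))) :=
  hatComplex.map (hatEmb g)

lemma isCell_cell3 {N : FinComplex V} (hN : N.DimLE3) {s : Finset V} (hs : s ∈ N.faces)
    (h4 : s.card = 4) : N.sd.sd.sd.IsCell (N.cell3 s) :=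
  (((isCell_singleton hN hs h4).sd hN).sd hN.sd).sd hN.sd.sd

lemma ConnAvoid.sd_of_false {N : FinComplex V} {U : Set (Finset V)} (hN : N.DimLE3) (hU : N.IsCell U)
    (h : ConnAvoid U (fun _ => False)) : ConnAvoid (N.sdUp U) (fun _ => False) := by
  have := ConnAvoid.sd (D := ∅) hN hU (by simp) (by simp) (by simpa using h)
  simpa using this

lemma connAvoid_cell3 {N : FinComplex V} (hN : N.DimLE3) {s : Finset V} (hs : s ∈ N.faces)
    (h4 : s.card = 4) : ConnAvoid (N.cell3 s) (fun _ => False) := by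
  have h1 := isCell_singleton hN hs h4
  exact ConnAvoid.sd_of_false hN.sd.sd ((h1.sd hN).sd hN.sd) (ConnAvoid.sd_of_false hN.sd (h1.sd hN)
    (ConnAvoid.sd_of_false hN h1 (connAvoid_singleton s _)))

lemma hat_mem {N : FinComplex V} {g : Fin 4 ↪ V} (hg : Finset.univ.map g ∈ N.faces) :
    ∀ σ ∈ hatComplex.faces, σ.map (hatEmb g) ∈ N.cell3 (Finset.univ.map g) := by
  classical
  have h0 : ∀ σ ∈ tetrahedron.faces, σ.map g ∈ N.faces := fun σ hσ =>
    mem_of_subset hg (Finset.map_subset_map.2 (Finset.subset_univ σ)) (Finset.Nonempty.map hσ)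
  have h3 := map_sd_mem (map_sd_mem (map_sd_mem h0))
  have hc : ∀ c, simplexEmb ⟨hatFace, hatFace_injective⟩ (hatChain c) ∈ tetrahedron.sd.faces := by
    intro c
    refine ⟨⟨_, Finset.mem_map_of_mem _ (hatChain_chain c).1⟩, ?_, ?_⟩
    · intro x hx
      obtain ⟨y, -, rfl⟩ := Finset.mem_map.1 hx
      exact hatFace_nonempty y
    · intro x hx y hy
      obtain ⟨x', hx', rfl⟩ := Finset.mem_map.1 hx
      obtain ⟨y', hy', rfl⟩ := Finset.mem_map.1 hy
      exact (hatChain_chain c).2 x' hx' y' hy'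
  have hv : ∀ i, hatVertex i ∈ tetrahedron.sd.sd.faces := by
    intro i
    refine ⟨(hatCode_chain i).1.map, ?_, ?_⟩
    · intro x hx
      obtain ⟨y, -, rfl⟩ := Finset.mem_map.1 hx
      exact hc y
    · intro x hx y hy
      obtain ⟨x', hx', rfl⟩ := Finset.mem_map.1 hx
      obtain ⟨y', hy', rfl⟩ := Finset.mem_map.1 hy
      exact ((hatCode_chain i).2 x' hx' y' hy').imp Finset.map_subset_map.2 Finset.map_subset_map.2
  rintro σ ⟨hσ, k, hk⟩
  have hσ3 : σ.map hatVertex ∈ tetrahedron.sd.sd.sd.faces := by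
    refine ⟨hσ.map, ?_, ?_⟩
    · intro x hx
      obtain ⟨i, hi, rfl⟩ := Finset.mem_map.1 hx
      exact hv i
    · intro x hx y hy
      obtain ⟨i, hi, rfl⟩ := Finset.mem_map.1 hx
      obtain ⟨j, hj, rfl⟩ := Finset.mem_map.1 hy
      exact (hatTriangle_comparable k i (hk hi) j (hk hj)).imp Finset.map_subset_map.2
        Finset.map_subset_map.2
  have hmem : σ.map (hatEmb g) ∈ N.sd.sd.sd.faces := by
    have := h3 _ hσ3
    rwa [Finset.map_map] at this
  refine ⟨hmem, ?_⟩
  obtain ⟨i, hi⟩ := hσ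
  have himem : hatEmb g i ∈ σ.map (hatEmb g) := Finset.mem_map_of_mem _ hi
  refine ⟨_, himem, hmem.2.1 _ himem, ?_⟩
  obtain ⟨c, hci⟩ := (hatCode_chain i).1
  refine ⟨(simplexEmb ⟨hatFace, hatFace_injective⟩ (hatChain c)).map (simplexEmb g),
    Finset.mem_map_of_mem (simplexEmb (simplexEmb g)) (Finset.mem_map_of_mem _ hci),
    map_sd_mem h0 _ (hc c), ?_⟩
  exact ⟨_, Finset.mem_map_of_mem (simplexEmb g) (Finset.mem_map_of_mem _ (hatChain_chain c).1), rfl⟩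

lemma isSpine_hat {N : FinComplex V} (hN : N.DimLE3) {g : Fin 4 ↪ V}
    (hg : Finset.univ.map g ∈ N.faces) :
    IsSpine N.sd.sd.sd (N.cell3 (Finset.univ.map g)) (hat g) where
  sub := by
    rintro _ ⟨σ, hσ, rfl⟩
    exact hat_mem hg σ hσ
  card_le := by
    rintro _ ⟨σ, ⟨-, k, hk⟩, rfl⟩
    rw [Finset.card_map]
    exact (Finset.card_le_card hk).trans (card_hatTriangle k).le
  pure := by
    rintro _ ⟨σ, ⟨-, k, hk⟩, rfl⟩
    exact ⟨_, ⟨_, hatTriangle_mem k, rfl⟩, Finset.map_subset_map.2 hk, by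
      rw [Finset.card_map, card_hatTriangle]⟩
  edge := by
    classical
    rintro _ ⟨σ, hσ, rfl⟩ h3 e he h2
    rw [Finset.card_map] at h3
    obtain ⟨k, rfl⟩ := mem_hat_of_card_three hσ h3
    obtain ⟨e, he', rfl⟩ := Finset.subset_map_iff.1 he
    rw [Finset.card_map] at h2
    obtain ⟨a, b, hab, rfl⟩ := Finset.card_eq_two.1 h2
    obtain ⟨l, hlk, ha, hb⟩ := hat_edge k a (he' (by simp)) b (he' (by simp)) hab
    refine ⟨_, ⟨_, hatTriangle_mem l, rfl⟩, by rw [Finset.card_map, card_hatTriangle], ?_, ?_⟩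
    · exact fun h => hlk (hatTriangle_injective (Finset.map_injective _ h))
    · rw [Finset.map_subset_map]
      intro x hx
      rw [Finset.mem_insert, Finset.mem_singleton] at hx
      rcases hx with rfl | rfl <;> assumption
  conn := by
    have h4 : (Finset.univ.map g).card = 4 := by simp
    have h := ConnAvoid.of_noCycles (D := {t | ∃ k, t = (hatTriangle k).map (hatEmb g)})
      (isCell_cell3 hN hg h4) (connAvoid_cell3 hN hg h4) hN.sd.sd.sd ?_ ?_ (noCycles_hat _)
    · intro B hB
      refine h B fun σ hσ h3 hσD => hB σ hσ h3 ?_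
      rintro ⟨ρ, hρ, rfl⟩
      rw [Finset.card_map] at h3
      obtain ⟨k, rfl⟩ := mem_hat_of_card_three hρ h3
      exact hσD ⟨k, rfl⟩
    · rintro _ ⟨k, rfl⟩
      rw [Finset.card_map, card_hatTriangle]
    · rintro _ ⟨k, rfl⟩ e he h2
      obtain ⟨e, he', rfl⟩ := Finset.subset_map_iff.1 he
      rw [Finset.card_map] at h2
      exact hat_mem hg e ⟨Finset.card_pos.1 (by omega), k, he'⟩
  nonempty := ⟨_, _, hatTriangle_mem 0, rfl⟩

end FinComplex

/-- A tetrahedron in the second barycentric subdivision of a tetrahedron, all of whose vertices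
are interior. -/
def innerVertex : Fin 4 → Finset (Finset (Fin 4)) := ![{Finset.univ}, {Finset.univ, {0}},
  {Finset.univ, {0}, {0, 1}}, {Finset.univ, {0}, {0, 1}, {0, 1, 2}}]

lemma innerVertex_injective : Function.Injective innerVertex := by
  have h : ∀ i j, innerVertex i = innerVertex j → i = j := by decide +kernel
  exact fun i j => h i j

lemma innerVertex_chain : ∀ i, Finset.univ ∈ innerVertex i ∧ (∀ x ∈ innerVertex i, x.Nonempty) ∧
    ∀ x ∈ innerVertex i, ∀ y ∈ innerVertex i, x ⊆ y ∨ y ⊆ x := by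
  decide +kernel

lemma innerVertex_comparable : ∀ i j, innerVertex i ⊆ innerVertex j ∨ innerVertex j ⊆ innerVertex i := by
  decide +kernel

/-- Triples of distinct vertices of a tetrahedron. -/
def distinctTriples : Finset (Fin 4 × Fin 4 × Fin 4) :=
  Finset.univ.filter fun p => p.1 ≠ p.2.1 ∧ p.1 ≠ p.2.2 ∧ p.2.1 ≠ p.2.2

lemma card_distinctTriples : distinctTriples.card = 24 := by decide +kernel

namespace FinComplex

variable {V : Type u} {L : FinComplex V}

/-- The inner tetrahedron of the second barycentric subdivision of a tetrahedron. -/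
def innerEmb (f : Fin 4 ↪ V) : Fin 4 ↪ Finset (Finset V) :=
  (⟨innerVertex, innerVertex_injective⟩ : Fin 4 ↪ _).trans (simplexEmb (simplexEmb f))

lemma map_mem_faces {f : Fin 4 ↪ V} (hf : Finset.univ.map f ∈ L.faces) :
    ∀ σ ∈ tetrahedron.faces, σ.map f ∈ L.faces := fun σ hσ =>
  mem_of_subset hf (Finset.map_subset_map.2 (Finset.subset_univ σ)) (Finset.Nonempty.map hσ)

lemma innerEmb_mem {f : Fin 4 ↪ V} (hf : Finset.univ.map f ∈ L.faces) :
    Finset.univ.map (innerEmb f) ∈ L.sd.sd.faces := by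
  have h : Finset.univ.map (⟨innerVertex, innerVertex_injective⟩ : Fin 4 ↪ _) ∈
      tetrahedron.sd.sd.faces := by
    refine ⟨by simp, ?_, ?_⟩
    · intro x hx
      obtain ⟨i, -, rfl⟩ := Finset.mem_map.1 hx
      exact ⟨⟨_, (innerVertex_chain i).1⟩, (innerVertex_chain i).2.1, (innerVertex_chain i).2.2⟩
    · intro x hx y hy
      obtain ⟨i, -, rfl⟩ := Finset.mem_map.1 hx
      obtain ⟨j, -, rfl⟩ := Finset.mem_map.1 hy
      exact innerVertex_comparable i j
  have := map_sd_mem (map_sd_mem (map_mem_faces hf)) _ h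
  rwa [Finset.map_map] at this

lemma mem_innerEmb (f : Fin 4 ↪ V) {x : Finset (Finset V)}
    (hx : x ∈ Finset.univ.map (innerEmb f)) : Finset.univ.map f ∈ x := by
  obtain ⟨i, -, rfl⟩ := Finset.mem_map.1 hx
  exact Finset.mem_map_of_mem (simplexEmb f) (innerVertex_chain i).1

/-- The cell around the dunce hat in the fifth barycentric subdivision. -/
def hatCell (L : FinComplex V) (f : Fin 4 ↪ V) : Set (Finset (Finset (Finset (Finset (Finset (Finset V)))))) :=
  L.sd.sd.cell3 (Finset.univ.map (innerEmb f))

/-- The dunce hat in the seventh barycentric subdivision, subdivided twice. -/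
def hatSd (f : Fin 4 ↪ V) :
    FinComplex (Finset (Finset (Finset (Finset (Finset (Finset (Finset V))))))) :=
  (hat (innerEmb f)).sd.sd

/-- The seventh barycentric subdivision. -/
abbrev sd7 (L : FinComplex V) :
    FinComplex (Finset (Finset (Finset (Finset (Finset (Finset (Finset V))))))) :=
  L.sd.sd.sd.sd.sd.sd.sd

/-- The cell around the dunce hat in the seventh barycentric subdivision. -/
def hatCell7 (L : FinComplex V) (f : Fin 4 ↪ V) :
    Set (Finset (Finset (Finset (Finset (Finset (Finset (Finset (Finset V)))))))) :=
  L.sd.sd.sd.sd.sd.sd.sdUp (L.sd.sd.sd.sd.sd.sdUp (L.hatCell f))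

/-- The tetrahedra of the cell around the dunce hat in the seventh barycentric subdivision. -/
def hatTets (L : FinComplex V) (f : Fin 4 ↪ V) :
    Finset (Finset (Finset (Finset (Finset (Finset (Finset (Finset (Finset V)))))))) :=
  L.sd7.cellTets (L.hatCell7 f)

lemma isCell_hatCell (hL : L.DimLE3) {f : Fin 4 ↪ V} (hf : Finset.univ.map f ∈ L.faces) :
    L.sd.sd.sd.sd.sd.IsCell (L.hatCell f) :=
  isCell_cell3 hL.sd.sd (innerEmb_mem hf) (by simp)

lemma isCell_hatCell7 (hL : L.DimLE3) {f : Fin 4 ↪ V} (hf : Finset.univ.map f ∈ L.faces) :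
    L.sd7.IsCell (L.hatCell7 f) :=
  ((isCell_hatCell hL hf).sd hL.sd.sd.sd.sd.sd).sd hL.sd.sd.sd.sd.sd.sd

lemma isSpine_hatSd (hL : L.DimLE3) {f : Fin 4 ↪ V} (hf : Finset.univ.map f ∈ L.faces) :
    IsSpine L.sd7 (L.hatCell7 f) (hatSd f) :=
  ((isSpine_hat hL.sd.sd (innerEmb_mem hf)).sd hL.sd.sd.sd.sd.sd (isCell_hatCell hL hf)).sd
    hL.sd.sd.sd.sd.sd.sd ((isCell_hatCell hL hf).sd hL.sd.sd.sd.sd.sd)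

lemma isGadget_hatSd (hL : L.DimLE3) {f : Fin 4 ↪ V} (hf : Finset.univ.map f ∈ L.faces) :
    IsGadget L.sd7 (L.hatTets f) (hatSd f).triangles
      {t | t ∈ (hat (innerEmb f)).sd.faces ∧ t.card = 3} (hat (innerEmb f)).sd.faces :=
  ((isSpine_hat hL.sd.sd (innerEmb_mem hf)).sd hL.sd.sd.sd.sd.sd (isCell_hatCell hL hf)).isGadget
    hL.sd.sd.sd.sd.sd.sd ((isCell_hatCell hL hf).sd hL.sd.sd.sd.sd.sd)
    ((isSpine_hat hL.sd.sd (innerEmb_mem hf)).sd_unique hL.sd.sd.sd.sd.sd (isCell_hatCell hL hf))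

lemma exists_card_hatTets_le : ∃ κ : ℕ, ∀ (V : Type u) (L : FinComplex V) (f : Fin 4 ↪ V), L.DimLE3 →
    Finset.univ.map f ∈ L.faces → (L.hatTets f).card ≤ κ := by
  refine ⟨2 ^ 16 * (2 ^ 16 * (2 ^ 16 * (2 ^ 16 * (2 ^ 16 * 1)))), fun V L f hL hf => ?_⟩
  have h0 := isCell_singleton hL.sd.sd (innerEmb_mem hf) (by simp)
  have c0 : (L.sd.sd.cellTets {Finset.univ.map (innerEmb f)}).card ≤ 1 := by
    refine Finset.card_le_one.2 fun a ha b hb => ?_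
    rw [mem_cellTets h0.sub] at ha hb
    exact ha.1.trans hb.1.symm
  have h1 := h0.sd hL.sd.sd
  have h2 := h1.sd hL.sd.sd.sd
  have h3 := h2.sd hL.sd.sd.sd.sd
  have h4 := h3.sd hL.sd.sd.sd.sd.sd
  have e1 := card_cellTets_sdUp_le hL.sd.sd h0
  have e2 := card_cellTets_sdUp_le hL.sd.sd.sd h1
  have e3 := card_cellTets_sdUp_le hL.sd.sd.sd.sd h2
  have e4 := card_cellTets_sdUp_le hL.sd.sd.sd.sd.sd h3
  have e5 := card_cellTets_sdUp_le hL.sd.sd.sd.sd.sd.sd h4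
  refine e5.trans (Nat.mul_le_mul_left _ (e4.trans (Nat.mul_le_mul_left _ (e3.trans
    (Nat.mul_le_mul_left _ (e2.trans (Nat.mul_le_mul_left _ (e1.trans
    (Nat.mul_le_mul_left _ c0)))))))))

lemma cellsDisjoint_hatCell7 (hL : L.DimLE3) {f f' : Fin 4 ↪ V} (hf : Finset.univ.map f ∈ L.faces)
    (hf' : Finset.univ.map f' ∈ L.faces) (hne : Finset.univ.map f ≠ Finset.univ.map f') :
    CellsDisjoint (L.hatCell7 f) (L.hatCell7 f') := by
  have h0 : CellsDisjoint {Finset.univ.map (innerEmb f)} {Finset.univ.map (innerEmb f')} := by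
    rintro σ ⟨x, hx⟩ ⟨_, rfl, h1⟩ ⟨_, rfl, h2⟩
    have hxs : x ∈ L.sd.faces := (innerEmb_mem hf).2.1 x (h1 hx)
    refine hne (sd_card_injOn hxs (mem_innerEmb f (h1 hx)) (mem_innerEmb f' (h2 hx)) ?_)
    simp
  have i0 := isCell_singleton hL.sd.sd (innerEmb_mem hf) (by simp)
  have j0 := isCell_singleton hL.sd.sd (innerEmb_mem hf') (by simp)
  have i1 := i0.sd hL.sd.sd
  have i2 := i1.sd hL.sd.sd.sd
  have i3 := i2.sd hL.sd.sd.sd.sd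
  have i4 := i3.sd hL.sd.sd.sd.sd.sd
  have j1 := j0.sd hL.sd.sd
  have j2 := j1.sd hL.sd.sd.sd
  have j3 := j2.sd hL.sd.sd.sd.sd
  have j4 := j3.sd hL.sd.sd.sd.sd.sd
  exact ((((h0.sd i0 j0).sd i1 j1).sd i2 j2).sd i3 j3).sd i4 j4

lemma hatTets_notMem (hL : L.DimLE3) {f f' : Fin 4 ↪ V} (hf : Finset.univ.map f ∈ L.faces)
    (hf' : Finset.univ.map f' ∈ L.faces) (hne : Finset.univ.map f ≠ Finset.univ.map f')
    {s s' : Finset (Finset (Finset (Finset (Finset (Finset (Finset (Finset V)))))))}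
    (hs : s ∈ L.hatTets f) (hs' : s' ∈ L.hatTets f') {x} (hx : x ∈ s) (hx' : x ∈ s') : False := by
  rw [hatTets, mem_cellTets (isCell_hatCell7 hL hf).sub] at hs
  rw [hatTets, mem_cellTets (isCell_hatCell7 hL hf').sub] at hs'
  exact (cellsDisjoint_hatCell7 hL hf hf' hne).notMem hs.1 hs'.1 hx hx'

lemma disjoint_sdUp {N B : FinComplex V} {U : Set (Finset V)} (h : Disjoint U B.faces) :
    Disjoint (N.sdUp U) B.sd.faces := by
  rw [Set.disjoint_left] at h ⊢
  rintro C ⟨-, σ, hσ, hσU⟩ hC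
  exact h hσU (hC.2.1 σ hσ)

/-- The cell around the dunce hat does not meet a subcomplex that does not contain the
tetrahedron. -/
lemma disjoint_hatCell7 {B : FinComplex V} {f : Fin 4 ↪ V} (hB : Finset.univ.map f ∉ B.faces) :
    Disjoint (L.hatCell7 f) B.sd7.faces := by
  have h0 : Disjoint ({Finset.univ.map (innerEmb f)} : Set _) B.sd.sd.faces := by
    rw [Set.disjoint_left]
    rintro _ rfl h
    have h1 : innerEmb f 0 ∈ Finset.univ.map (innerEmb f) := Finset.mem_map_of_mem _ (Finset.mem_univ _)
    exact hB ((h.2.1 _ h1).2.1 _ (mem_innerEmb f h1))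
  exact disjoint_sdUp (disjoint_sdUp (disjoint_sdUp (disjoint_sdUp (disjoint_sdUp h0))))

/-- A parametrization of a face with four vertices. -/
lemma exists_embedding_of_card {Δ : Finset V} (h : Δ.card = 4) :
    ∃ f : Fin 4 ↪ V, Finset.univ.map f = Δ := by
  classical
  have e := (Δ.equivFinOfCardEq h).symm
  refine ⟨e.toEmbedding.trans (Function.Embedding.subtype _), ?_⟩
  ext x
  simp only [Finset.mem_map, Finset.mem_univ, true_and]
  constructor
  · rintro ⟨i, rfl⟩
    exact (e i).2
  · intro hx
    exact ⟨e.symm ⟨x, hx⟩, by simp⟩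

lemma flag_injective {x y z x' y' z' : V} {T T' : Finset V} (hT : T.card = 4) (hT' : T'.card = 4)
    (hxy : x ≠ y) (hxz : x ≠ z) (hyz : y ≠ z) (hxy' : x' ≠ y') (hxz' : x' ≠ z') (hyz' : y' ≠ z')
    (h : flag x y z T = flag x' y' z' T') : T = T' ∧ x = x' ∧ y = y' ∧ z = z' := by
  classical
  have c3 : ∀ {x y z : V}, x ≠ y → x ≠ z → y ≠ z → ({x, y, z} : Finset V).card = 3 :=
    fun hxy hxz hyz => Finset.card_eq_three.2 ⟨_, _, _, hxy, hxz, hyz, rfl⟩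
  have key : ∀ r ∈ flag x y z T, (r.card = 1 → r = {x'}) ∧ (r.card = 2 → r = {x', y'}) ∧
      (r.card = 3 → r = {x', y', z'}) ∧ (r.card = 4 → r = T') := by
    intro r hr
    rw [h, mem_flag] at hr
    have e1 := Finset.card_singleton x'
    have e2 := Finset.card_pair hxy'
    have e3 := c3 hxy' hxz' hyz'
    rcases hr with rfl | rfl | rfl | rfl <;> refine ⟨fun _ => ?_, fun _ => ?_, fun _ => ?_, fun _ => ?_⟩ <;>
      first | rfl | omega
  have k1 := (key {x} (mem_flag.2 (by simp))).1 (Finset.card_singleton x)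
  have k2 := (key {x, y} (mem_flag.2 (by simp))).2.1 (Finset.card_pair hxy)
  have k3 := (key {x, y, z} (mem_flag.2 (by simp))).2.2.1 (c3 hxy hxz hyz)
  have k4 := (key T (mem_flag.2 (by simp))).2.2.2 hT
  have hx : x = x' := by simpa using k1
  subst hx
  have hy : y = y' := by
    have : y ∈ ({x, y'} : Finset V) := k2 ▸ (by simp)
    rcases Finset.mem_insert.1 this with h | h
    · exact absurd h.symm hxy
    · simpa using h
  subst hy
  refine ⟨k4, rfl, rfl, ?_⟩
  have : z ∈ ({x, y, z'} : Finset V) := k3 ▸ (by simp)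
  simp only [Finset.mem_insert, Finset.mem_singleton] at this
  rcases this with h | h | h
  exacts [absurd h.symm hxz, absurd h.symm hyz, h]

lemma f_three_sd_le (K : FinComplex V) : 24 * K.f 3 ≤ K.sd.f 3 := by
  classical
  set A : Finset (Finset V) := {σ ∈ K.faceFinset | σ.card = 3 + 1} with hA
  have hmem : ∀ Δ : {x // x ∈ A}, Δ.1 ∈ K.faces ∧ Δ.1.card = 4 := fun Δ => by
    have h := Finset.mem_filter.1 Δ.2
    exact ⟨mem_faceFinset.1 h.1, h.2⟩
  choose f hf using fun Δ : {x // x ∈ A} => exists_embedding_of_card (hmem Δ).2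
  have hfm : ∀ Δ i, f Δ i ∈ Δ.1 := fun Δ i =>
    (hf Δ).symm ▸ Finset.mem_map_of_mem (f Δ) (Finset.mem_univ i)
  have h := Finset.card_le_card_of_injOn (s := A.attach ×ˢ distinctTriples)
    (t := {σ ∈ K.sd.faceFinset | σ.card = 3 + 1})
    (fun p => flag (f p.1 p.2.1) (f p.1 p.2.2.1) (f p.1 p.2.2.2) p.1.1) ?_ ?_
  · rw [Finset.card_product, Finset.card_attach, card_distinctTriples] at h
    rw [mul_comm]
    exact h
  · rintro ⟨Δ, a, b, c⟩ hp
    simp only [distinctTriples, Finset.coe_product, Set.mem_prod, Finset.mem_coe,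
      Finset.mem_filter, Finset.mem_univ, true_and] at hp
    simp only [Finset.coe_filter, Set.mem_ofPred_eq, mem_faceFinset]
    have hi := (f Δ).injective
    exact ⟨flag_mem_sd (hmem Δ).1 (hfm Δ a) (hfm Δ b) (hfm Δ c),
      card_flag (hmem Δ).2 (hi.ne hp.2.1) (hi.ne hp.2.2.1) (hi.ne hp.2.2.2)⟩
  · rintro ⟨Δ, a, b, c⟩ hp ⟨Δ', a', b', c'⟩ hp' heq
    simp only [distinctTriples, Finset.coe_product, Set.mem_prod, Finset.mem_coe,
      Finset.mem_filter, Finset.mem_univ, true_and] at hp hp'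
    have hi := (f Δ).injective
    have hi' := (f Δ').injective
    obtain ⟨h1, h2, h3, h4⟩ := flag_injective (hmem Δ).2 (hmem Δ').2 (hi.ne hp.2.1) (hi.ne hp.2.2.1)
      (hi.ne hp.2.2.2) (hi'.ne hp'.2.1) (hi'.ne hp'.2.2.1) (hi'.ne hp'.2.2.2) heq
    obtain rfl := Subtype.ext h1
    rw [hi h2, hi h3, hi h4]

lemma f_three_sdIter_le (K : FinComplex V) (n : ℕ) : 24 ^ n * K.f 3 ≤ (K.sdIter n).f 3 := by
  induction n with
  | zero => simp [sdIter, SdVertex]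
  | succ n ih =>
    have h := f_three_sd_le (K.sdIter n)
    calc 24 ^ (n + 1) * K.f 3 = 24 * (24 ^ n * K.f 3) := by ring
      _ ≤ 24 * (K.sdIter n).f 3 := Nat.mul_le_mul_left _ ih
      _ ≤ _ := h

lemma DimLE3.sdIter {K : FinComplex V} (hK : K.DimLE3) : ∀ n, (K.sdIter n).DimLE3
  | 0 => hK
  | n + 1 => (hK.sdIter n).sd

/-- A triangulated ball: a cell that contains all tetrahedra, with a boundary triangle. -/
structure IsBall (M : FinComplex V) (U : Set (Finset V)) : Prop where
  cell : M.IsCell U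
  conn : ConnAvoid U (fun _ => False)
  tets : ∀ s ∈ M.faces, s.card = 4 → s ∈ U
  boundary : ∃ b ∈ M.faces, b.card = 3 ∧ ∃ s ∈ M.faces, b ⊂ s ∧ ∀ s' ∈ M.faces, b ⊂ s' → s' = s

lemma dimLE3_tetrahedron : tetrahedron.DimLE3 := fun σ _ => by simpa using Finset.card_le_univ σ

lemma isBall_tetrahedron : tetrahedron.IsBall {Finset.univ} where
  cell := isCell_singleton dimLE3_tetrahedron
    (by exact Finset.univ_nonempty) (by simp)
  conn := connAvoid_singleton _ _
  tets := fun s _ h => by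
    rw [Set.mem_singleton_iff, ← Finset.card_eq_iff_eq_univ]
    simpa using h
  boundary := by
    refine ⟨{0, 1, 2}, by exact ⟨0, by decide⟩, by decide, Finset.univ, by exact Finset.univ_nonempty,
      by decide, fun s' _ h => ?_⟩
    rw [← Finset.card_eq_iff_eq_univ]
    have h1 := Finset.card_lt_card h
    have h2 := Finset.card_le_univ s'
    have h3 : ({0, 1, 2} : Finset (Fin 4)).card = 3 := by decide
    rw [Fintype.card_fin] at h2 ⊢
    omega

lemma IsBall.sd {M : FinComplex V} {U : Set (Finset V)} (hM : M.DimLE3) (h : M.IsBall U) :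
    M.sd.IsBall (M.sdUp U) where
  cell := h.cell.sd hM
  conn := ConnAvoid.sd_of_false hM h.cell h.conn
  tets := fun C hC h4 => by
    obtain ⟨T, hT, hT4, -⟩ := exists_eq_flag hM hC h4
    exact ⟨hC, T, hT, h.tets T (hC.2.1 T hT) hT4⟩
  boundary := by
    classical
    obtain ⟨b, hb, h3, s, hs, hbs, hall⟩ := h.boundary
    obtain ⟨x, y, z, hxy, hxz, hyz, rfl⟩ := Finset.card_eq_three.1 h3
    have hs4 : s.card = 4 := by
      have := Finset.card_lt_card hbs
      have := hM s hs
      omega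
    have f1 := flag_mem_sd (N := M) hs (hbs.1 (by simp : x ∈ _)) (hbs.1 (by simp : y ∈ _))
      (hbs.1 (by simp : z ∈ _))
    have c1 := card_flag hs4 hxy hxz hyz
    have e1 := Finset.card_singleton x
    have e2 := Finset.card_pair hxy
    set F : Finset (Finset V) := {{x}, {x, y}, {x, y, z}} with hF
    have hF3 : F.card = 3 := by
      refine Finset.card_eq_three.2 ⟨_, _, _, ?_, ?_, ?_, rfl⟩ <;> intro h <;>
        [rw [h] at e1; rw [h] at e1; rw [h] at e2] <;> omega
    have s1 : F ⊆ flag x y z s := by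
      intro w; simp only [hF, mem_flag, Finset.mem_insert, Finset.mem_singleton]; tauto
    refine ⟨F, mem_of_subset f1 s1 (Finset.card_pos.1 (by omega)), hF3, _, f1,
      s1.ssubset_of_ne (fun h => by rw [h] at hF3; omega), ?_⟩
    intro C hC hFC
    obtain ⟨w, hw, hwM, rfl, -⟩ := sd_coface hM hF3 hC hFC
    have hcard : ∀ r ∈ F, w.card ≠ r.card := fun r hr h =>
      hw (sd_card_injOn hC (by simp) (by simp [hr]) h ▸ hr)
    have k1 := hcard {x} (by simp [hF])
    have k2 := hcard {x, y} (by simp [hF])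
    have k3 := hcard {x, y, z} (by simp [hF])
    have k4 := hM w hwM
    have k5 := Finset.card_pos.2 (nonempty_of_mem hwM)
    have hsub : {x, y, z} ⊆ w := sd_subset_of_card_le hC (by simp [hF]) (by simp) (by omega)
    rw [hall w hwM (hsub.ssubset_of_ne (by rintro rfl; exact k3 rfl))]
    ext r
    simp only [hF, mem_flag, Finset.mem_insert, Finset.mem_singleton]
    tauto

lemma exists_isBall_sdIter (n : ℕ) : (tetrahedron.sdIter n).DimLE3 ∧
    ∃ U, (tetrahedron.sdIter n).IsBall U := by
  induction n with
  | zero => exact ⟨dimLE3_tetrahedron, _, isBall_tetrahedron⟩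
  | succ n ih =>
    obtain ⟨h, U, hU⟩ := ih
    exact ⟨h.sd, _, hU.sd h⟩

end FinComplex

open FinComplex in
lemma FinComplex.IsBall.hasFreeFaces {V : Type u} {M : FinComplex V} {U : Set (Finset V)} (hM : M.DimLE3)
    (h : M.IsBall U) : HasFreeFaces M := by
  intro S hS hdim
  have hsup := sup_eq_four hM hS hdim
  have hfree : ∀ σ s, σ ∈ M.faces → σ.card = 3 → s ∈ S → σ ⊂ s → (∀ s' ∈ S, σ ⊂ s' → s' = s) →
      (freeFaces S).Nonempty := fun σ s hσ h3 hs hσs hall =>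
    ⟨σ, mem_freeFaces.2 ⟨hS.2 s hs σ hσs.1 (nonempty_of_mem hσ), by omega, s, hs, hσs, hall⟩⟩
  obtain ⟨b, hb, h3, t, ht, hbt, hall⟩ := h.boundary
  by_cases htS : t ∈ S
  · exact hfree b t hb h3 htS hbt fun s' hs' hbs' => hall s' (hS.1 s' hs') hbs'
  · simp only [HaltDim, not_forall, not_le] at hdim
    obtain ⟨s, hs, hs4⟩ := hdim
    have hs4' : s.card = 4 := by
      have := hM s (hS.1 s hs)
      omega
    have ht4 : t.card = 4 := by
      have := Finset.card_lt_card hbt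
      have := hM t ht
      omega
    by_contra hno
    refine htS (h.conn {s | s ∈ S} ?_ s (h.tets s (hS.1 s hs) hs4') t (h.tets t ht ht4) hs4' ht4 hs)
    rintro σ hσ hσ3 - r hr r' hr' hr4 hr4' hσr hσr' hrS
    by_contra hrS'
    refine hno (hfree σ r (h.cell.sub hσ) hσ3 hrS hσr fun s' hs' hσs' => ?_)
    obtain ⟨s₁, h1, s₂, h2, hne, hs1, hs2, hall⟩ := h.cell.two σ hσ hσ3
    have e1 := hall r (h.cell.sub hr) hσr
    have e2 := hall r' (h.cell.sub hr') hσr'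
    have e3 := hall s' (hS.1 s' hs') hσs'
    have n1 : r' ≠ r := by rintro rfl; exact hrS' hrS
    have n2 : r' ≠ s' := by rintro rfl; exact hrS' hs'
    rcases e1 with rfl | rfl <;> rcases e2 with rfl | rfl <;> rcases e3 with rfl | rfl <;> tauto

namespace FinComplex

/-! ### Realizations -/

section Realization

variable {V : Type*} {K : FinComplex V}

lemma isClosed_realization (K : FinComplex V) : IsClosed K.realization := by
  have : K.realization = ⋃ σ ∈ K.faces, {x : V → ℝ | (∀ v, 0 ≤ x v) ∧ (∀ v, v ∉ σ → x v = 0) ∧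
      ∑ v ∈ σ, x v = 1} := by
    ext x
    simp only [realization, Set.mem_ofPred_eq, Set.mem_iUnion, exists_prop]
    constructor
    · rintro ⟨h0, σ, hσ, h1, h2⟩
      exact ⟨σ, hσ, h0, h1, h2⟩
    · rintro ⟨σ, hσ, h0, h1, h2⟩
      exact ⟨h0, σ, hσ, h1, h2⟩
  rw [this]
  refine K.finite.isClosed_biUnion fun σ _ => ?_
  simp only [Set.ofPred_and, Set.ofPred_forall]
  refine IsClosed.inter ?_ (IsClosed.inter ?_ ?_)
  · exact isClosed_iInter fun v => isClosed_le continuous_const (continuous_apply v)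
  · exact isClosed_iInter fun v => isClosed_iInter fun _ =>
      isClosed_eq (continuous_apply v) continuous_const
  · exact isClosed_eq (continuous_finsetSum _ fun v _ => continuous_apply v) continuous_const

lemma isCompact_realization (K : FinComplex V) : IsCompact K.realization := by
  refine (isCompact_univ_pi fun _ => isCompact_Icc (a := (0 : ℝ)) (b := 1)).of_isClosed_subset
    K.isClosed_realization ?_
  rintro x ⟨h0, σ, hσ, h1, h2⟩ v -
  refine ⟨h0 v, ?_⟩
  by_cases hv : v ∈ σ
  · rw [← h2]
    exact Finset.single_le_sum (fun w _ => h0 w) hv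
  · rw [h1 v hv]
    norm_num

instance (K : FinComplex V) : CompactSpace K.realization :=
  isCompact_iff_compactSpace.1 K.isCompact_realization

lemma nonempty_homeomorph_of_bijective {X Y : Type*} [TopologicalSpace X] [TopologicalSpace Y]
    [CompactSpace X] [T2Space Y] {f : X → Y} (hf : Continuous f) (hb : Function.Bijective f) :
    Nonempty (X ≃ₜ Y) :=
  ⟨Continuous.homeoOfEquivCompactToT2 (f := Equiv.ofBijective f hb) hf⟩

open Classical in
/-- The barycentric subdivision map in coordinates. -/
def baryMap (K : FinComplex V) (x : Finset V → ℝ) (v : V) : ℝ :=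
  ∑ σ ∈ K.faceFinset, if v ∈ σ then x σ / σ.card else 0

lemma continuous_baryMap (K : FinComplex V) : Continuous K.baryMap := by
  classical
  refine continuous_pi fun v => continuous_finsetSum _ fun σ _ => ?_
  by_cases h : v ∈ σ
  · simp only [h, if_true]
    exact (continuous_apply σ).div_const _
  · simp only [h, if_false]
    exact continuous_const

open Classical in
lemma baryMap_eq {x : Finset V → ℝ} {C : Finset (Finset V)} (hC : ∀ σ ∈ C, σ ∈ K.faces)
    (hx : ∀ σ, σ ∉ C → x σ = 0) (v : V) :
    K.baryMap x v = ∑ σ ∈ C, if v ∈ σ then x σ / σ.card else 0 := by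
  refine (Finset.sum_subset (fun σ hσ => mem_faceFinset.2 (hC σ hσ)) fun σ _ hσ => ?_).symm
  simp [hx σ hσ]

open Classical in
lemma sum_bary {x : Finset V → ℝ} {C : Finset (Finset V)} {m : Finset V}
    (hm : ∀ σ ∈ C, σ ⊆ m ∧ σ.Nonempty) :
    ∑ v ∈ m, ∑ σ ∈ C, (if v ∈ σ then x σ / σ.card else 0) = ∑ σ ∈ C, x σ := by
  rw [Finset.sum_comm]
  refine Finset.sum_congr rfl fun σ hσ => ?_
  obtain ⟨h1, h2⟩ := hm σ hσ
  rw [← Finset.sum_filter, Finset.filter_mem_eq_inter, Finset.inter_eq_right.2 h1, Finset.sum_const,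
    nsmul_eq_mul]
  have : (σ.card : ℝ) ≠ 0 := by
    have := Finset.card_pos.2 h2
    positivity
  field_simp

lemma baryMap_mem {x : Finset V → ℝ} (hx : x ∈ K.sd.realization) : K.baryMap x ∈ K.realization := by
  classical
  obtain ⟨h0, C, hC, h1, h2⟩ := hx
  obtain ⟨m, hm, hmax⟩ := C.exists_max_image Finset.card hC.1
  have hsub : ∀ σ ∈ C, σ ⊆ m := fun σ hσ => sd_subset_of_card_le hC hσ hm (hmax σ hσ)
  refine ⟨fun v => ?_, m, hC.2.1 m hm, fun v hv => ?_, ?_⟩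
  · rw [baryMap_eq hC.2.1 h1]
    refine Finset.sum_nonneg fun σ _ => ?_
    split_ifs
    · exact div_nonneg (h0 σ) (Nat.cast_nonneg _)
    · exact le_rfl
  · rw [baryMap_eq hC.2.1 h1]
    exact Finset.sum_eq_zero fun σ hσ => if_neg fun h => hv (hsub σ hσ h)
  · rw [Finset.sum_congr rfl fun v _ => baryMap_eq hC.2.1 h1 v,
      sum_bary fun σ hσ => ⟨hsub σ hσ, nonempty_of_mem (hC.2.1 σ hσ)⟩, h2]

lemma baryMap_coord_le {x x' : Finset V → ℝ} (hx : x ∈ K.sd.realization)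
    (hx' : x' ∈ K.sd.realization) (h : K.baryMap x = K.baryMap x') {σ : Finset V} (hσ : σ ∈ K.faces)
    (hbig : ∀ τ : Finset V, σ.card < τ.card → x τ = x' τ) : x' σ ≤ x σ := by
  classical
  obtain ⟨h0, C, hC, h1, h2⟩ := hx
  obtain ⟨v, hvσ, hv⟩ : ∃ v ∈ σ, ∀ τ ∈ C, τ.card ≤ σ.card → τ ≠ σ → v ∉ τ := by
    by_cases hne : ({τ ∈ C | τ.card ≤ σ.card ∧ τ ≠ σ}).Nonempty
    · obtain ⟨m, hm, hmax⟩ := Finset.exists_max_image _ Finset.card hne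
      rw [Finset.mem_filter] at hm
      have : ¬ σ ⊆ m := fun h => hm.2.2 (Finset.eq_of_subset_of_card_le h hm.2.1).symm
      obtain ⟨v, hv, hvm⟩ := Finset.not_subset.1 this
      exact ⟨v, hv, fun τ hτ hc hn h => hvm
        (sd_subset_of_card_le hC hτ hm.1 (hmax τ (Finset.mem_filter.2 ⟨hτ, hc, hn⟩)) h)⟩
    · obtain ⟨v, hv⟩ := nonempty_of_mem hσ
      exact ⟨v, hv, fun τ hτ hc hn => (hne ⟨τ, Finset.mem_filter.2 ⟨hτ, hc, hn⟩⟩).elim⟩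
  have hsum : ∑ τ ∈ K.faceFinset, ((if v ∈ τ then x' τ / τ.card else 0) -
      if v ∈ τ then x τ / τ.card else 0) = 0 := by
    rw [Finset.sum_sub_distrib]
    have := congrFun h v
    simp only [baryMap] at this
    rw [this, sub_self]
  have hnonneg : ∀ τ ∈ K.faceFinset, τ ≠ σ → (0 : ℝ) ≤ (if v ∈ τ then x' τ / τ.card else 0) -
      if v ∈ τ then x τ / τ.card else 0 := by
    intro τ _ hτσ
    by_cases hvτ : v ∈ τ
    · simp only [hvτ, if_true]
      by_cases hc : σ.card < τ.card
      · rw [hbig τ hc, sub_self]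
      · rw [h1 τ fun hτ => hv τ hτ (by omega) hτσ hvτ, zero_div, sub_zero]
        exact div_nonneg (hx'.1 τ) (Nat.cast_nonneg _)
    · simp [hvτ]
  rw [← Finset.add_sum_erase _ _ (mem_faceFinset.2 hσ)] at hsum
  have hpos : (0 : ℝ) < σ.card := by
    have := Finset.card_pos.2 (nonempty_of_mem hσ)
    positivity
  have h3 := Finset.sum_nonneg fun τ hτ => hnonneg τ (Finset.mem_of_mem_erase hτ)
    (Finset.ne_of_mem_erase hτ)
  simp only [hvσ, if_true] at hsum
  have h4 : x' σ / σ.card ≤ x σ / σ.card := by linarith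
  exact (div_le_div_iff_of_pos_right hpos).1 h4

lemma baryMap_injOn : Set.InjOn K.baryMap K.sd.realization := by
  intro x hx x' hx' h
  have hzero : ∀ {x}, x ∈ K.sd.realization → ∀ σ, σ ∉ K.faces → x σ = 0 := by
    rintro x ⟨-, C, hC, h1, -⟩ σ hσ
    exact h1 σ fun h => hσ (hC.2.1 σ h)
  obtain ⟨B, hB⟩ : ∃ B : ℕ, ∀ σ ∈ K.faces, σ.card ≤ B :=
    ⟨K.faceFinset.sup Finset.card, fun σ hσ => Finset.le_sup (f := Finset.card) (mem_faceFinset.2 hσ)⟩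
  have key : ∀ n : ℕ, ∀ σ : Finset V, B < σ.card + n → x σ = x' σ := by
    intro n
    induction n with
    | zero =>
      intro σ hσ
      have : σ ∉ K.faces := fun h => by have := hB σ h; omega
      rw [hzero hx σ this, hzero hx' σ this]
    | succ n ih =>
      intro σ hσ
      by_cases hf : σ ∈ K.faces
      · have hbig : ∀ τ : Finset V, σ.card < τ.card → x τ = x' τ := fun τ hτ => ih τ (by omega)
        exact (baryMap_coord_le hx' hx h.symm hf fun τ hτ => (hbig τ hτ).symm).antisymm
          (baryMap_coord_le hx hx' h hf hbig)
      · rw [hzero hx σ hf, hzero hx' σ hf]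
  ext σ
  exact key (B + 1) σ (by omega)

open Classical in
lemma exists_chain_coords : ∀ (n : ℕ) (s : Finset V) (y : V → ℝ), s.card = n → (∀ v ∈ s, 0 < y v) →
    (∀ v, v ∉ s → y v = 0) → ∃ (C : Finset (Finset V)) (x : Finset V → ℝ),
      (∀ σ ∈ C, σ ⊆ s ∧ σ.Nonempty) ∧ (∀ σ ∈ C, ∀ τ ∈ C, σ ⊆ τ ∨ τ ⊆ σ) ∧ (∀ σ, 0 ≤ x σ) ∧
      (∀ σ, σ ∉ C → x σ = 0) ∧ ∀ v, ∑ σ ∈ C, (if v ∈ σ then x σ / σ.card else 0) = y v := by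
  intro n
  induction n using Nat.strong_induction_on with
  | _ n ih =>
    intro s y hn hpos hzero
    rcases s.eq_empty_or_nonempty with rfl | hs
    · exact ⟨∅, fun _ => 0, by simp, by simp, by simp, by simp, fun v => by simp [hzero v]⟩
    · obtain ⟨w, hw, hmin⟩ := s.exists_min_image y hs
      set s' := {v ∈ s | y w < y v} with hs'
      have hsub : s' ⊂ s := (Finset.filter_subset _ _).ssubset_of_ne fun h => by
        have hw' := hw
        rw [← h] at hw'
        simp at hw'
      obtain ⟨C, x, hC1, hC2, hx0, hx1, hx2⟩ := ih s'.card (hn ▸ Finset.card_lt_card hsub) s'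
        (fun v => if v ∈ s then y v - y w else 0) rfl (fun v hv => by
          rw [hs', Finset.mem_filter] at hv
          simp [hv.1, hv.2]) (fun v hv => by
          by_cases hvs : v ∈ s
          · rw [hs', Finset.mem_filter] at hv
            have h1 := hmin v hvs
            have h2 : y v ≤ y w := not_lt.1 fun h => hv ⟨hvs, h⟩
            simp [hvs, le_antisymm h1 h2]
          · simp [hvs])
      have hsC : s ∉ C := fun h => hsub.2 (hC1 s h).1
      have hcard : (0 : ℝ) < s.card := by
        have := Finset.card_pos.2 hs
        positivity
      refine ⟨insert s C, Function.update x s (y w * s.card), ?_, ?_, ?_, ?_, ?_⟩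
      · intro σ hσ
        rcases Finset.mem_insert.1 hσ with rfl | hσ
        exacts [⟨subset_rfl, hs⟩, ⟨(hC1 σ hσ).1.trans hsub.1, (hC1 σ hσ).2⟩]
      · intro σ hσ τ hτ
        rcases Finset.mem_insert.1 hσ with h | h <;> rcases Finset.mem_insert.1 hτ with h' | h'
        · exact Or.inl (h.trans h'.symm).subset
        · exact Or.inr (h ▸ (hC1 τ h').1.trans hsub.1)
        · exact Or.inl (h' ▸ (hC1 σ h).1.trans hsub.1)
        · exact hC2 σ h τ h'
      · intro σ
        by_cases h : σ = s
        · subst h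
          simpa using mul_nonneg (hpos w hw).le hcard.le
        · simpa [h] using hx0 σ
      · intro σ hσ
        rw [Finset.mem_insert, not_or] at hσ
        simpa [hσ.1] using hx1 σ hσ.2
      · intro v
        rw [Finset.sum_insert hsC, Function.update_self]
        have hrest : ∑ σ ∈ C, (if v ∈ σ then Function.update x s (y w * s.card) σ / σ.card else 0) =
            if v ∈ s then y v - y w else 0 := by
          rw [← hx2 v]
          refine Finset.sum_congr rfl fun σ hσ => ?_
          rw [Function.update_of_ne (by rintro rfl; exact hsC hσ)]
        rw [hrest]
        by_cases hv : v ∈ s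
        · simp only [hv, if_true]
          field_simp
          ring
        · simp [hv, hzero v hv]

lemma baryMap_surjOn : Set.SurjOn K.baryMap K.sd.realization K.realization := by
  classical
  rintro y ⟨h0, σ, hσ, h1, h2⟩
  set s := {v ∈ σ | 0 < y v} with hs
  have hzero : ∀ v, v ∉ s → y v = 0 := by
    intro v hv
    by_cases hvσ : v ∈ σ
    · refine le_antisymm (not_lt.1 fun h => hv ?_) (h0 v)
      rw [hs, Finset.mem_filter]
      exact ⟨hvσ, h⟩
    · exact h1 v hvσ
  obtain ⟨C, x, hC1, hC2, hx0, hx1, hx2⟩ := exists_chain_coords _ s y rfl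
    (fun v hv => (Finset.mem_filter.1 hv).2) hzero
  have hCf : ∀ τ ∈ C, τ ∈ K.faces := fun τ hτ =>
    mem_of_subset hσ ((hC1 τ hτ).1.trans (Finset.filter_subset _ _)) (hC1 τ hτ).2
  have hsum : ∑ τ ∈ C, x τ = 1 := by
    rw [← sum_bary (m := σ) fun τ hτ =>
      ⟨(hC1 τ hτ).1.trans (Finset.filter_subset _ _), (hC1 τ hτ).2⟩, ← h2]
    exact Finset.sum_congr rfl fun v _ => hx2 v
  refine ⟨x, ⟨hx0, C, ⟨?_, hCf, hC2⟩, hx1, hsum⟩, ?_⟩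
  · rw [Finset.nonempty_iff_ne_empty]
    rintro rfl
    simp at hsum
  · ext v
    rw [baryMap_eq hCf hx1, hx2]

lemma nonempty_homeomorph_sd (K : FinComplex V) : Nonempty (K.sd.realization ≃ₜ K.realization) := by
  refine nonempty_homeomorph_of_bijective (f := fun x => ⟨K.baryMap x.1, baryMap_mem x.2⟩)
    (Continuous.subtype_mk (K.continuous_baryMap.comp continuous_subtype_val) _) ⟨?_, ?_⟩
  · intro x x' h
    exact Subtype.ext (baryMap_injOn x.2 x'.2 (congrArg Subtype.val h))
  · intro y
    obtain ⟨x, hx, h⟩ := baryMap_surjOn y.2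
    exact ⟨⟨x, hx⟩, Subtype.ext h⟩

end Realization

section Push

variable {V W : Type*} [Fintype V] [DecidableEq W] {K : FinComplex V} {K' : FinComplex W}

/-- The affine map of coordinates induced by a map of vertices. -/
def push (q : V → W) (x : V → ℝ) (w : W) : ℝ := ∑ v, if q v = w then x v else 0

lemma continuous_push (q : V → W) : Continuous (push q) := by
  refine continuous_pi fun w => continuous_finsetSum _ fun v _ => ?_
  by_cases h : q v = w
  · simp only [h, if_true]
    exact continuous_apply v
  · simp only [h, if_false]
    exact continuous_const

lemma push_apply {q : V → W} {x : V → ℝ} {σ : Finset V} (hx : ∀ v, v ∉ σ → x v = 0)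
    (hq : Set.InjOn q σ) {v : V} (hv : v ∈ σ) : push q x (q v) = x v := by
  rw [push, Finset.sum_eq_single v]
  · simp
  · intro w _ hwv
    by_cases hw : w ∈ σ
    · exact if_neg fun h => hwv (hq hw hv h)
    · simp [hx w hw]
  · simp

lemma push_eq_zero {q : V → W} {x : V → ℝ} {σ : Finset V} (hx : ∀ v, v ∉ σ → x v = 0) {w : W}
    (hw : ∀ v ∈ σ, q v ≠ w) : push q x w = 0 := by
  refine Finset.sum_eq_zero fun v _ => ?_
  by_cases hv : v ∈ σ
  · exact if_neg (hw v hv)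
  · simp [hx v hv]

lemma push_mem {q : V → W} (hq : ∀ σ ∈ K.faces, σ.image q ∈ K'.faces) {x : V → ℝ}
    (hx : x ∈ K.realization) : push q x ∈ K'.realization := by
  obtain ⟨h0, σ, hσ, h1, h2⟩ := hx
  refine ⟨fun w => Finset.sum_nonneg fun v _ => ?_, _, hq σ hσ, fun w hw => ?_, ?_⟩
  · split_ifs
    exacts [h0 v, le_rfl]
  · exact push_eq_zero h1 fun v hv h => hw (h ▸ Finset.mem_image_of_mem q hv)
  · have : ∀ w, push q x w = ∑ v ∈ σ, if q v = w then x v else 0 := by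
      intro w
      refine (Finset.sum_subset (Finset.subset_univ σ) fun v _ hv => ?_).symm
      simp [h1 v hv]
    simp only [this]
    rw [Finset.sum_comm, ← h2]
    refine Finset.sum_congr rfl fun v hv => ?_
    rw [Finset.sum_eq_single (q v) (fun w _ h => if_neg h.symm)
      (fun h => (h (Finset.mem_image_of_mem q hv)).elim), if_pos rfl]

lemma exists_push_eq {q : V → W} (hq : ∀ τ ∈ K'.faces, ∃ σ ∈ K.faces, σ.image q = τ ∧ Set.InjOn q σ)
    {y : W → ℝ} (hy : y ∈ K'.realization) : ∃ x ∈ K.realization, push q x = y := by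
  classical
  obtain ⟨h0, τ, hτ, h1, h2⟩ := hy
  obtain ⟨σ, hσ, rfl, hinj⟩ := hq τ hτ
  have hx1 : ∀ v, v ∉ σ → (fun v => if v ∈ σ then y (q v) else 0) v = 0 := fun v hv => if_neg hv
  refine ⟨fun v => if v ∈ σ then y (q v) else 0, ⟨fun v => ?_, σ, hσ, hx1, ?_⟩, ?_⟩
  · dsimp only
    split_ifs
    exacts [h0 _, le_rfl]
  · rw [← h2, Finset.sum_image hinj]
    exact Finset.sum_congr rfl fun v hv => if_pos hv
  · ext w
    by_cases hw : w ∈ σ.image q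
    · obtain ⟨v, hv, rfl⟩ := Finset.mem_image.1 hw
      rw [push_apply hx1 hinj hv]
      exact if_pos hv
    · rw [h1 w hw]
      exact push_eq_zero hx1 fun v hv h => hw (h ▸ Finset.mem_image_of_mem q hv)

end Push

lemma nonempty_homeomorph_map {V : Type*} {W : Type u} [Fintype V] (g : V ↪ W) (K : FinComplex V) :
    Nonempty (K.realization ≃ₜ (K.map g).realization) := by
  classical
  have hm : ∀ σ ∈ K.faces, σ.image g ∈ (K.map g).faces := fun σ hσ =>
    ⟨σ, hσ, (Finset.map_eq_image g σ).symm⟩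
  refine nonempty_homeomorph_of_bijective (f := fun x => ⟨push g x.1, push_mem hm x.2⟩)
    (Continuous.subtype_mk ((continuous_push g).comp continuous_subtype_val) _) ⟨?_, ?_⟩
  · intro x x' h
    refine Subtype.ext (funext fun v => ?_)
    have h1 := congrFun (congrArg Subtype.val h) (g v)
    dsimp only at h1
    have key : ∀ x : V → ℝ, push g x (g v) = x v := fun x =>
      push_apply (σ := Finset.univ) (by simp) g.injective.injOn (Finset.mem_univ v)
    rwa [key, key] at h1
  · rintro ⟨y, hy⟩
    obtain ⟨x, hx, h⟩ := exists_push_eq (K := K) (q := g) (by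
      rintro _ ⟨σ, hσ, rfl⟩
      exact ⟨σ, hσ, (Finset.map_eq_image g σ).symm, g.injective.injOn⟩) hy
    exact ⟨⟨x, hx⟩, Subtype.ext h⟩

end FinComplex

/-! ### The triangulated disc is a triangle -/

/-- Positions of the vertices of the disc in a triangle, in barycentric coordinates multiplied
by `75`. -/
def discPos : Fin 23 → Fin 3 → ℤ := ![
  ![53, 8, 14], ![43, 15, 17], ![51, 20, 4], ![64, 5, 6], ![33, 23, 19], ![41, 28, 6],
  ![26, 41, 8], ![25, 50, 0], ![75, 0, 0], ![0, 75, 0], ![15, 36, 24], ![20, 23, 32],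
  ![24, 33, 18], ![25, 0, 50], ![0, 0, 75], ![9, 44, 22], ![8, 24, 43], ![4, 50, 21],
  ![4, 26, 45], ![0, 25, 50], ![50, 0, 25], ![0, 50, 25], ![50, 25, 0]]

/-- Heights that show that the triangulation is regular. -/
def discHeight : Fin 23 → ℤ := ![
  0, 0, 0, 1, 2, 4, 12, 18, 3, 40, 17, 12, 8, 17, 50, 25, 28, 32, 35, 44, 2, 40, 6]

/-- The neighbour of a triangle opposite to a vertex; the sides of the big triangle have the numbers
`35`, `36` and `37`. -/
def discNeighbor : Fin 35 → Fin 3 → Fin 38 := ![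
  ![3, 1, 2], ![5, 4, 0], ![6, 0, 4], ![0, 7, 5], ![8, 2, 1], ![1, 3, 9], ![2, 8, 10],
  ![11, 12, 3], ![4, 36, 6], ![36, 5, 13], ![14, 6, 37], ![7, 14, 15], ![15, 16, 7],
  ![18, 9, 17], ![10, 37, 11], ![12, 11, 19], ![20, 17, 12], ![21, 13, 16], ![13, 22, 36],
  ![15, 37, 20], ![16, 19, 23], ![17, 23, 24], ![24, 25, 18], ![21, 20, 26], ![22, 21, 27],
  ![29, 28, 22], ![27, 23, 30], ![31, 24, 26], ![32, 35, 25], ![25, 31, 33], ![31, 26, 34],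
  ![27, 30, 29], ![33, 35, 28], ![32, 29, 34], ![33, 30, 35]]

/-- The cross product of the positions of the two vertices opposite to the vertex `j`. -/
def discCross (k : Fin 35) (j i : Fin 3) : ℤ :=
  discPos (discTriangle k (j + 1)) (i + 1) * discPos (discTriangle k (j + 2)) (i + 2) -
    discPos (discTriangle k (j + 1)) (i + 2) * discPos (discTriangle k (j + 2)) (i + 1)

/-- The dot product. -/
def dotInt (u v : Fin 3 → ℤ) : ℤ := u 0 * v 0 + u 1 * v 1 + u 2 * v 2

/-- The area of a triangle of the disc. -/
def discDet (k : Fin 35) : ℤ := dotInt (discCross k 0) (discPos (discTriangle k 0))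

/-- The linear function that interpolates the heights on a triangle, multiplied by the area. -/
def discSupport (k : Fin 35) (i : Fin 3) : ℤ :=
  discHeight (discTriangle k 0) * discCross k 0 i + discHeight (discTriangle k 1) * discCross k 1 i +
    discHeight (discTriangle k 2) * discCross k 2 i

/-- A linear function that vanishes on the edge opposite to the vertex `j`. -/
def discWall (k : Fin 35) (j i : Fin 3) : ℤ :=
  if h : (discNeighbor k j : ℕ) < 35 then
    discDet ⟨discNeighbor k j, h⟩ * discSupport k i - discDet k * discSupport ⟨discNeighbor k j, h⟩ i
  else if (discNeighbor k j : ℕ) = 35 + i then 1 else 0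

lemma discDet_pos : ∀ k, 0 < discDet k := by decide +kernel

lemma discSupport_lt : ∀ k v, (∀ j, discTriangle k j ≠ v) →
    dotInt (discSupport k) (discPos v) < discDet k * discHeight v := by
  decide +kernel

lemma discSupport_eq : ∀ k j, dotInt (discSupport k) (discPos (discTriangle k j)) =
    discDet k * discHeight (discTriangle k j) := by
  decide +kernel

lemma discWall_pos : ∀ k j, 0 < dotInt (discWall k j) (discPos (discTriangle k j)) := by
  decide +kernel

lemma discWall_parallel : ∀ k j i, discWall k j i * discDet k =
    discCross k j i * dotInt (discWall k j) (discPos (discTriangle k j)) := by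
  decide +kernel

lemma discCross_dot : ∀ k j j', dotInt (discCross k j) (discPos (discTriangle k j')) =
    if j = j' then discDet k else 0 := by
  decide +kernel

lemma discCross_sum : ∀ k i, 75 * (discCross k 0 i + discCross k 1 i + discCross k 2 i) =
    discDet k := by
  decide +kernel

lemma discCross_pos : ∀ k i i', discCross k 0 i * discPos (discTriangle k 0) i' +
    discCross k 1 i * discPos (discTriangle k 1) i' + discCross k 2 i * discPos (discTriangle k 2) i' =
      if i = i' then discDet k else 0 := by
  decide +kernel

lemma discPos_spec : ∀ v, (∀ i, 0 ≤ discPos v i) ∧ discPos v 0 + discPos v 1 + discPos v 2 = 75 := by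
  decide +kernel

/-- The triangulated disc. -/
def discComplex : FinComplex (Fin 23) where
  faces := {σ | σ.Nonempty ∧ ∃ k, σ ⊆ Finset.univ.image (discTriangle k)}
  isRelLowerSet_faces := fun _ h => ⟨h.1, fun _ hs h' =>
    ⟨h', h.2.imp fun _ hk => hs.trans hk⟩⟩
  finite := Set.toFinite _

/-- The dot product of an integer vector with a real vector. -/
def dotReal (u : Fin 3 → ℤ) (z : Fin 3 → ℝ) : ℝ := u 0 * z 0 + u 1 * z 1 + u 2 * z 2

/-- The affine map of the realization of the disc to the plane (multiplied by `75`). -/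
def discMap (x : Fin 23 → ℝ) (i : Fin 3) : ℝ := ∑ v, x v * discPos v i

lemma dotReal_discMap (u : Fin 3 → ℤ) (x : Fin 23 → ℝ) :
    dotReal u (discMap x) = ∑ v, x v * (dotInt u (discPos v) : ℤ) := by
  simp only [dotReal, discMap, dotInt, Finset.mul_sum, ← Finset.sum_add_distrib]
  refine Finset.sum_congr rfl fun v _ => ?_
  push_cast
  ring

lemma exists_discTriangle {x : Fin 23 → ℝ} (hx : x ∈ discComplex.realization) :
    (∑ v, x v = 1) ∧ ∃ k, ∀ v, (∀ j, discTriangle k j ≠ v) → x v = 0 := by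
  obtain ⟨-, σ, ⟨-, k, hk⟩, h1, h2⟩ := hx
  refine ⟨?_, k, fun v hv => h1 v fun h => ?_⟩
  · rw [← h2]
    exact (Finset.sum_subset (Finset.subset_univ σ) fun v _ hv => h1 v hv).symm
  · obtain ⟨j, -, hj⟩ := Finset.mem_image.1 (hk h)
    exact hv j hj

lemma discSupport_le (k : Fin 35) (v : Fin 23) :
    dotInt (discSupport k) (discPos v) ≤ discDet k * discHeight v := by
  by_cases h : ∀ j, discTriangle k j ≠ v
  · exact (discSupport_lt k v h).le
  · push Not at h
    obtain ⟨j, rfl⟩ := h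
    exact (discSupport_eq k j).le

lemma dotReal_support_of_mem {x : Fin 23 → ℝ} {k : Fin 35}
    (hk : ∀ v, (∀ j, discTriangle k j ≠ v) → x v = 0) :
    dotReal (discSupport k) (discMap x) = discDet k * ∑ v, x v * discHeight v := by
  rw [dotReal_discMap, Finset.mul_sum]
  refine Finset.sum_congr rfl fun v _ => ?_
  by_cases h : ∀ j, discTriangle k j ≠ v
  · simp [hk v h]
  · push Not at h
    obtain ⟨j, rfl⟩ := h
    rw [discSupport_eq]
    push_cast
    ring

lemma dotReal_support_le {x : Fin 23 → ℝ} (h0 : ∀ v, 0 ≤ x v) (k : Fin 35) :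
    dotReal (discSupport k) (discMap x) ≤ discDet k * ∑ v, x v * discHeight v := by
  rw [dotReal_discMap, Finset.mul_sum]
  refine Finset.sum_le_sum fun v _ => ?_
  have h : ((dotInt (discSupport k) (discPos v) : ℤ) : ℝ) ≤ discDet k * discHeight v := by
    exact_mod_cast discSupport_le k v
  calc x v * _ ≤ x v * (discDet k * discHeight v) := mul_le_mul_of_nonneg_left h (h0 v)
    _ = _ := by ring

lemma dotReal_cross {x : Fin 23 → ℝ} {k : Fin 35}
    (hk : ∀ v, (∀ j, discTriangle k j ≠ v) → x v = 0) (j : Fin 3) :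
    dotReal (discCross k j) (discMap x) = discDet k * x (discTriangle k j) := by
  rw [dotReal_discMap, Finset.sum_eq_single (discTriangle k j)]
  · rw [discCross_dot, if_pos rfl, mul_comm]
  · intro v _ hv
    by_cases h : ∀ j, discTriangle k j ≠ v
    · simp [hk v h]
    · push Not at h
      obtain ⟨j', rfl⟩ := h
      rw [discCross_dot, if_neg (by rintro rfl; exact hv rfl)]
      simp
  · simp

lemma discMap_injOn : Set.InjOn discMap discComplex.realization := by
  intro x hx x' hx' h
  obtain ⟨-, k, hk⟩ := exists_discTriangle hx
  obtain ⟨-, k', hk'⟩ := exists_discTriangle hx'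
  have hdet : ∀ k, (0 : ℝ) < discDet k := fun k => by exact_mod_cast discDet_pos k
  have e1 := dotReal_support_of_mem hk
  have e2 := dotReal_support_of_mem hk'
  have e3 := dotReal_support_le hx'.1 k
  have e4 := dotReal_support_le hx.1 k'
  rw [h] at e1 e4
  have e5 := le_of_mul_le_mul_left (e1.symm.trans_le e3) (hdet k)
  have e6 := le_of_mul_le_mul_left (e2.symm.trans_le e4) (hdet k')
  have e7 := le_antisymm e5 e6
  -- the second point lies in the first triangle
  have hk2 : ∀ v, (∀ j, discTriangle k j ≠ v) → x' v = 0 := by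
    have hsum : ∑ v, x' v * (discDet k * discHeight v - (dotInt (discSupport k) (discPos v) : ℤ)) = 0 := by
      simp only [mul_sub, Finset.sum_sub_distrib]
      rw [← dotReal_discMap, e1, e7, Finset.mul_sum, ← Finset.sum_sub_distrib]
      exact Finset.sum_eq_zero fun v _ => by ring
    have hnn : ∀ v ∈ Finset.univ, 0 ≤ x' v *
        ((discDet k : ℝ) * discHeight v - (dotInt (discSupport k) (discPos v) : ℤ)) := fun v _ =>
      mul_nonneg (hx'.1 v) (sub_nonneg.2 (by exact_mod_cast discSupport_le k v))
    intro v hv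
    have h0 := (Finset.sum_eq_zero_iff_of_nonneg hnn).1 hsum v (Finset.mem_univ v)
    rcases mul_eq_zero.1 h0 with h0 | h0
    · exact h0
    · have : ((dotInt (discSupport k) (discPos v) : ℤ) : ℝ) < discDet k * discHeight v := by
        exact_mod_cast discSupport_lt k v hv
      linarith
  ext v
  by_cases hv : ∀ j, discTriangle k j ≠ v
  · rw [hk v hv, hk2 v hv]
  · push Not at hv
    obtain ⟨j, rfl⟩ := hv
    have e8 := dotReal_cross hk j
    have e9 := dotReal_cross hk2 j
    rw [h, e9] at e8
    exact (mul_left_cancel₀ (hdet k).ne' e8).symm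

lemma discMap_surjOn {z : Fin 3 → ℝ} (hz0 : ∀ i, 0 ≤ z i) (hz : z 0 + z 1 + z 2 = 75) :
    ∃ x ∈ discComplex.realization, discMap x = z := by
  classical
  have hdet : ∀ k, (0 : ℝ) < discDet k := fun k => by exact_mod_cast discDet_pos k
  obtain ⟨k, -, hk⟩ := Finset.univ.exists_max_image
    (fun k : Fin 35 => dotReal (discSupport k) z / discDet k) Finset.univ_nonempty
  have hcoord : ∀ j, 0 ≤ dotReal (discCross k j) z := by
    intro j
    have hw : 0 ≤ dotReal (discWall k j) z := by
      by_cases h : (discNeighbor k j : ℕ) < 35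
      · have h1 := hk ⟨discNeighbor k j, h⟩ (Finset.mem_univ _)
        rw [div_le_div_iff₀ (hdet _) (hdet _)] at h1
        have : dotReal (discWall k j) z = dotReal (discSupport k) z * discDet ⟨discNeighbor k j, h⟩ -
            dotReal (discSupport ⟨discNeighbor k j, h⟩) z * discDet k := by
          simp only [dotReal, discWall, h, dif_pos]
          push_cast
          ring
        linarith
      · have : ∀ i, (0 : ℝ) ≤ discWall k j i := by
          intro i
          simp only [discWall, h, dif_neg, not_false_iff]
          split_ifs <;> norm_num
        have h0 := mul_nonneg (this 0) (hz0 0)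
        have h1 := mul_nonneg (this 1) (hz0 1)
        have h2 := mul_nonneg (this 2) (hz0 2)
        unfold dotReal
        linarith
    have hs : (0 : ℝ) < (dotInt (discWall k j) (discPos (discTriangle k j)) : ℤ) := by
      exact_mod_cast discWall_pos k j
    have hpar : ∀ i, (discWall k j i : ℝ) * discDet k =
        discCross k j i * (dotInt (discWall k j) (discPos (discTriangle k j)) : ℤ) := fun i => by
      exact_mod_cast discWall_parallel k j i
    have h1 : dotReal (discWall k j) z * discDet k =
        dotReal (discCross k j) z * (dotInt (discWall k j) (discPos (discTriangle k j)) : ℤ) := by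
      have h0 := hpar 0
      have h1 := hpar 1
      have h2 := hpar 2
      unfold dotReal
      linear_combination z 0 * h0 + z 1 * h1 + z 2 * h2
    have h2 := mul_nonneg hw (hdet k).le
    rw [h1] at h2
    exact nonneg_of_mul_nonneg_left h2 hs
  set c : Fin 3 → ℝ := fun j => dotReal (discCross k j) z / discDet k with hc
  have hc0 : ∀ j, 0 ≤ c j := fun j => div_nonneg (hcoord j) (hdet k).le
  have hsum : ∀ g : Fin 23 → ℝ, ∑ v, (∑ j, if discTriangle k j = v then c j else 0) * g v =
      ∑ j, c j * g (discTriangle k j) := by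
    intro g
    simp only [Finset.sum_mul]
    rw [Finset.sum_comm]
    refine Finset.sum_congr rfl fun j _ => ?_
    simp only [ite_mul, zero_mul]
    rw [Finset.sum_ite_eq, if_pos (Finset.mem_univ _)]
  have hoff : ∀ v, v ∉ Finset.univ.image (discTriangle k) →
      (∑ j, if discTriangle k j = v then c j else 0) = 0 := by
    intro v hv
    refine Finset.sum_eq_zero fun j _ => if_neg fun h => hv ?_
    exact Finset.mem_image.2 ⟨j, Finset.mem_univ j, h⟩
  refine ⟨fun v => ∑ j, if discTriangle k j = v then c j else 0, ⟨fun v => ?_,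
    Finset.univ.image (discTriangle k), ⟨by simp, k, subset_rfl⟩, hoff, ?_⟩, ?_⟩
  · refine Finset.sum_nonneg fun j _ => ?_
    split_ifs
    exacts [hc0 j, le_rfl]
  · rw [Finset.sum_subset (Finset.subset_univ _) fun v _ hv => hoff v hv]
    have h := hsum fun _ => 1
    simp only [mul_one] at h
    rw [h, Fin.sum_univ_three, hc]
    dsimp only
    rw [← add_div, ← add_div, div_eq_one_iff_eq (hdet k).ne']
    have hs : ∀ i, 75 * ((discCross k 0 i : ℝ) + discCross k 1 i + discCross k 2 i) = discDet k :=
      fun i => by exact_mod_cast discCross_sum k i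
    have h0 := hs 0
    have h1 := hs 1
    have h2 := hs 2
    unfold dotReal
    linear_combination (z 0 * h0 + z 1 * h1 + z 2 * h2) / 75 + discDet k * hz / 75
  · ext i
    have h := hsum fun v => discPos v i
    rw [discMap, h, Fin.sum_univ_three, hc]
    dsimp only
    have hp : ∀ i', ((discCross k 0 i' : ℝ) * discPos (discTriangle k 0) i +
        discCross k 1 i' * discPos (discTriangle k 1) i +
        discCross k 2 i' * discPos (discTriangle k 2) i) = if i' = i then (discDet k : ℝ) else 0 :=
      fun i' => by
        have := discCross_pos k i' i
        split_ifs at this ⊢ <;> exact_mod_cast this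
    have h0 := hp 0
    have h1 := hp 1
    have h2 := hp 2
    have hd := (hdet k).ne'
    have : (z 0 * (if (0 : Fin 3) = i then (discDet k : ℝ) else 0) +
        z 1 * (if (1 : Fin 3) = i then (discDet k : ℝ) else 0) +
        z 2 * (if (2 : Fin 3) = i then (discDet k : ℝ) else 0)) = discDet k * z i := by
      fin_cases i <;> simp [mul_comm]
    field_simp
    unfold dotReal
    linear_combination z 0 * h0 + z 1 * h1 + z 2 * h2 + this

/-- The realization of the disc is a triangle. -/
def discToSimplex (x : discComplex.realization) : stdSimplex ℝ (Fin 3) :=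
  ⟨fun i => discMap x.1 i / 75, fun i => div_nonneg (Finset.sum_nonneg fun v _ =>
      mul_nonneg (x.2.1 v) (by exact_mod_cast (discPos_spec v).1 i)) (by norm_num), by
    rw [← Finset.sum_div, div_eq_one_iff_eq (by norm_num), Fin.sum_univ_three, discMap, discMap,
      discMap, ← Finset.sum_add_distrib, ← Finset.sum_add_distrib]
    have h : ∀ v, x.1 v * (discPos v 0 : ℝ) + x.1 v * discPos v 1 + x.1 v * discPos v 2 = 75 * x.1 v := by
      intro v
      have : (discPos v 0 : ℝ) + discPos v 1 + discPos v 2 = 75 := by exact_mod_cast (discPos_spec v).2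
      linear_combination x.1 v * this
    simp only [h]
    rw [← Finset.mul_sum, (exists_discTriangle x.2).1, mul_one]⟩

lemma continuous_discToSimplex : Continuous discToSimplex := by
  refine Continuous.subtype_mk (continuous_pi fun i => Continuous.div_const ?_ _) _
  refine continuous_finsetSum _ fun v _ => Continuous.mul ?_ continuous_const
  exact (continuous_apply v).comp continuous_subtype_val

lemma discToSimplex_bijective : Function.Bijective discToSimplex := by
  constructor
  · intro x x' h
    refine Subtype.ext (discMap_injOn x.2 x'.2 (funext fun i => ?_))
    have h1 : discMap x.1 i / 75 = discMap x'.1 i / 75 := congrFun (congrArg Subtype.val h) i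
    linarith
  · intro z
    have hz : z.1 0 + z.1 1 + z.1 2 = 1 := by
      have := z.2.2
      rwa [Fin.sum_univ_three] at this
    obtain ⟨x, hx, h⟩ := discMap_surjOn (z := fun i => 75 * z.1 i)
      (fun i => mul_nonneg (by norm_num) (z.2.1 i)) (by linarith)
    refine ⟨⟨x, hx⟩, Subtype.ext (funext fun i => ?_)⟩
    show discMap x i / 75 = z.1 i
    rw [h]
    ring

/-! ### The quotient of the disc is the dunce hat -/

/-- The vertices on the three sides of the disc. -/
def discSide : Fin 3 → Fin 4 → Fin 23 := ![![8, 22, 7, 9], ![9, 21, 19, 14], ![8, 20, 13, 14]]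

/-- The vertices of the singular loop of the dunce hat. -/
def hatLoop : Fin 4 → Fin 17 := ![2, 16, 4, 2]

lemma foldVertex_discSide : ∀ k j, foldVertex (discSide k j) = hatLoop j := by decide +kernel

lemma foldVertex_interior : ∀ v v', (∀ k j, discSide k j ≠ v) → foldVertex v = foldVertex v' →
    v = v' := by
  decide +kernel

lemma foldVertex_link : ∀ k j, (∀ s l, discSide s l ≠ discTriangle k j) → ∀ k' j',
    discTriangle k' j' = discTriangle k j → ∀ i i',
    foldVertex (discTriangle k i) = foldVertex (discTriangle k' i') →
    discTriangle k i = discTriangle k' i' := by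
  decide +kernel

lemma exists_discSide_of_boundary : ∀ k, ∃ (s : Fin 3) (l : Fin 3), ∀ j,
    (∃ s' l', discSide s' l' = discTriangle k j) →
      discTriangle k j = discSide s l.castSucc ∨ discTriangle k j = discSide s l.succ := by
  decide +kernel

lemma discSide_edge : ∀ (s : Fin 3) (l : Fin 3), ∃ k, ∃ i j, discTriangle k i = discSide s l.castSucc ∧
    discTriangle k j = discSide s l.succ := by
  decide +kernel

lemma discSide_ne : ∀ (s : Fin 3) (l : Fin 3), discSide s l.castSucc ≠ discSide s l.succ := by
  decide +kernel

lemma foldVertex_injective_triangle : ∀ k i j, foldVertex (discTriangle k i) =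
    foldVertex (discTriangle k j) → i = j := by
  decide +kernel

lemma image_foldVertex : ∀ k, (Finset.univ.image (discTriangle k)).image foldVertex =
    hatTriangle k := by
  decide +kernel

lemma foldVertex_injOn {σ : Finset (Fin 23)} (hσ : σ ∈ discComplex.faces) :
    Set.InjOn foldVertex σ := by
  obtain ⟨-, k, hk⟩ := hσ
  intro v hv w hw h
  obtain ⟨i, -, rfl⟩ := Finset.mem_image.1 (hk hv)
  obtain ⟨j, -, rfl⟩ := Finset.mem_image.1 (hk hw)
  rw [foldVertex_injective_triangle k i j h]

lemma image_foldVertex_mem {σ : Finset (Fin 23)} (hσ : σ ∈ discComplex.faces) :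
    σ.image foldVertex ∈ hatComplex.faces := by
  obtain ⟨h, k, hk⟩ := hσ
  exact ⟨h.image _, k, image_foldVertex k ▸ Finset.image_subset_image hk⟩

lemma exists_image_foldVertex {τ : Finset (Fin 17)} (hτ : τ ∈ hatComplex.faces) :
    ∃ σ ∈ discComplex.faces, σ.image foldVertex = τ ∧ Set.InjOn foldVertex σ := by
  obtain ⟨h, k, hk⟩ := hτ
  rw [← image_foldVertex k] at hk
  obtain ⟨σ, hσ, rfl⟩ := Finset.subset_image_iff.1 hk
  have hσ' : σ ∈ discComplex.faces := ⟨by simpa using h, k, by exact_mod_cast hσ⟩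
  exact ⟨σ, hσ', rfl, foldVertex_injOn hσ'⟩

/-- The point with parameter `s` on an edge of a side of the disc. -/
def discSidePoint (k : Fin 3) (l : Fin 3) (s : ℝ) (v : Fin 23) : ℝ :=
  (if v = discSide k l.castSucc then 1 - s else 0) + if v = discSide k l.succ then s else 0

lemma discSidePoint_left (k l : Fin 3) (s : ℝ) :
    discSidePoint k l s (discSide k l.castSucc) = 1 - s := by
  simp [discSidePoint, discSide_ne k l]

lemma discSidePoint_right (k l : Fin 3) (s : ℝ) : discSidePoint k l s (discSide k l.succ) = s := by
  simp [discSidePoint, (discSide_ne k l).symm]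

lemma discSidePoint_mem (k l : Fin 3) {s : ℝ} (h0 : 0 ≤ s) (h1 : s ≤ 1) :
    discSidePoint k l s ∈ discComplex.realization := by
  refine ⟨fun v => ?_, {discSide k l.castSucc, discSide k l.succ}, ⟨by simp, ?_⟩, fun v hv => ?_, ?_⟩
  · refine add_nonneg ?_ ?_ <;> split_ifs <;> linarith
  · obtain ⟨t, i, j, hi, hj⟩ := discSide_edge k l
    refine ⟨t, ?_⟩
    intro v hv
    simp only [Finset.mem_insert, Finset.mem_singleton] at hv
    rcases hv with rfl | rfl
    · exact Finset.mem_image.2 ⟨i, Finset.mem_univ _, hi⟩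
    · exact Finset.mem_image.2 ⟨j, Finset.mem_univ _, hj⟩
  · simp only [Finset.mem_insert, Finset.mem_singleton, not_or] at hv
    simp [discSidePoint, hv.1, hv.2]
  · rw [Finset.sum_pair (discSide_ne k l), discSidePoint_left, discSidePoint_right]
    ring

lemma sum_discSidePoint (k l : Fin 3) (s : ℝ) (g : Fin 23 → ℝ) :
    ∑ v, discSidePoint k l s v * g v =
      (1 - s) * g (discSide k l.castSucc) + s * g (discSide k l.succ) := by
  simp only [discSidePoint, add_mul, ite_mul, zero_mul, Finset.sum_add_distrib]
  rw [Finset.sum_ite_eq', Finset.sum_ite_eq', if_pos (Finset.mem_univ _), if_pos (Finset.mem_univ _)]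

/-- The sides of the triangle, in the directions in which they are identified. -/
def simplexSide (k : Fin 3) (t : ℝ) : Fin 3 → ℝ :=
  (![![1 - t, t, 0], ![0, 1 - t, t], ![1 - t, 0, t]] : Fin 3 → Fin 3 → ℝ) k

lemma discPos_discSide : ∀ (k : Fin 3) (j : Fin 4) (i : Fin 3), discPos (discSide k j) i =
    25 * (![![3 - (j : ℤ), j, 0], ![0, 3 - (j : ℤ), j], ![3 - (j : ℤ), 0, j]] :
      Fin 3 → Fin 3 → ℤ) k i := by
  decide +kernel

lemma discMap_discSidePoint (k l : Fin 3) (s : ℝ) (i : Fin 3) :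
    discMap (discSidePoint k l s) i / 75 = simplexSide k ((l + s) / 3) i := by
  rw [discMap, sum_discSidePoint k l s fun v => discPos v i, discPos_discSide, discPos_discSide]
  fin_cases k <;> fin_cases i <;> simp [simplexSide] <;> ring

lemma push_discSidePoint (k l : Fin 3) (s : ℝ) (w : Fin 17) :
    FinComplex.push foldVertex (discSidePoint k l s) w =
      (if hatLoop l.castSucc = w then 1 - s else 0) + if hatLoop l.succ = w then s else 0 := by
  classical
  have h := sum_discSidePoint k l s fun v => if foldVertex v = w then 1 else 0
  simp only [mul_ite, mul_one, mul_zero, foldVertex_discSide] at h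
  rw [← h, FinComplex.push]

/-- A point whose support lies in the boundary of the disc. -/
lemma exists_discSidePoint {x : Fin 23 → ℝ} (hx : x ∈ discComplex.realization)
    (hb : ∀ v, x v ≠ 0 → ∃ k j, discSide k j = v) :
    ∃ k l, ∃ s, 0 ≤ s ∧ s ≤ 1 ∧ x = discSidePoint k l s := by
  obtain ⟨h1, t, ht⟩ := exists_discTriangle hx
  obtain ⟨k, l, hkl⟩ := exists_discSide_of_boundary t
  have hoff : ∀ v, v ≠ discSide k l.castSucc → v ≠ discSide k l.succ → x v = 0 := by
    intro v hv1 hv2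
    by_contra hne
    by_cases h : ∀ j, discTriangle t j ≠ v
    · exact hne (ht v h)
    · push Not at h
      obtain ⟨j, rfl⟩ := h
      rcases hkl j (hb _ hne) with h | h
      exacts [hv1 h, hv2 h]
  have hsum : x (discSide k l.castSucc) + x (discSide k l.succ) = 1 := by
    rw [← h1, ← Finset.sum_pair (discSide_ne k l)]
    refine Finset.sum_subset (Finset.subset_univ _) fun v _ hv => ?_
    simp only [Finset.mem_insert, Finset.mem_singleton, not_or] at hv
    exact hoff v hv.1 hv.2
  have h2 := hx.1 (discSide k l.castSucc)
  have h3 := hx.1 (discSide k l.succ)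
  refine ⟨k, l, x (discSide k l.succ), h3, by linarith, ?_⟩
  ext v
  by_cases hv1 : v = discSide k l.castSucc
  · rw [hv1, discSidePoint_left]
    linarith
  · by_cases hv2 : v = discSide k l.succ
    · rw [hv2, discSidePoint_right]
    · rw [hoff v hv1 hv2]
      simp [discSidePoint, hv1, hv2]

lemma simplexSide_mem (k : Fin 3) {t : ℝ} (h0 : 0 ≤ t) (h1 : t ≤ 1) :
    simplexSide k t ∈ stdSimplex ℝ (Fin 3) := by
  constructor
  · intro i
    fin_cases k <;> fin_cases i <;> simp [simplexSide] <;> linarith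
  · rw [Fin.sum_univ_three]
    fin_cases k <;> simp [simplexSide]

/-- The class of the points with parameter `t` on the sides. -/
def sideClass (t : ℝ) (h0 : 0 ≤ t) (h1 : t ≤ 1) : DunceHat :=
  Quot.mk _ ⟨simplexSide 0 t, simplexSide_mem 0 h0 h1⟩

lemma mk_simplexSide (k : Fin 3) {t : ℝ} (h0 : 0 ≤ t) (h1 : t ≤ 1) :
    (Quot.mk _ ⟨simplexSide k t, simplexSide_mem k h0 h1⟩ : DunceHat) = sideClass t h0 h1 := by
  fin_cases k
  · rfl
  · exact (Quot.sound ⟨t, rfl, Or.inl rfl⟩).symm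
  · exact (Quot.sound ⟨t, rfl, Or.inr rfl⟩).symm

lemma sideClass_zero_eq_one : sideClass 0 le_rfl zero_le_one = sideClass 1 zero_le_one le_rfl := by
  rw [← mk_simplexSide 1 le_rfl zero_le_one]
  refine congrArg _ (Subtype.ext ?_)
  ext i
  fin_cases i <;> simp [simplexSide]

lemma hatLoop_param {l l' : Fin 3} {s s' : ℝ}
    (h : ∀ w, ((if hatLoop l.castSucc = w then 1 - s else 0) + if hatLoop l.succ = w then s else 0) =
      (if hatLoop l'.castSucc = w then 1 - s' else 0) + if hatLoop l'.succ = w then s' else 0) :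
    ((l : ℝ) + s) / 3 = (l' + s') / 3 ∨ (((l : ℝ) + s) / 3 = 0 ∧ ((l' : ℝ) + s') / 3 = 1) ∨
      (((l : ℝ) + s) / 3 = 1 ∧ ((l' : ℝ) + s') / 3 = 0) := by
  have a := h 2
  have b := h 16
  have c := h 4
  fin_cases l <;> fin_cases l' <;> simp [hatLoop] at a b c ⊢ <;>
    first
      | (left; linarith)
      | (right; left; constructor <;> linarith)
      | (right; right; constructor <;> linarith)

/-- The two points of the disc with the same image in the dunce hat. -/
lemma eq_or_boundary {x x' : Fin 23 → ℝ} (hx : x ∈ discComplex.realization)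
    (hx' : x' ∈ discComplex.realization)
    (h : FinComplex.push foldVertex x = FinComplex.push foldVertex x') :
    x = x' ∨ ((∀ v, x v ≠ 0 → ∃ k j, discSide k j = v) ∧ ∀ v, x' v ≠ 0 → ∃ k j, discSide k j = v) := by
  classical
  have hval : ∀ {x}, x ∈ discComplex.realization → ∀ v, x v ≠ 0 →
      FinComplex.push foldVertex x (foldVertex v) = x v := by
    rintro x ⟨-, σ, hσ, h1, -⟩ v hv
    exact FinComplex.push_apply h1 (foldVertex_injOn hσ) (by_contra fun hn => hv (h1 v hn))
  have hpre : ∀ {x}, x ∈ discComplex.realization → ∀ w, FinComplex.push foldVertex x w ≠ 0 →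
      ∃ v, x v ≠ 0 ∧ foldVertex v = w := by
    intro x hx w hw
    rw [FinComplex.push] at hw
    obtain ⟨v, -, hv⟩ := Finset.exists_ne_zero_of_sum_ne_zero hw
    by_cases hvw : foldVertex v = w
    · exact ⟨v, by simpa [hvw] using hv, hvw⟩
    · simp [hvw] at hv
  have hsub : ∀ {x x'}, x ∈ discComplex.realization → x' ∈ discComplex.realization →
      FinComplex.push foldVertex x = FinComplex.push foldVertex x' → ∀ v, x v ≠ 0 →
      ∃ v', x' v' ≠ 0 ∧ foldVertex v' = foldVertex v := fun hx hx' h v hv =>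
    hpre hx' _ (by rw [← h, hval hx v hv]; exact hv)
  have htri : ∀ {x}, x ∈ discComplex.realization → ∃ k, ∀ v, x v ≠ 0 → ∃ j, discTriangle k j = v := by
    intro x hx
    obtain ⟨-, k, hk⟩ := exists_discTriangle hx
    refine ⟨k, fun v hv => ?_⟩
    by_contra hn
    push Not at hn
    exact hv (hk v hn)
  by_cases hint : ∃ v, x v ≠ 0 ∧ ∀ k j, discSide k j ≠ v
  · left
    obtain ⟨v, hv, hvi⟩ := hint
    obtain ⟨v', hv', hvv'⟩ := hsub hx hx' h v hv
    obtain rfl := foldVertex_interior v v' hvi hvv'.symm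
    obtain ⟨k, hk⟩ := htri hx
    obtain ⟨k', hk'⟩ := htri hx'
    obtain ⟨j, rfl⟩ := hk v hv
    obtain ⟨j', hj'⟩ := hk' _ hv'
    have hlink : ∀ p p', x p ≠ 0 → x' p' ≠ 0 → foldVertex p = foldVertex p' → p = p' := by
      intro p p' hp hp' hpp'
      obtain ⟨i, rfl⟩ := hk p hp
      obtain ⟨i', rfl⟩ := hk' p' hp'
      exact foldVertex_link k j hvi k' j' hj' i i' hpp'
    ext p
    by_cases hp : x p = 0
    · by_contra hne
      have hp' : x' p ≠ 0 := fun h0 => hne (hp.trans h0.symm)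
      obtain ⟨p', hp0, hpp'⟩ := hsub hx' hx h.symm p hp'
      obtain rfl := hlink p' p hp0 hp' hpp'
      exact hp0 hp
    · obtain ⟨p', hp0, hpp'⟩ := hsub hx hx' h p hp
      obtain rfl := hlink p p' hp hp0 hpp'.symm
      rw [← hval hx p hp, h, hval hx' p hp0]
  · right
    push Not at hint
    refine ⟨hint, fun v hv => ?_⟩
    by_contra hn
    push Not at hn
    obtain ⟨v', hv', hvv'⟩ := hsub hx' hx h.symm v hv
    obtain rfl := foldVertex_interior v v' hn hvv'.symm
    obtain ⟨k, j, hkj⟩ := hint v hv'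
    exact hn k j hkj

/-- The quotient map from the disc. -/
def discToHat (x : discComplex.realization) : hatComplex.realization :=
  ⟨FinComplex.push foldVertex x.1, FinComplex.push_mem (fun _ hσ => image_foldVertex_mem hσ) x.2⟩

lemma continuous_discToHat : Continuous discToHat :=
  Continuous.subtype_mk ((FinComplex.continuous_push _).comp continuous_subtype_val) _

lemma mk_discToSimplex_eq {x x' : discComplex.realization} (h : discToHat x = discToHat x') :
    (Quot.mk _ (discToSimplex x) : DunceHat) = Quot.mk _ (discToSimplex x') := by
  have h' : FinComplex.push foldVertex x.1 = FinComplex.push foldVertex x'.1 := congrArg Subtype.val h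
  rcases eq_or_boundary x.2 x'.2 h' with h | ⟨hb, hb'⟩
  · rw [Subtype.ext h]
  · obtain ⟨k, l, s, h0, h1, hs⟩ := exists_discSidePoint x.2 hb
    obtain ⟨k', l', s', h0', h1', hs'⟩ := exists_discSidePoint x'.2 hb'
    have hl : ∀ l : Fin 3, (0 : ℝ) ≤ l ∧ (l : ℝ) ≤ 2 := fun l => by
      refine ⟨Nat.cast_nonneg _, ?_⟩
      have : (l : ℕ) ≤ 2 := by omega
      exact_mod_cast this
    have key : ∀ (x : discComplex.realization) (k l : Fin 3) (s : ℝ) (h0 : 0 ≤ s) (h1 : s ≤ 1)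
        (ha : 0 ≤ (l + s) / 3) (hb : (l + s) / 3 ≤ 1), x.1 = discSidePoint k l s →
        (Quot.mk _ (discToSimplex x) : DunceHat) = sideClass ((l + s) / 3) ha hb := by
      intro x k l s h0 h1 ha hb hx
      rw [← mk_simplexSide k ha hb]
      refine congrArg _ (Subtype.ext (funext fun i => ?_))
      change _ = simplexSide k ((l + s) / 3) i
      rw [← discMap_discSidePoint, ← hx]
      rfl
    have hl1 := hl l
    have hl2 := hl l'
    rw [key x k l s h0 h1 (by linarith) (by linarith) hs,
      key x' k' l' s' h0' h1' (by linarith) (by linarith) hs']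
    have hp := hatLoop_param (l := l) (l' := l') (s := s) (s' := s') fun w => by
      rw [← push_discSidePoint k, ← push_discSidePoint k', ← hs, ← hs', h']
    rcases hp with hp | ⟨e1, e2⟩ | ⟨e1, e2⟩
    · simp only [hp]
    · simp only [e1, e2]
      exact sideClass_zero_eq_one
    · simp only [e1, e2]
      exact sideClass_zero_eq_one.symm

lemma exists_side_param {t : ℝ} (h0 : 0 ≤ t) (h1 : t ≤ 1) :
    ∃ l : Fin 3, ∃ s, 0 ≤ s ∧ s ≤ 1 ∧ t = (l + s) / 3 := by
  rcases le_total t (1 / 3) with h | h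
  · exact ⟨0, 3 * t, by linarith, by linarith, by simp⟩
  · rcases le_total t (2 / 3) with h' | h'
    · exact ⟨1, 3 * t - 1, by linarith, by linarith, by simp⟩
    · exact ⟨2, 3 * t - 2, by linarith, by linarith, by simp⟩

/-- The realization of the triangulated dunce hat is the dunce hat. -/
theorem hatComplex_isDunceHat : hatComplex.IsDunceHat := by
  have hF : Function.Bijective discToSimplex := discToSimplex_bijective
  obtain ⟨e, he⟩ : ∃ e : discComplex.realization ≃ₜ stdSimplex ℝ (Fin 3), ⇑e = discToSimplex :=
    ⟨Continuous.homeoOfEquivCompactToT2 (f := Equiv.ofBijective _ hF) continuous_discToSimplex, rfl⟩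
  have hresp : ∀ z z' : stdSimplex ℝ (Fin 3), dunceHatRel z z' →
      discToHat (e.symm z) = discToHat (e.symm z') := by
    rintro z z' ⟨t, hz, hz'⟩
    have h0 : 0 ≤ t := by
      have := z.2.1 1
      rw [hz] at this
      simpa using this
    have h1 : t ≤ 1 := by
      have := z.2.1 0
      rw [hz] at this
      simpa using this
    obtain ⟨l, s, hs0, hs1, hls⟩ := exists_side_param h0 h1
    have key : ∀ (z : stdSimplex ℝ (Fin 3)) (k : Fin 3), z.1 = simplexSide k t →
        (e.symm z).1 = discSidePoint k l s := by
      intro z k hz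
      have : z = e ⟨discSidePoint k l s, discSidePoint_mem k l hs0 hs1⟩ := by
        rw [he]
        refine Subtype.ext (funext fun i => ?_)
        rw [hz, hls, ← discMap_discSidePoint]
        rfl
      rw [this, e.symm_apply_apply]
    have e0 := key z 0 hz
    obtain ⟨k, hk⟩ : ∃ k, z'.1 = simplexSide k t := by
      rcases hz' with h | h
      exacts [⟨1, h⟩, ⟨2, h⟩]
    have e1 := key z' k hk
    refine Subtype.ext (funext fun w => ?_)
    change FinComplex.push foldVertex (e.symm z).1 w = FinComplex.push foldVertex (e.symm z').1 w
    rw [e0, e1, push_discSidePoint, push_discSidePoint]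
  have : CompactSpace (stdSimplex ℝ (Fin 3)) := isCompact_iff_compactSpace.1 (isCompact_stdSimplex ℝ _)
  have hcont : Continuous (Quot.lift (fun z => discToHat (e.symm z)) hresp : DunceHat → _) :=
    continuous_quot_lift _ (continuous_discToHat.comp e.symm.continuous)
  have hbij : Function.Bijective (Quot.lift (fun z => discToHat (e.symm z)) hresp : DunceHat → _) := by
    constructor
    · rintro ⟨z⟩ ⟨z'⟩ h
      have h1 := mk_discToSimplex_eq h
      rwa [← he, e.apply_symm_apply, e.apply_symm_apply] at h1
    · rintro ⟨y, hy⟩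
      obtain ⟨x, hx, h⟩ := FinComplex.exists_push_eq (fun _ hτ => exists_image_foldVertex hτ) hy
      refine ⟨Quot.mk _ (e ⟨x, hx⟩), Subtype.ext ?_⟩
      change FinComplex.push foldVertex (e.symm (e ⟨x, hx⟩)).1 = y
      rw [e.symm_apply_apply, h]
  obtain ⟨g⟩ := FinComplex.nonempty_homeomorph_of_bijective hcont hbij
  exact ⟨g.symm⟩

lemma FinComplex.isDunceHat_hatSd {V : Type u} (f : Fin 4 ↪ V) : (hatSd f).IsDunceHat := by
  obtain ⟨e1⟩ := nonempty_homeomorph_sd (hat (innerEmb f)).sd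
  obtain ⟨e2⟩ := nonempty_homeomorph_sd (hat (innerEmb f))
  obtain ⟨e3⟩ := nonempty_homeomorph_map (hatEmb (innerEmb f)) hatComplex
  obtain ⟨e4⟩ := hatComplex_isDunceHat
  exact ⟨e1.trans (e2.trans (e3.symm.trans e4))⟩

/-! ### Random relabelings -/

lemma list_lt_of_mem {x : ℕ} : ∀ {l l' : List ℕ}, l.Pairwise (· < ·) → l'.Pairwise (· < ·) →
    l.length = l'.length → x ∈ l → x ∉ l' → (∀ y ∈ l', y ∉ l → x < y) → l < l'
  | [], _, _, _, _, hx, _, _ => by simp at hx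
  | _ :: _, [], _, _, hlen, _, _, _ => by simp at hlen
  | a :: l, b :: l', hl, hl', hlen, hx, hx', h => by
    rw [List.pairwise_cons] at hl hl'
    rw [List.cons_lt_cons_iff]
    rcases lt_trichotomy a b with hab | rfl | hab
    · exact Or.inl hab
    · have hxa : x ≠ a := fun e => hx' (by simp [e])
      refine Or.inr ⟨rfl, list_lt_of_mem hl.2 hl'.2 (by simpa using hlen)
        ((List.mem_cons.1 hx).resolve_left hxa) (fun hm => hx' (List.mem_cons_of_mem _ hm)) ?_⟩
      intro y hy hyl
      refine h y (List.mem_cons_of_mem _ hy) fun hm => ?_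
      rcases List.mem_cons.1 hm with rfl | hm
      · exact lt_irrefl _ (hl'.1 _ hy)
      · exact hyl hm
    · exfalso
      by_cases hb : b ∈ a :: l
      · rcases List.mem_cons.1 hb with rfl | hb
        · exact lt_irrefl _ hab
        · exact lt_asymm hab (hl.1 b hb)
      · have h1 := h b (by simp) hb
        rcases List.mem_cons.1 hx with rfl | hx
        · exact lt_asymm hab h1
        · exact lt_asymm (h1.trans hab) (hl.1 x hx)

section Lex

variable {V : Type u} {M : FinComplex V} {τ s₁ s₂ : Finset V}

lemma lexKey_lt_of_mem {lab : V → ℕ} {σ τ : Finset V} (hlab : Set.InjOn lab {x | x ∈ σ ∨ x ∈ τ})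
    (hc : τ.card = σ.card) {x : V} (hx : x ∈ τ) (hxσ : x ∉ σ)
    (h : ∀ y ∈ σ, y ∉ τ → lab x < lab y) : lexKey lab τ < lexKey lab σ := by
  classical
  have hτ : Set.InjOn lab τ := hlab.mono fun _ h => Or.inr h
  have hσ : Set.InjOn lab σ := hlab.mono fun _ h => Or.inl h
  unfold lexKey
  refine list_lt_of_mem (x := lab x) (Finset.sortedLT_sort _).pairwise (Finset.sortedLT_sort _).pairwise
    ?_ ?_ ?_ ?_
  · rw [Finset.length_sort, Finset.length_sort, Finset.card_image_of_injOn hτ,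
      Finset.card_image_of_injOn hσ, hc]
  · rw [Finset.mem_sort]
    exact Finset.mem_image_of_mem _ hx
  · rw [Finset.mem_sort]
    intro hm
    obtain ⟨y, hy, hyx⟩ := Finset.mem_image.1 hm
    exact hxσ (hlab (Or.inl hy) (Or.inr hx) hyx ▸ hy)
  · intro b hb hb'
    rw [Finset.mem_sort] at hb hb'
    obtain ⟨y, hy, rfl⟩ := Finset.mem_image.1 hb
    exact h y hy fun hyτ => hb' (Finset.mem_image_of_mem _ hyτ)

open Classical in
lemma IsWall.exists_of_ne (hw : IsWall M τ s₁ s₂) {σ : Finset V} (h3 : σ.card = 3)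
    (hσ : σ ⊂ s₁ ∨ σ ⊂ s₂) (hne : σ ≠ τ) : ∃ s ∈ ({s₁, s₂} : Finset (Finset V)), σ ⊆ s ∧
      (∃ w ∈ σ, w ∉ τ) ∧ ∃ x ∈ τ, x ∉ σ := by
  have h : ∃ w ∈ σ, w ∉ τ := Finset.not_subset.1 fun h =>
    hne (Finset.eq_of_subset_of_card_le h (by rw [h3, hw.card]))
  have h' : ∃ x ∈ τ, x ∉ σ := Finset.not_subset.1 fun h =>
    hne (Finset.eq_of_subset_of_card_le h (by rw [h3, hw.card])).symm
  rcases hσ with hσ | hσ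
  exacts [⟨s₁, by simp, hσ.1, h, h'⟩, ⟨s₂, by simp, hσ.1, h, h'⟩]

open Classical in
lemma IsWall.prefers_lexFirst (hw : IsWall M τ s₁ s₂) {lab : V → ℕ} (hinj : Set.InjOn lab M.verts)
    (hlab : LabelsAbove lab {s₁, s₂} {x | x ∉ τ}) : PrefersWall (lexFirstSelector lab) M τ s₁ s₂ := by
  intro S hS h hτ σ hσ h3 hs
  by_contra hne
  obtain ⟨s, hsm, hσs, -, x, hx, hxσ⟩ := hw.exists_of_ne h3 hs hne
  have hverts : ∀ s ∈ ({s₁, s₂} : Finset (Finset V)), ∀ x ∈ s, x ∈ M.verts := by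
    intro s hs x hx
    simp only [FinComplex.verts, Finset.mem_biUnion, id, FinComplex.mem_faceFinset]
    simp only [Finset.mem_insert, Finset.mem_singleton] at hs
    rcases hs with rfl | rfl
    exacts [⟨_, hw.mem₁, hx⟩, ⟨_, hw.mem₂, hx⟩]
  refine absurd (lexFirstSelector_support hσ τ hτ) (not_le.2 (lexKey_lt_of_mem ?_ ?_ hx hxσ ?_))
  · refine hinj.mono ?_
    rintro y (hy | hy)
    exacts [hverts s hsm y (hσs hy), hverts s₁ (by simp) y (hw.sub₁.1 hy)]
  · rw [hw.card, h3]
  · intro y hy hyτ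
    exact hlab s₁ (by simp) x (hw.sub₁.1 hx) s hsm y (hσs hy) (fun h => h hx) hyτ

open Classical in
lemma IsWall.prefers_lexLast (hw : IsWall M τ s₁ s₂) {lab : V → ℕ}
    (hlab : LabelsAbove lab {s₁, s₂} {x | x ∈ τ}) : PrefersWall (lexLastSelector lab) M τ s₁ s₂ := by
  intro S hS h hτ σ hσ h3 hs
  by_contra hne
  obtain ⟨s, hsm, hσs, ⟨w, hw1, hw2⟩, -⟩ := hw.exists_of_ne h3 hs hne
  refine absurd (lexLastSelector_support hσ τ hτ) (not_le.2 (lexKey_lt ?_ ⟨w, hw1, ?_⟩))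
  · exact Finset.card_pos.1 (by rw [hw.card]; norm_num)
  · intro y hy
    exact hlab s hsm w (hσs hw1) s₁ (by simp) y (hw.sub₁.1 hy) hw2 hy

end Lex

section Labels

variable {V : Type u} {M : FinComplex V} {ι : Type*} {T : ι → Finset (Finset V)} {Q : ι → Set V}
  {J : Finset ι} {t : ℝ} {k : ℕ}

namespace FinComplex

lemma mem_verts {s : Finset V} (hs : s ∈ M.faces) {x : V} (hx : x ∈ s) : x ∈ M.verts := by
  classical
  simp only [verts, Finset.mem_biUnion, id, mem_faceFinset]
  exact ⟨s, hs, hx⟩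

lemma label_apply (e : M.Relabeling) {x : V} (hx : x ∈ M.verts) : M.label e x = e ⟨x, hx⟩ + 1 := by
  simp [label, hx]

lemma label_injOn (e : M.Relabeling) : Set.InjOn (M.label e) M.verts := by
  intro x hx y hy h
  rw [label_apply e hx, label_apply e hy] at h
  have := e.injective (Fin.ext (Nat.succ_injective h))
  exact congrArg Subtype.val this

/-- There are labels that are larger on `Q` than elsewhere. -/
lemma exists_labelsAbove (T : Finset (Finset V)) (hT : ∀ s ∈ T, s ∈ M.faces) (Q : Set V) :
    ∃ e : M.Relabeling, LabelsAbove (M.label e) T Q := by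
  classical
  obtain ⟨π, hπ⟩ := exists_perm_labelsAbove (lab := fun x : {x // x ∈ M.verts} =>
    ((M.verts.equivFin x : Fin _) : ℕ)) (fun x y h => M.verts.equivFin.injective (Fin.ext h))
    {x | x.1 ∈ Q}
  refine ⟨π.trans M.verts.equivFin, ?_⟩
  intro s hs x hx s' hs' y hy hxQ hyQ
  have hxv := mem_verts (hT s hs) hx
  have hyv := mem_verts (hT s' hs') hy
  rw [label_apply _ hxv, label_apply _ hyv]
  exact Nat.succ_lt_succ (hπ ⟨x, hxv⟩ ⟨y, hyv⟩ hxQ hyQ)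

open Classical in
lemma sum_labelsAbove_le (ht0 : 0 ≤ t) (ht1 : t ≤ 1) (hT : ∀ i ∈ J, ∀ s ∈ T i, s ∈ M.faces)
    (hdisj : ∀ i ∈ J, ∀ l ∈ J, ∀ s ∈ T i, ∀ s' ∈ T l, ∀ x, x ∈ s → x ∈ s' → i = l)
    (hcard : ∀ i ∈ J, ((T i).biUnion id).card ≤ k) :
    ∑ e : M.Relabeling, ∏ i ∈ J, (if LabelsAbove (M.label e) (T i) (Q i) then t else 1) ≤
      (1 - (1 - t) * ((k.factorial : ℝ))⁻¹) ^ J.card * Fintype.card M.Relabeling := by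
  obtain ⟨P, hP⟩ : ∃ P : ι → Set {x // x ∈ M.verts}, ∀ i x, x ∈ P i ↔ ∃ s ∈ T i, x.1 ∈ s :=
    ⟨fun i => {x | ∃ s ∈ T i, x.1 ∈ s}, fun _ _ => Iff.rfl⟩
  refine sum_prod_perm_le (P := P) ht0 ht1 ?_ ?_ ?_ ?_
  · intro i hi l hl x hx hx'
    obtain ⟨s, hs, hx⟩ := (hP i x).1 hx
    obtain ⟨s', hs', hx'⟩ := (hP l x).1 hx'
    exact hdisj i hi l hl s hs s' hs' x hx hx'
  · intro i hi e e' hee h s hs x hx s' hs' y hy hxQ hyQ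
    have hxv := mem_verts (hT i hi s hs) hx
    have hyv := mem_verts (hT i hi s' hs') hy
    have := h s hs x hx s' hs' y hy hxQ hyQ
    rw [label_apply _ hxv, label_apply _ hyv] at this ⊢
    rwa [← hee ⟨x, hxv⟩ ((hP i _).2 ⟨s, hs, hx⟩), ← hee ⟨y, hyv⟩ ((hP i _).2 ⟨s', hs', hy⟩)]
  · intro i hi e
    obtain ⟨π, hπ⟩ := exists_perm_labelsAbove
      (lab := fun x : {x // x ∈ P i} => (e x.1 : ℕ))
      (fun x y h => Subtype.ext (e.injective (Fin.ext h))) {x | x.1.1 ∈ Q i}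
    refine ⟨π, ?_⟩
    intro s hs x hx s' hs' y hy hxQ hyQ
    have hxv := mem_verts (hT i hi s hs) hx
    have hyv := mem_verts (hT i hi s' hs') hy
    have hxP := (hP i ⟨x, hxv⟩).2 ⟨s, hs, hx⟩
    have hyP := (hP i ⟨y, hyv⟩).2 ⟨s', hs', hy⟩
    rw [label_apply _ hxv, label_apply _ hyv, Equiv.trans_apply, Equiv.trans_apply,
      Equiv.Perm.ofSubtype_apply_of_mem π hxP, Equiv.Perm.ofSubtype_apply_of_mem π hyP]
    exact Nat.succ_lt_succ (hπ ⟨_, hxP⟩ ⟨_, hyP⟩ hxQ hyQ)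
  · intro i hi
    refine le_trans ?_ (hcard i hi)
    rw [← Fintype.card_coe]
    refine Fintype.card_le_of_injective (fun x => ⟨x.1.1, ?_⟩) ?_
    · obtain ⟨s, hs, hx⟩ := (hP i _).1 x.2
      exact Finset.mem_biUnion.2 ⟨s, hs, hx⟩
    · intro x y h
      have h' := congrArg Subtype.val h
      exact Subtype.ext (Subtype.ext h')

open Classical in
lemma expect_randomRelabeling_le {f : M.Relabeling → ℝ≥0∞} {g : M.Relabeling → ℝ} {c : ℝ}
    (hg0 : ∀ e, 0 ≤ g e) (hfg : ∀ e, f e ≤ ENNReal.ofReal (g e))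
    (h : ∑ e, g e ≤ c * Fintype.card M.Relabeling) :
    M.randomRelabeling.expect f ≤ ENNReal.ofReal c := by
  have : Nonempty M.Relabeling := ⟨M.verts.equivFin⟩
  have hpos : (0 : ℝ) < Fintype.card M.Relabeling := by exact_mod_cast Fintype.card_pos
  rw [randomRelabeling, PMF.expect_uniformOfFintype]
  calc _ ≤ (Fintype.card M.Relabeling : ℝ≥0∞)⁻¹ * ∑ e, ENNReal.ofReal (g e) :=
        mul_le_mul_right (Finset.sum_le_sum fun e _ => hfg e) _
    _ = ENNReal.ofReal ((Fintype.card M.Relabeling : ℝ)⁻¹ * ∑ e, g e) := by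
        rw [← ENNReal.ofReal_sum_of_nonneg fun e _ => hg0 e, ENNReal.ofReal_mul (by positivity),
          ENNReal.ofReal_inv_of_pos hpos, ENNReal.ofReal_natCast]
    _ ≤ _ := by
        refine ENNReal.ofReal_le_ofReal ?_
        rw [inv_mul_le_iff₀ hpos, mul_comm]
        exact h

end FinComplex

variable {D : ι → Finset (Finset V)} {A W : ι → Set V}

open Classical in
lemma expect_pow_lex_le {sel : (V → ℕ) → Selector V} (hsel : ∀ lab, (sel lab).Proper)
    (hG : ∀ i ∈ J, IsGadget M (T i) (D i) (A i) (W i))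
    (hdisj : ∀ i ∈ J, ∀ l ∈ J, ∀ s ∈ T i, ∀ s' ∈ T l, ∀ x, x ∈ s → x ∈ s' → i = l)
    (havoid : ∀ i ∈ J, ∀ lab, LabelsAbove lab (T i) (Q i) → AvoidsGadget (sel lab) M (D i))
    (hcard : ∀ i ∈ J, ((T i).biUnion id).card ≤ k) (ht0 : 0 ≤ t) (ht1 : t ≤ 1) :
    (M.randomRelabeling.bind fun e =>
      morseRun (sel (M.label e)) (· = ∅) M.faceFinset.card (M.faceFinset, 0)).expect
      (fun s => ENNReal.ofReal (t ^ s.2)) ≤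
        ENNReal.ofReal ((1 - (1 - t) * ((k.factorial : ℝ))⁻¹) ^ J.card) := by
  have hT : ∀ i ∈ J, ∀ s ∈ T i, s ∈ M.faces := fun i hi s hs => ((hG i hi).tet s hs).1
  rw [PMF.expect_bind]
  refine FinComplex.expect_randomRelabeling_le (fun e => Finset.prod_nonneg fun i _ => ?_) (fun e => ?_)
    (FinComplex.sum_labelsAbove_le (Q := Q) ht0 ht1 hT hdisj hcard)
  · split_ifs
    exacts [ht0, zero_le_one]
  · rw [Finset.prod_ite, Finset.prod_const, Finset.prod_const_one, mul_one]
    refine expect_pow_avoids_le (hsel _) (fun i hi => hG i (Finset.mem_filter.1 hi).1) ?_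
      (fun i hi => havoid i (Finset.mem_filter.1 hi).1 _ (Finset.mem_filter.1 hi).2) ht0 ht1
    intro i hi l hl s hs hs'
    have hi' := (Finset.mem_filter.1 hi).1
    obtain ⟨x, hx⟩ := FinComplex.nonempty_of_mem (hT i hi' s hs)
    exact hdisj i hi' l (Finset.mem_filter.1 hl).1 s hs s hs' x hx hx

end Labels

/-! ### The probability to find the dunce hat -/

section Find

variable {V : Type u} {M D : FinComplex V} {τ s₁ s₂ : Finset V}

open Classical in
lemma IsWall.lex_le {sel : (V → ℕ) → Selector V} (hsel : ∀ lab, (sel lab).Proper) (hN : M.DimLE3)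
    (hw : IsWall M τ s₁ s₂) {Q : Set V} (hp : ∀ lab, Set.InjOn lab M.verts →
      LabelsAbove lab {s₁, s₂} Q → PrefersWall (sel lab) M τ s₁ s₂) :
    (M.randomRelabeling.bind fun e =>
      morseRun (sel (M.label e)) HaltDim M.faceFinset.card (M.faceFinset, 0)).toOuterMeasure
      {s | τ ∈ s.1} ≤ ENNReal.ofReal (1 - (Nat.factorial 8 : ℝ)⁻¹) := by
  rw [PMF.toOuterMeasure_eq_expect, PMF.expect_bind]
  have hsum := FinComplex.sum_labelsAbove_le (M := M) (ι := Unit) (T := fun _ => {s₁, s₂})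
    (Q := fun _ => Q) (J := Finset.univ) (t := 0) (k := 8) le_rfl zero_le_one ?_
    (fun _ _ _ _ _ _ _ _ _ _ _ => rfl) ?_
  · simp only [Finset.univ_unique, Finset.prod_singleton, Finset.card_singleton, pow_one, sub_zero,
      one_mul] at hsum
    refine FinComplex.expect_randomRelabeling_le (fun e => ?_) (fun e => ?_) hsum
    · split_ifs
      exacts [le_rfl, zero_le_one]
    · split_ifs with h
      · rw [ENNReal.ofReal_zero]
        refine (PMF.expect_mono_support _ fun s hs => ?_).trans (PMF.expect_const _ 0).le
        refine (Set.indicator_of_notMem (s := {s : MorseState V | τ ∈ s.1}) ?_ _).le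
        exact hw.notMem_of_prefers hN (hsel _) (hp _ (M.label_injOn e) h) hs
      · rw [ENNReal.ofReal_one]
        refine (PMF.expect_mono_support _ fun s hs => ?_).trans (PMF.expect_const _ 1).le
        exact Set.indicator_le_self' (fun _ _ => zero_le_one) s
  · intro _ _ s hs
    simp only [Finset.mem_insert, Finset.mem_singleton] at hs
    rcases hs with rfl | rfl
    exacts [hw.mem₁, hw.mem₂]
  · intro _ _
    refine Finset.card_biUnion_le.trans ?_
    rw [Finset.sum_pair hw.ne]
    simp [hw.card₁, hw.card₂]

lemma MorseStrategy.findProb_le (hN : M.DimLE3) (hw : IsWall M τ s₁ s₂) (hτ : τ ∈ M.faces)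
    (hD : τ ∈ D.faces) (i : MorseStrategy) :
    i.findProb M D ≤ ENNReal.ofReal (1 - (Nat.factorial 8 : ℝ)⁻¹) := by
  classical
  have h : i.findProb M D ≤ (i.law M HaltDim).toOuterMeasure {s | τ ∈ s.1} :=
    MeasureTheory.measure_mono fun s hs => hs.2.2 (FinComplex.mem_faceFinset.2 hD)
  refine h.trans ?_
  cases i with
  | random =>
    refine (hw.uniform_le hN hτ).trans (ENNReal.ofReal_le_ofReal ?_)
    norm_num [Nat.factorial]
  | randomLexFirst =>
    exact hw.lex_le proper_lexFirstSelector hN fun lab hinj hlab => hw.prefers_lexFirst hinj hlab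
  | randomLexLast =>
    exact hw.lex_le proper_lexLastSelector hN fun lab _ hlab => hw.prefers_lexLast hlab

lemma MorseStrategy.findProb_pos {T : Finset (Finset V)} {A W : Set V}
    (hG : IsGadget M T D.triangles A W) (hfree : HasFreeFaces M)
    (hpure : ∀ σ ∈ D.faces, ∃ t ∈ D.faces, σ ⊆ t ∧ t.card = 3) (i : MorseStrategy) :
    0 < i.findProb M D := by
  classical
  have key : ∀ sel : Selector V, sel.Proper →
      (∀ S, IsState M S → ∀ h : (freeFaces S).Nonempty,
        ∃ σ ∈ (sel (freeFaces S) h).support, σ ∈ freeFaces S ∧ σ ∉ D.triangles) →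
      ∃ s ∈ (morseRun sel HaltDim M.faceFinset.card (M.faceFinset, 0)).support,
        s.2 = 0 ∧ (∀ σ ∈ s.1, σ.card ≤ 3) ∧ D.faceFinset ⊆ s.1 := by
    intro sel hsel hchoice
    obtain ⟨s, hs, hst, h0, hD⟩ := exists_support_find hG hfree hchoice M.faceFinset.card
    refine ⟨s, hs, h0, halt_of_mem_support_morseRun (halt := HaltDim) hsel (by simp [HaltDim])
      M.faceFinset.card (M.faceFinset, 0) le_rfl s hs, fun σ hσ => ?_⟩
    rw [FinComplex.mem_faceFinset] at hσ
    obtain ⟨t, ht, hσt, h3⟩ := hpure σ hσ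
    exact hst.2 t (hD (FinComplex.mem_triangles.2 ⟨ht, h3⟩)) σ hσt (FinComplex.nonempty_of_mem hσ)
  have hT : ∀ s ∈ T, s ∈ M.faces := fun s hs => (hG.tet s hs).1
  suffices h : ∃ s ∈ (i.law M HaltDim).support,
      s.2 = 0 ∧ (∀ σ ∈ s.1, σ.card ≤ 3) ∧ D.faceFinset ⊆ s.1 by
    obtain ⟨s, hs, hs'⟩ := h
    rw [pos_iff_ne_zero, MorseStrategy.findProb, Ne, PMF.toOuterMeasure_apply_eq_zero_iff]
    exact fun hd => Set.disjoint_left.1 hd hs hs'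
  have hlex : ∀ (sel : (V → ℕ) → Selector V) (Q : Set V), (∀ lab, (sel lab).Proper) →
      (∀ lab, LabelsAbove lab T Q → AvoidsGadget (sel lab) M D.triangles) →
      ∃ s ∈ (M.randomRelabeling.bind fun e =>
        morseRun (sel (M.label e)) HaltDim M.faceFinset.card (M.faceFinset, 0)).support,
        s.2 = 0 ∧ (∀ σ ∈ s.1, σ.card ≤ 3) ∧ D.faceFinset ⊆ s.1 := by
    intro sel Q hsel hav
    obtain ⟨e, he⟩ := FinComplex.exists_labelsAbove T hT Q
    obtain ⟨s, hs, hs'⟩ := key _ (hsel _) fun S hS h => (hav _ he).exists_choice (hsel _) hS h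
    refine ⟨s, ?_, hs'⟩
    rw [PMF.mem_support_bind_iff]
    have : Nonempty M.Relabeling := ⟨M.verts.equivFin⟩
    exact ⟨e, PMF.mem_support_uniformOfFintype e, hs⟩
  cases i with
  | random => exact key _ proper_uniformSelector fun S hS h => hG.exists_choice_uniform hS h
  | randomLexFirst =>
    exact hlex _ W proper_lexFirstSelector fun lab hlab => avoidsGadget_lexFirst hG hlab
  | randomLexLast =>
    exact hlex _ Aᶜ proper_lexLastSelector fun lab hlab => avoidsGadget_lexLast hG hlab

end Find

open FinComplex

/-! ### The exponential moment of the number of critical faces -/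

lemma expect_X_le : ∃ F : ℕ, 1 ≤ F ∧ ∀ (V : Type u) (L : FinComplex V), L.DimLE3 →
    ∀ (i : MorseStrategy) (t : ℝ), 0 ≤ t → t ≤ 1 →
    (i.X L.sd7).expect (fun n => ENNReal.ofReal (t ^ n)) ≤
      ENNReal.ofReal ((1 - (1 - t) * ((F : ℝ) ^ F)⁻¹) ^ L.f 3) := by
  classical
  obtain ⟨κ, hκ⟩ := exists_card_hatTets_le.{u}
  refine ⟨4 * κ + 1, by omega, fun V L hL i t ht0 ht1 => ?_⟩
  set F := 4 * κ + 1 with hF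
  set A : Finset (Finset V) := {σ ∈ L.faceFinset | σ.card = 3 + 1} with hA
  have hmem : ∀ Δ : {x // x ∈ A}, Δ.1 ∈ L.faces ∧ Δ.1.card = 4 := fun Δ => by
    have h := Finset.mem_filter.1 Δ.2
    exact ⟨mem_faceFinset.1 h.1, h.2⟩
  choose f hf using fun Δ : {x // x ∈ A} => exists_embedding_of_card (hmem Δ).2
  have hfL : ∀ Δ, Finset.univ.map (f Δ) ∈ L.faces := fun Δ => (hf Δ).symm ▸ (hmem Δ).1
  have hG := fun Δ (_ : Δ ∈ A.attach) => isGadget_hatSd hL (hfL Δ)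
  have hdisj : ∀ Δ ∈ A.attach, ∀ Δ' ∈ A.attach, ∀ s ∈ L.hatTets (f Δ), ∀ s' ∈ L.hatTets (f Δ'),
      ∀ x, x ∈ s → x ∈ s' → Δ = Δ' := by
    intro Δ _ Δ' _ s hs s' hs' x hx hx'
    by_contra hne
    exact hatTets_notMem hL (hfL Δ) (hfL Δ') (by rw [hf, hf]; exact fun h => hne (Subtype.ext h))
      hs hs' hx hx'
  have hcard4 : ∀ Δ ∈ A.attach, 4 * (L.hatTets (f Δ)).card ≤ F := fun Δ _ => by
    have := hκ V L (f Δ) hL (hfL Δ)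
    omega
  have hcard : ∀ Δ ∈ A.attach, ((L.hatTets (f Δ)).biUnion id).card ≤ F := by
    intro Δ hΔ
    refine (Finset.card_biUnion_le_card_mul _ _ 4 fun s hs => ?_).trans
      ((mul_comm _ _).trans_le (hcard4 Δ hΔ))
    exact ((hG Δ hΔ).tet s hs).2.le
  have hJ : A.attach.card = L.f 3 := Finset.card_attach
  have hlex : (1 - (1 - t) * ((F.factorial : ℝ))⁻¹) ^ L.f 3 ≤
      (1 - (1 - t) * ((F : ℝ) ^ F)⁻¹) ^ L.f 3 := by
    have h1 : (1 : ℝ) ≤ F.factorial := by exact_mod_cast Nat.succ_le_of_lt (Nat.factorial_pos F)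
    have h2 : (F.factorial : ℝ) ≤ (F : ℝ) ^ F := by exact_mod_cast Nat.factorial_le_pow F
    have h3 : ((F : ℝ) ^ F)⁻¹ ≤ (F.factorial : ℝ)⁻¹ := inv_anti₀ (by linarith) h2
    have h4 : (F.factorial : ℝ)⁻¹ ≤ 1 := inv_le_one_of_one_le₀ h1
    have h5 : 0 ≤ (F.factorial : ℝ)⁻¹ := by positivity
    refine pow_le_pow_left₀ ?_ ?_ _
    · nlinarith
    · nlinarith
  unfold MorseStrategy.X
  rw [PMF.expect_map]
  cases i with
  | random =>
    have h := expect_pow_uniform_le (J := A.attach) hL.sd.sd.sd.sd.sd.sd.sd hG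
      (fun Δ hΔ Δ' hΔ' s hs hs' => by
        obtain ⟨x, hx⟩ := nonempty_of_mem ((hG Δ hΔ).tet s hs).1
        exact hdisj Δ hΔ Δ' hΔ' s hs s hs' x hx hx) (F := F) (by omega) hcard4 ht0 ht1
    rwa [hJ] at h
  | randomLexFirst =>
    have h := expect_pow_lex_le (J := A.attach) proper_lexFirstSelector hG hdisj
      (fun Δ hΔ lab hlab => avoidsGadget_lexFirst (hG Δ hΔ) hlab) hcard ht0 ht1
    rw [hJ] at h
    exact h.trans (ENNReal.ofReal_le_ofReal hlex)
  | randomLexLast =>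
    have h := expect_pow_lex_le (J := A.attach) proper_lexLastSelector hG hdisj
      (fun Δ hΔ lab hlab => avoidsGadget_lexLast (hG Δ hΔ) hlab) hcard ht0 ht1
    rw [hJ] at h
    exact h.trans (ENNReal.ofReal_le_ofReal hlex)

/-- The number of critical faces is bounded by the number of faces. -/
lemma MorseStrategy.le_of_mem_support_X {V : Type u} (i : MorseStrategy) (K : FinComplex V) {n : ℕ}
    (hn : n ∈ (i.X K).support) : n ≤ K.faceFinset.card := by
  have key : ∀ sel : Selector V, sel.Proper → ∀ s ∈ (morseRun sel (· = ∅) K.faceFinset.card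
      (K.faceFinset, 0)).support, s.2 ≤ K.faceFinset.card := by
    intro sel hsel s hs
    have h := morseRun_invariant (sel := sel) (halt := (· = ∅))
      (Inv := fun s => s.2 + s.1.card ≤ K.faceFinset.card) ?_ _ _ (by simp) s hs
    · omega
    · intro s hinv hne s' hs'
      rcases mem_support_morseStep hsel hs' (Finset.nonempty_iff_ne_empty.2 hne) with
        ⟨σ, hσ, rfl⟩ | ⟨-, σ, hσ, rfl⟩
      · have := card_deleteFace_lt (mem_of_mem_freeFaces hσ)
        dsimp only
        omega
      · have := card_deleteFace_lt (mem_of_mem_topFaces hσ)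
        dsimp only
        omega
  rw [MorseStrategy.X, PMF.mem_support_map_iff] at hn
  obtain ⟨s, hs, rfl⟩ := hn
  cases i with
  | random => exact key _ proper_uniformSelector s hs
  | randomLexFirst =>
    obtain ⟨e, -, he⟩ := (PMF.mem_support_bind_iff _ _ _).1 hs
    exact key _ (proper_lexFirstSelector _) s he
  | randomLexLast =>
    obtain ⟨e, -, he⟩ := (PMF.mem_support_bind_iff _ _ _).1 hs
    exact key _ (proper_lexLastSelector _) s he

/-! ### Numerical estimates -/

lemma one_sub_mul_pow_le {p q q' : ℝ} {M : ℕ} (hp0 : 0 ≤ p) (hq0 : 0 ≤ q) (hq1 : q ≤ 1)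
    (hq' : 0 < q') (hp : p ≤ 1 - q') (hM : 1 ≤ M * (q * q')) : (1 - p * q) ^ M ≤ 1 - p := by
  have hpq0 : 0 ≤ p * q := mul_nonneg hp0 hq0
  have hpq1 : p * q ≤ 1 := mul_le_one₀ (by linarith) hq0 hq1
  have h1 : 1 + M * (p * q) ≤ (1 + p * q) ^ M := one_add_mul_le_pow (by linarith) M
  have h2 : (1 - p * q) ^ M * (1 + p * q) ^ M ≤ 1 := by
    rw [← mul_pow]
    exact pow_le_one₀ (by nlinarith) (by nlinarith)
  have h3 : 0 ≤ (1 - p * q) ^ M := pow_nonneg (by linarith) M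
  have h4 : (1 - p * q) ^ M * (1 + M * (p * q)) ≤ 1 := (mul_le_mul_of_nonneg_left h1 h3).trans h2
  have h5 : p ≤ M * (p * q) * q' := by nlinarith
  set y := M * (p * q) with hy
  have hy0 : 0 ≤ y := by positivity
  have h6 : 1 ≤ (1 - p) * (1 + y) := by nlinarith
  have h7 : (0 : ℝ) < 1 + y := by linarith
  nlinarith

lemma toOuterMeasure_le_of_expect_le {X : PMF ℕ} {t : ℝ} (ht0 : 0 < t) (ht1 : t ≤ 1) {N : ℕ}
    (h : X.expect (fun n => ENNReal.ofReal (t ^ n)) ≤ ENNReal.ofReal (t ^ N)) (m : ℕ) :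
    X.toOuterMeasure {n | n ≤ m} ≤ ENNReal.ofReal t ^ ((N : ℤ) - (m : ℤ)) := by
  have hy0 : ENNReal.ofReal t ≠ 0 := by simpa using ht0
  have hy1 : ENNReal.ofReal t ≠ ⊤ := ENNReal.ofReal_ne_top
  rw [ENNReal.zpow_sub hy0 hy1, zpow_natCast, zpow_natCast, ← div_eq_mul_inv,
    ENNReal.le_div_iff_mul_le (Or.inl (pow_ne_zero _ hy0)) (Or.inl (ENNReal.pow_ne_top hy1))]
  rw [← ENNReal.ofReal_pow ht0.le N]
  refine le_trans ?_ h
  rw [PMF.toOuterMeasure_eq_expect, PMF.expect, PMF.expect, ← ENNReal.tsum_mul_right]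
  refine ENNReal.tsum_le_tsum fun n => ?_
  rw [mul_assoc]
  refine mul_le_mul_right ?_ _
  by_cases hn : n ≤ m
  · rw [Set.indicator_of_mem (by exact hn), one_mul, ← ENNReal.ofReal_pow ht0.le]
    exact ENNReal.ofReal_le_ofReal (pow_le_pow_of_le_one ht0.le ht1 hn)
  · rw [Set.indicator_of_notMem (by exact hn), zero_mul]
    exact zero_le

lemma mul_le_integral_of_toOuterMeasure_le {X : PMF ℕ} {B N : ℕ} (hB : ∀ n ∈ X.support, n ≤ B)
    {p : ℝ≥0∞} (hp : p ≤ 1) (h : X.toOuterMeasure {n | n ≤ N} ≤ 1 - p) :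
    (N + 1 : ℝ) * p.toReal ≤ ∫ n, (n : ℝ) ∂X.toMeasure := by
  have hint : MeasureTheory.Integrable (fun n : ℕ => (n : ℝ)) X.toMeasure := by
    refine MeasureTheory.Integrable.of_bound (measurable_of_countable _).aestronglyMeasurable B ?_
    rw [MeasureTheory.ae_iff, PMF.toMeasure_apply_eq_zero_iff _ (Set.to_countable _).measurableSet]
    rw [Set.disjoint_left]
    intro n hn hn'
    refine hn' ?_
    rw [Real.norm_natCast]
    exact_mod_cast hB n hn
  have h1 := MeasureTheory.mul_meas_ge_le_integral_of_nonneg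
    (Filter.Eventually.of_forall fun n => Nat.cast_nonneg n) hint (N + 1 : ℝ)
  refine le_trans (mul_le_mul_of_nonneg_left ?_ (by positivity)) h1
  have hc : {n : ℕ | (N + 1 : ℝ) ≤ n} = {n | n ≤ N}ᶜ := by
    ext n
    simp only [Set.mem_ofPred_eq, Set.mem_compl_iff, not_le]
    exact_mod_cast Nat.succ_le_iff
  rw [hc, MeasureTheory.measureReal_def, MeasureTheory.prob_compl_eq_one_sub
    (Set.to_countable _).measurableSet]
  rw [← PMF.toMeasure_apply_eq_toOuterMeasure] at h
  refine ENNReal.toReal_mono (by simp) ?_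
  calc p = 1 - (1 - p) := (ENNReal.sub_sub_cancel ENNReal.one_ne_top hp).symm
    _ ≤ _ := tsub_le_tsub_left h 1

lemma two_le_log : (2 : ℝ) ≤ Real.log 24 := by
  rw [Real.le_log_iff_exp_le (by norm_num)]
  have h := Real.exp_one_lt_d9
  have h0 := Real.exp_pos 1
  have : Real.exp 2 = Real.exp 1 * Real.exp 1 := by rw [← Real.exp_add]; norm_num
  nlinarith

lemma tetrahedronBoundary_card_le : ∀ σ ∈ tetrahedronBoundary.faces, σ.card ≤ 3 := by
  rintro σ ⟨-, hσ⟩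
  have := (Finset.card_lt_iff_ne_univ σ).2 hσ
  rw [Fintype.card_fin] at this
  exact Nat.le_of_lt_succ this

end

open FinComplex

theorem theorem5p3 :
    ∃ (α : ℕ) (D : FinComplex (SdVertex (Fin 4) α)),
      -- `D` is a copy of the dunce hat in the interior of the subdivided tetrahedron
      D.IsDunceHat ∧ D.faces ⊆ (tetrahedron.sdIter α).faces ∧
      Disjoint D.faces (tetrahedronBoundary.sdIter α).faces ∧
      -- that each strategy finds with positive probability, and
      (∀ i : MorseStrategy, 0 < i.findProb (tetrahedron.sdIter α) D) ∧
      ∀ (V : Type u) (K : FinComplex V), K.HasDim 3 → ∀ i : MorseStrategy,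
        (∀ ℓ m : ℕ, (i.X (K.sdIter (ℓ + α))).toOuterMeasure {n | n ≤ m} ≤
          (1 - i.findProb (tetrahedron.sdIter α) D) ^ ((24 : ℤ) ^ ℓ * (K.f 3 : ℤ) - (m : ℤ))) ∧
        ∃ c : ℝ, 0 < c ∧ ∀ᶠ ℓ : ℕ in Filter.atTop, c * (ℓ : ℝ) ≤ Real.log (i.E (K.sdIter ℓ)) := by
  classical
  obtain ⟨F, hF1, hX⟩ := expect_X_le.{u}
  set q : ℝ := ((F : ℝ) ^ F)⁻¹ with hq
  set q' : ℝ := (Nat.factorial 8 : ℝ)⁻¹ with hq'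
  have hF : (1 : ℝ) ≤ (F : ℝ) ^ F := one_le_pow₀ (by exact_mod_cast hF1)
  have hq0 : 0 < q := by positivity
  have hq1 : q ≤ 1 := inv_le_one_of_one_le₀ hF
  have hq'0 : 0 < q' := by positivity
  obtain ⟨β, hβ⟩ : ∃ β : ℕ, 1 ≤ ((24 ^ β : ℕ) : ℝ) * (q * q') := by
    obtain ⟨β, hβ⟩ := pow_unbounded_of_one_lt (q * q')⁻¹ (by norm_num : (1 : ℝ) < 24)
    refine ⟨β, ?_⟩
    have := (inv_lt_iff_one_lt_mul₀ (mul_pos hq0 hq'0)).1 hβ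
    push_cast
    linarith
  -- a tetrahedron of the subdivision and its dunce hat
  set L := tetrahedron.sdIter β with hLdef
  have hL : L.DimLE3 := dimLE3_tetrahedron.sdIter β
  obtain ⟨Δ, hΔ, hΔ4⟩ : ∃ Δ ∈ L.faces, Δ.card = 4 := by
    have h1 : 0 < tetrahedron.f 3 := by
      rw [FinComplex.f, Finset.card_pos]
      exact ⟨Finset.univ, Finset.mem_filter.2 ⟨mem_faceFinset.2 Finset.univ_nonempty, by simp⟩⟩
    have h2 : 0 < L.f 3 := lt_of_lt_of_le (by positivity) (f_three_sdIter_le tetrahedron β)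
    rw [FinComplex.f, Finset.card_pos] at h2
    obtain ⟨Δ, hΔ⟩ := h2
    rw [Finset.mem_filter, mem_faceFinset] at hΔ
    exact ⟨Δ, hΔ⟩
  obtain ⟨f, rfl⟩ := exists_embedding_of_card hΔ4
  have hspine := isSpine_hatSd hL hΔ
  have hG := isGadget_hatSd hL hΔ
  have hcell := isCell_hatCell7 hL hΔ
  obtain ⟨-, U, hball⟩ := exists_isBall_sdIter (β + 7)
  have hpos : ∀ i : MorseStrategy, 0 < i.findProb L.sd7 (hatSd f) := fun i =>
    MorseStrategy.findProb_pos hG (hball.hasFreeFaces (dimLE3_tetrahedron.sdIter (β + 7)))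
      hspine.pure i
  have hle : ∀ i : MorseStrategy, i.findProb L.sd7 (hatSd f) ≤ ENNReal.ofReal (1 - q') := by
    intro i
    obtain ⟨τ, hτ⟩ := hG.nonempty
    obtain ⟨s₁, h1, s₂, h2, hne, hs1, hs2, hall⟩ := hG.coface τ hτ
    have hw : IsWall L.sd7 τ s₁ s₂ := ⟨(hG.tri τ hτ).2, (hG.tet _ h1).1, (hG.tet _ h2).1,
      (hG.tet _ h1).2, (hG.tet _ h2).2, hne, hs1, hs2, hall⟩
    exact MorseStrategy.findProb_le hL.sd.sd.sd.sd.sd.sd.sd hw (hG.tri τ hτ).1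
      (mem_triangles.1 hτ).1 i
  refine ⟨β + 7, hatSd f, isDunceHat_hatSd f, fun σ hσ => hcell.sub (hspine.sub hσ), ?_, hpos, ?_⟩
  · refine Set.disjoint_of_subset_left hspine.sub (disjoint_hatCell7 (B := tetrahedronBoundary.sdIter β) ?_)
    intro hmem
    have hB : ∀ n, ∀ σ ∈ (tetrahedronBoundary.sdIter n).faces, σ.card ≤ 3 := by
      intro n
      induction n with
      | zero => exact tetrahedronBoundary_card_le
      | succ n ih => exact sd_card_le ih
    have := hB β _ hmem
    omega
  · intro V K hK i
    have hK3 : K.DimLE3 := hK.1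
    have hf3 : 1 ≤ K.f 3 := by
      obtain ⟨σ, hσ, h4⟩ := hK.2
      exact Finset.card_pos.2 ⟨σ, Finset.mem_filter.2 ⟨mem_faceFinset.2 hσ, h4⟩⟩
    change (∀ ℓ m : ℕ, (i.X (K.sdIter (ℓ + β)).sd7).toOuterMeasure {n | n ≤ m} ≤
          (1 - i.findProb L.sd7 (hatSd f)) ^ ((24 : ℤ) ^ ℓ * (K.f 3 : ℤ) - (m : ℤ))) ∧ _
    set P := i.findProb L.sd7 (hatSd f) with hP
    have hP1 : P ≤ ENNReal.ofReal (1 - q') := hle i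
    have hq'1 : q' < 1 := by
      rw [hq']
      norm_num [Nat.factorial]
    have hPtop : P ≠ ⊤ := (hP1.trans_lt ENNReal.ofReal_lt_top).ne
    set p := P.toReal with hp
    have hp0 : 0 < p := ENNReal.toReal_pos (hpos i).ne' hPtop
    have hp1 : p ≤ 1 - q' := ENNReal.toReal_le_of_le_ofReal (by linarith) hP1
    have hPp : 1 - P = ENNReal.ofReal (1 - p) := by
      rw [ENNReal.ofReal_sub _ hp0.le, ENNReal.ofReal_one, ENNReal.ofReal_toReal hPtop]
    have part1 : ∀ ℓ m : ℕ, (i.X (K.sdIter (ℓ + β)).sd7).toOuterMeasure {n | n ≤ m} ≤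
        (1 - P) ^ ((24 : ℤ) ^ ℓ * (K.f 3 : ℤ) - (m : ℤ)) := by
      intro ℓ m
      have h1 := hX _ (K.sdIter (ℓ + β)) (hK3.sdIter _) i (1 - p) (by linarith) (by linarith)
      have h2 : (1 - (1 - (1 - p)) * q) ^ (K.sdIter (ℓ + β)).f 3 ≤ (1 - p) ^ (24 ^ ℓ * K.f 3) := by
        have e : 1 - (1 - (1 - p)) * q = 1 - p * q := by ring
        have hpq : p * q ≤ 1 := mul_le_one₀ (by linarith) hq0.le hq1
        have h3 : 24 ^ β * (24 ^ ℓ * K.f 3) ≤ (K.sdIter (ℓ + β)).f 3 :=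
          le_of_eq_of_le (by ring) (f_three_sdIter_le K (ℓ + β))
        rw [e]
        calc (1 - p * q) ^ (K.sdIter (ℓ + β)).f 3 ≤ (1 - p * q) ^ (24 ^ β * (24 ^ ℓ * K.f 3)) :=
              pow_le_pow_of_le_one (by linarith) (by nlinarith) h3
          _ = ((1 - p * q) ^ (24 ^ β)) ^ (24 ^ ℓ * K.f 3) := pow_mul _ _ _
          _ ≤ _ := pow_le_pow_left₀ (pow_nonneg (by linarith) _)
              (one_sub_mul_pow_le hp0.le hq0.le hq1 hq'0 hp1 hβ) _
      have h3 := toOuterMeasure_le_of_expect_le (by linarith) (by linarith)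
        (h1.trans (ENNReal.ofReal_le_ofReal h2)) m
      rw [hPp]
      push_cast at h3
      exact h3
    refine ⟨part1, 1, one_pos, ?_⟩
    obtain ⟨n₀, hn₀⟩ := exists_nat_ge (2 * ((β + 7 : ℕ) : ℝ) - Real.log p)
    filter_upwards [Filter.eventually_ge_atTop (n₀ + (β + 7))] with ℓ' hℓ'
    obtain ⟨ℓ, rfl⟩ : ∃ ℓ, ℓ' = ℓ + (β + 7) := ⟨ℓ' - (β + 7), by omega⟩
    have hNpos : 1 ≤ 24 ^ ℓ * K.f 3 := Nat.one_le_iff_ne_zero.2 (by positivity)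
    obtain ⟨N, hN⟩ : ∃ N, 24 ^ ℓ * K.f 3 = N + 1 := ⟨24 ^ ℓ * K.f 3 - 1, by omega⟩
    have h1 := part1 ℓ N
    have hz : (24 : ℤ) ^ ℓ * (K.f 3 : ℤ) - (N : ℤ) = 1 := by
      have : ((24 ^ ℓ * K.f 3 : ℕ) : ℤ) = N + 1 := by rw [hN]; push_cast; rfl
      push_cast at this
      omega
    rw [hz, zpow_one] at h1
    have hPle : P ≤ 1 := hP1.trans (by
      rw [← ENNReal.ofReal_one]
      exact ENNReal.ofReal_le_ofReal (by linarith))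
    have h2 : (N + 1 : ℝ) * p ≤ i.E (K.sdIter (ℓ + (β + 7))) :=
      mul_le_integral_of_toOuterMeasure_le (fun n hn => i.le_of_mem_support_X _ hn) hPle h1
    have h3 : (24 : ℝ) ^ ℓ ≤ N + 1 := by
      have : (24 ^ ℓ : ℕ) ≤ N + 1 := hN ▸ Nat.le_mul_of_pos_right _ hf3
      exact_mod_cast this
    have h4 : Real.log ((24 : ℝ) ^ ℓ * p) ≤ Real.log (i.E (K.sdIter (ℓ + (β + 7)))) :=
      Real.log_le_log (by positivity) ((mul_le_mul_of_nonneg_right h3 hp0.le).trans h2)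
    rw [Real.log_mul (by positivity) hp0.ne', Real.log_pow] at h4
    have h5 := two_le_log
    have h6 : (n₀ : ℝ) ≤ ℓ := by
      have : n₀ ≤ ℓ := by omega
      exact_mod_cast this
    have h7 : (ℓ : ℝ) * 2 ≤ ℓ * Real.log 24 := mul_le_mul_of_nonneg_left h5 (Nat.cast_nonneg ℓ)
    push_cast at hn₀ ⊢
    have h8 : (0 : ℝ) ≤ β := Nat.cast_nonneg β
    linarith
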